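/- Let $\mathcal S$ be a compact smooth 3-manifold without boundary, $m\ge 4$, $\tau_\star<\tau_\bullet$, $\lambda=3$, and let $$\Theta(\tau)=\tfrac12\big(1-(\tau-\tau_0)^2\big),\qquad d_{\bf 0}=\dot\Theta,\quad d_{\bf i}=0\ ({\bf i}=1,2,3),$$ with $\Theta(\tau_\star)\neq0$ (for instance $\tau_0=\tau_\star$, $\tau_\bullet=\tfrac32$). Frame indices ${\bf a},{\bf b},\dots$ range over $0,\dots,3$ and are moved with $\eta=\mathrm{diag}(-1,1,1,1)$. Consider on $\mathcal M=[\tau_\star,\tau_\bullet)\times\mathcal S$ fields of class $C^{m-2}$: vector fields $e_{\bf a}$, and functions $\hat\Gamma_{\bf a}{}^{\bf b}{}_{\bf c}$, $\hat L_{\bf ab}$, $d_{\bf abcd}$, such that, with $f_{\bf a}=\frac14\hat\Gamma_{\bf a}{}^{\bf b}{}_{\bf b}$, one has $\hat\Gamma_{\bf abc}+\hat\Gamma_{\bf acb}=2f_{\bf a}\eta_{\bf bc}$ (where $\hat\Gamma_{\bf abc}=\eta_{\bf be}\hat\Gamma_{\bf a}{}^{\bf e}{}_{\bf c}$), $d_{\bf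 abcd}$ has the algebraic symmetries of a Weyl tensor (including trace-freeness), and the conformal Gaussian gauge conditions $e_{\bf 0}=\partial_\tau$, $\hat\Gamma_{\bf 0}{}^{\bf b}{}_{\bf c}=0$, $\hat L_{\bf 0a}=0$ hold. Put $S_{\bf ab}{}^{\bf cd}=\delta_{\bf a}{}^{\bf c}\delta_{\bf b}{}^{\bf d}+\delta_{\bf a}{}^{\bf d}\delta_{\bf b}{}^{\bf c}-\eta_{\bf ab}\eta^{\bf cd}$; let $\hat\nabla$ be the covariant derivative with coefficients $\hat\Gamma_{\bf a}{}^{\bf b}{}_{\bf c}$ and $\nabla$ the one with coefficients $\hat\Gamma_{\bf a}{}^{\bf b}{}_{\bf c}-S_{\bf ac}{}^{\bf bd}f_{\bf d}$; write $\partial_{\bf a}$ for the derivative along $e_{\bf a}$, $\beta_{\bf a}=\Theta^{-1}d_{\bf a}$, $d^*_{\bf abcd}=\frac12\epsilon_{\bf ab}{}^{\bf ef}d_{\bf cdef}$, and define the zero-quantities $$\hat\Sigma_{\bf a}{}^{\bf c}{}_{\bf b}e_{\bf c}=[e_{\bf a},e_{\bf b}]-(\hat\Gamma_{\bf a}{}^{\bf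 c}{}_{\bf b}-\hat\Gamma_{\bf b}{}^{\bf c}{}_{\bf a})e_{\bf c},$$ $$\hat\Xi^{\bf c}{}_{\bf dab}=\partial_{\bf a}\hat\Gamma_{\bf b}{}^{\bf c}{}_{\bf d}-\partial_{\bf b}\hat\Gamma_{\bf a}{}^{\bf c}{}_{\bf d}+\hat\Gamma_{\bf f}{}^{\bf c}{}_{\bf d}(\hat\Gamma_{\bf b}{}^{\bf f}{}_{\bf a}-\hat\Gamma_{\bf a}{}^{\bf f}{}_{\bf b})+\hat\Gamma_{\bf b}{}^{\bf f}{}_{\bf d}\hat\Gamma_{\bf a}{}^{\bf c}{}_{\bf f}-\hat\Gamma_{\bf a}{}^{\bf f}{}_{\bf d}\hat\Gamma_{\bf b}{}^{\bf c}{}_{\bf f}-\Theta d^{\bf c}{}_{\bf dab}-2S_{\bf d[a}{}^{\bf ce}\hat L_{\bf b]e},$$ $$\hat\Delta_{\bf cdb}=\hat\nabla_{\bf c}\hat L_{\bf db}-\hat\nabla_{\bf d}\hat L_{\bf cb}-d_{\bf a}d^{\bf a}{}_{\bf bcd},\qquad \Lambda_{\bf bcd}=\nabla^{\bf a}d_{\bf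 abcd},\qquad \Lambda^*_{\bf bcd}=\nabla^{\bf a}d^*_{\bf abcd},$$ $$\delta_{\bf a}=d_{\bf a}-\Theta f_{\bf a}-\partial_{\bf a}\Theta,\qquad \gamma_{\bf ab}=\hat L_{\bf ab}+\hat\nabla_{\bf a}\beta_{\bf b}+\tfrac12S_{\bf ab}{}^{\bf cd}\beta_{\bf c}\beta_{\bf d}-\tfrac{\lambda}6\Theta^{-2}\eta_{\bf ab},\qquad \varsigma_{\bf ab}=\hat L_{\bf [ab]}+\hat\nabla_{\bf [a}f_{\bf b]}.$$ Assume that the fields satisfy on $\mathcal M$ the conformal evolution equations $$\hat\Sigma_{\bf 0}{}^{\bf c}{}_{\bf b}e_{\bf c}=0,\quad \hat\Xi^{\bf c}{}_{\bf d0b}=0,\quad \hat\Delta_{\bf 0bc}=0,\quad \Lambda_{({\bf i}|{\bf 0}|{\bf j})}=0,\quad \Lambda^*_{({\bf i}|{\bf 0}|{\bf j})}=0\qquad({\bf i},{\bf j}=1,2,3),$$ and that on the initial hypersurface $\mathcal S_\star=\{\tau_\star\}\times\mathcal S$ the $e_{\bf a}$ form a frame adapted to $\mathcal S_\star$ (linearly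 independent, with $e_{\bf 1},e_{\bf 2},e_{\bf 3}$ tangent to $\mathcal S_\star$) and the zero-quantities $\hat\Sigma,\hat\Xi,\hat\Delta,\Lambda,\delta,\gamma,\varsigma$ all vanish. Then $\{e_{\bf a}\}$ is a frame on all of $\mathcal M$ and, with $\{\omega^{\bf a}\}$ the dual coframe and $g=\eta_{\bf ab}\,\omega^{\bf a}\otimes\omega^{\bf b}$, the metric $$\tilde g=\Theta^{-2}g$$ is, at all points of $\mathcal M$ where $\Theta\neq0$, a Lorentzian metric of class $C^{m-2}$ which solves the vacuum Einstein field equations $\mathrm{Ric}[\tilde g]=3\,\tilde g$. -/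

import Mathlib

open scoped Manifold ContDiff

noncomputable section

namespace ConformalEFE

/-! ### Coordinates and constants -/

/-- The model of the spatial manifold. -/
abbrev Space : Type := EuclideanSpace ℝ (Fin 3)

/-- Spacetime coordinates `(τ, x¹, x², x³)`. -/
abbrev Coord : Type := ℝ × Space

/-- The coordinate vectors `∂_μ`, with `∂_0 = ∂_τ`. -/
def coordVec (μ : Fin 4) : Coord :=
  Fin.cases (motive := fun _ => Coord) ((1 : ℝ), (0 : Space))
    (fun i => ((0 : ℝ), EuclideanSpace.single i (1 : ℝ))) μ

/-- The partial derivative `∂_μ F` at `z` of a function on the domain `D`. The derivative is taken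
within `D`, so that it is one-sided in `τ` at an initial hypersurface `τ = τ_⋆`. -/
def pd (D : Set Coord) (μ : Fin 4) (F : Coord → ℝ) (z : Coord) : ℝ :=
  fderivWithin ℝ F D z (coordVec μ)

/-- The Kronecker delta. -/
def kron (a b : Fin 4) : ℝ := if a = b then 1 else 0

/-- `η = diag(-1, 1, 1, 1)`, which is also its own inverse. -/
def eta (a b : Fin 4) : ℝ := if a = b then (if a = 0 then -1 else 1) else 0

/-- The totally antisymmetric symbol with `ε_{0123} = 1`. -/
def eps (a b c d : Fin 4) : ℝ :=
  Matrix.det (Matrix.of fun i j : Fin 4 => kron (![a, b, c, d] i) j)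

/-- `S_{ab}^{cd} = δ_a^c δ_b^d + δ_a^d δ_b^c - η_{ab} η^{cd}`. -/
def S (a b c d : Fin 4) : ℝ := kron a c * kron b d + kron a d * kron b c - eta a b * eta c d

/-- The cosmological constant. -/
def lam : ℝ := 3

/-- The conformal factor `Θ(τ) = (1 - (τ - τ₀)²) / 2`. -/
def Theta (τ₀ τ : ℝ) : ℝ := (1 - (τ - τ₀) ^ 2) / 2

/-- The components of the gauge covector: `d_0 = dΘ/dτ`, `d_i = 0`. -/
def dcov (τ₀ : ℝ) (a : Fin 4) (z : Coord) : ℝ := if a = 0 then deriv (Theta τ₀) z.1 else 0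

/-! ### The conformal fields in a chart -/

/-- The unknowns of the extended conformal Einstein field equations in a chart:
`e a μ = e_a^μ` (frame coefficients), `Γ a b c = Γ̂_a^b_c` (Weyl connection coefficients),
`L a b = L̂_{ab}` (Schouten tensor of the Weyl connection) and `d a b c e = d_{abce}` (rescaled Weyl
tensor, all frame indices down). -/
structure LocalFields where
  e : Fin 4 → Fin 4 → Coord → ℝ
  Γ : Fin 4 → Fin 4 → Fin 4 → Coord → ℝ
  L : Fin 4 → Fin 4 → Coord → ℝ
  d : Fin 4 → Fin 4 → Fin 4 → Fin 4 → Coord → ℝ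

namespace LocalFields

variable (u : LocalFields) (D : Set Coord)

/-- `∂_a F = e_a^μ ∂_μ F`. -/
def dirD (a : Fin 4) (F : Coord → ℝ) (z : Coord) : ℝ := ∑ μ, u.e a μ z * pd D μ F z

/-- `f_a = (1/4) Γ̂_a^b_b`. -/
def f (a : Fin 4) (z : Coord) : ℝ := (1 / 4) * ∑ b, u.Γ a b b z

/-- The coefficients `Γ_a^b_c = Γ̂_a^b_c - S_{ac}^{bd} f_d` of the metric connection `∇`. -/
def gam (a b c : Fin 4) (z : Coord) : ℝ := u.Γ a b c z - ∑ d, S a c b d * u.f d z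

/-- `∇̂_a w_b` for a covector with frame components `w_b`. -/
def hatNabla₁ (w : Fin 4 → Coord → ℝ) (a b : Fin 4) (z : Coord) : ℝ :=
  u.dirD D a (w b) z - ∑ c, u.Γ a c b z * w c z

/-- `∇̂_a w_{bc}`. -/
def hatNabla₂ (w : Fin 4 → Fin 4 → Coord → ℝ) (a b c : Fin 4) (z : Coord) : ℝ :=
  u.dirD D a (w b c) z - ∑ e, u.Γ a e b z * w e c z - ∑ e, u.Γ a e c z * w b e z

/-- `∇_x w_{abce}`, with the metric connection `∇`. -/
def nabla₄ (w : Fin 4 → Fin 4 → Fin 4 → Fin 4 → Coord → ℝ) (x a b c e : Fin 4) (z : Coord) : ℝ :=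
  u.dirD D x (w a b c e) z - ∑ y, u.gam x y a z * w y b c e z - ∑ y, u.gam x y b z * w a y c e z
    - ∑ y, u.gam x y c z * w a b y e z - ∑ y, u.gam x y e z * w a b c y z

/-- `∇^a w_{abce}`. -/
def div₄ (w : Fin 4 → Fin 4 → Fin 4 → Fin 4 → Coord → ℝ) (b c e : Fin 4) (z : Coord) : ℝ :=
  ∑ x, ∑ a, eta x a * u.nabla₄ D w x a b c e z

/-! ### Zero-quantities -/

/-- The `ν`-th coordinate component of `Σ̂_a^c_b e_c = [e_a, e_b] - (Γ̂_a^c_b - Γ̂_b^c_a) e_c`. -/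
def torsionZero (a b ν : Fin 4) (z : Coord) : ℝ :=
  u.dirD D a (u.e b ν) z - u.dirD D b (u.e a ν) z
    - ∑ c, (u.Γ a c b z - u.Γ b c a z) * u.e c ν z

/-- The geometric curvature `P̂^c_{dab}`. -/
def geomCurv (c d a b : Fin 4) (z : Coord) : ℝ :=
  u.dirD D a (u.Γ b c d) z - u.dirD D b (u.Γ a c d) z
    + ∑ f, u.Γ f c d z * (u.Γ b f a z - u.Γ a f b z)
    + ∑ f, (u.Γ b f d z * u.Γ a c f z - u.Γ a f d z * u.Γ b c f z)

/-- The rescaled Weyl tensor `d^a_{bce}` with its first index up. -/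
def dUp (a b c e : Fin 4) (z : Coord) : ℝ := ∑ x, eta a x * u.d x b c e z

/-- The algebraic curvature `ρ̂^c_{dab} = Θ d^c_{dab} + S_{da}^{ce} L̂_{be} - S_{db}^{ce} L̂_{ae}`. -/
def algCurv (τ₀ : ℝ) (c d a b : Fin 4) (z : Coord) : ℝ :=
  Theta τ₀ z.1 * u.dUp c d a b z + ∑ e, (S d a c e * u.L b e z - S d b c e * u.L a e z)

/-- `Ξ̂^c_{dab} = P̂^c_{dab} - ρ̂^c_{dab}`. -/
def curvZero (τ₀ : ℝ) (c d a b : Fin 4) (z : Coord) : ℝ :=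
  u.geomCurv D c d a b z - u.algCurv τ₀ c d a b z

/-- `Δ̂_{cdb} = ∇̂_c L̂_{db} - ∇̂_d L̂_{cb} - d_a d^a_{bcd}`. -/
def cottonZero (τ₀ : ℝ) (c d b : Fin 4) (z : Coord) : ℝ :=
  u.hatNabla₂ D u.L c d b z - u.hatNabla₂ D u.L d c b z - ∑ a, dcov τ₀ a z * u.dUp a b c d z

/-- `Λ_{bcd} = ∇^a d_{abcd}`. -/
def bianchiZero (b c d : Fin 4) (z : Coord) : ℝ := u.div₄ D u.d b c d z

/-- The Hodge dual `d*_{abcd} = (1/2) ε_{ab}^{ef} d_{cdef}`. -/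
def dualWeyl (a b c d : Fin 4) (z : Coord) : ℝ :=
  (1 / 2) * ∑ e, ∑ f, (∑ x, ∑ y, eps a b x y * eta x e * eta y f) * u.d c d e f z

/-- `Λ*_{bcd} = ∇^a d*_{abcd}`. -/
def dualBianchiZero (b c d : Fin 4) (z : Coord) : ℝ := u.div₄ D u.dualWeyl b c d z

/-- `δ_a = d_a - Θ f_a - ∂_a Θ`. -/
def deltaZero (τ₀ : ℝ) (a : Fin 4) (z : Coord) : ℝ :=
  dcov τ₀ a z - Theta τ₀ z.1 * u.f a z - u.dirD D a (fun y => Theta τ₀ y.1) z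

/-- `β_a = Θ⁻¹ d_a`. -/
def beta (τ₀ : ℝ) (a : Fin 4) (z : Coord) : ℝ := (Theta τ₀ z.1)⁻¹ * dcov τ₀ a z

/-- `γ_{ab} = L̂_{ab} + ∇̂_a β_b + (1/2) S_{ab}^{cd} β_c β_d - (λ/6) Θ⁻² η_{ab}`. -/
def gammaZero (τ₀ : ℝ) (a b : Fin 4) (z : Coord) : ℝ :=
  u.L a b z + u.hatNabla₁ D (beta τ₀) a b z
    + (1 / 2) * ∑ c, ∑ d, S a b c d * beta τ₀ c z * beta τ₀ d z
    - lam / 6 * ((Theta τ₀ z.1) ^ 2)⁻¹ * eta a b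

/-- `ς_{ab} = L̂_{[ab]} + ∇̂_{[a} f_{b]}`. -/
def sigmaZero (a b : Fin 4) (z : Coord) : ℝ :=
  (1 / 2) * (u.L a b z - u.L b a z)
    + (1 / 2) * (u.hatNabla₁ D u.f a b z - u.hatNabla₁ D u.f b a z)

/-! ### Algebraic structure, gauge, evolution equations, constraints -/

/-- The algebraic relations between the components of the unknowns: `Γ̂` is a Weyl connection,
i.e. `∇̂_a g_{bc} = -2 f_a g_{bc}`, and `d_{abce}` has the symmetries of a Weyl tensor. -/
structure Algebraic (z : Coord) : Prop where
  weyl_connection : ∀ a b c,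
    (∑ x, eta b x * u.Γ a x c z) + (∑ x, eta c x * u.Γ a x b z) = 2 * u.f a z * eta b c
  antisymm_left : ∀ a b c e, u.d a b c e z = -u.d b a c e z
  antisymm_right : ∀ a b c e, u.d a b c e z = -u.d a b e c z
  pair_symm : ∀ a b c e, u.d a b c e z = u.d c e a b z
  cyclic : ∀ a b c e, u.d a b c e z + u.d a c e b z + u.d a e b c z = 0
  trace_free : ∀ b e, ∑ a, ∑ c, eta a c * u.d a b c e z = 0

/-- The conformal Gaussian gauge: `e_0 = ∂_τ`, `Γ̂_0^b_c = 0`, `L̂_{0a} = 0`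
(so that also `f_0 = 0`). -/
structure Gauge (z : Coord) : Prop where
  frame : ∀ μ, u.e 0 μ z = kron 0 μ
  connection : ∀ b c, u.Γ 0 b c z = 0
  schouten : ∀ a, u.L 0 a z = 0

/-- The conformal evolution equations: `Σ̂_0^c_b e_c = 0`, `Ξ̂^c_{d0b} = 0`, `Δ̂_{0bc} = 0`,
`Λ_{(i|0|j)} = 0` and `Λ*_{(i|0|j)} = 0`, where `i`, `j` are spatial. -/
structure Evolution (τ₀ : ℝ) (z : Coord) : Prop where
  frame : ∀ b ν, u.torsionZero D 0 b ν z = 0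
  connection : ∀ c d b, u.curvZero D τ₀ c d 0 b z = 0
  schouten : ∀ b c, u.cottonZero D τ₀ 0 b c z = 0
  electric : ∀ i j : Fin 3,
    u.bianchiZero D i.succ 0 j.succ z + u.bianchiZero D j.succ 0 i.succ z = 0
  magnetic : ∀ i j : Fin 3,
    u.dualBianchiZero D i.succ 0 j.succ z + u.dualBianchiZero D j.succ 0 i.succ z = 0

/-- All the zero-quantities of the extended conformal Einstein field equations and of the
supplementary conditions vanish at `z`. -/
structure Constraints (τ₀ : ℝ) (z : Coord) : Prop where
  torsion : ∀ a b ν, u.torsionZero D a b ν z = 0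
  curvature : ∀ c d a b, u.curvZero D τ₀ c d a b z = 0
  cotton : ∀ c d b, u.cottonZero D τ₀ c d b z = 0
  bianchi : ∀ b c d, u.bianchiZero D b c d z = 0
  delta : ∀ a, u.deltaZero D τ₀ a z = 0
  gamma : ∀ a b, u.gammaZero D τ₀ a b z = 0
  sigma : ∀ a b, u.sigmaZero D a b z = 0

/-- The matrix `(e_a^μ)` of the frame. -/
def frameMatrix (z : Coord) : Matrix (Fin 4) (Fin 4) ℝ := Matrix.of fun a μ => u.e a μ z

/-- At a point of the initial hypersurface `{e_a}` is a frame adapted to that hypersurface: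
`e_0 = ∂_τ` (by the gauge) is its unit normal, so that `e_1, e_2, e_3` are tangent to it. -/
structure AdaptedFrame (z : Coord) : Prop where
  nondegenerate : (u.frameMatrix z).det ≠ 0
  tangent : ∀ i : Fin 3, u.e i.succ 0 z = 0

/-- All components are of class `C^k` on `D`. -/
structure Regular (k : ℕ) : Prop where
  e : ∀ a μ, ContDiffOn ℝ k (u.e a μ) D
  Γ : ∀ a b c, ContDiffOn ℝ k (u.Γ a b c) D
  L : ∀ a b, ContDiffOn ℝ k (u.L a b) D
  d : ∀ a b c e, ContDiffOn ℝ k (u.d a b c e) D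

/-- The unphysical metric `g = η_{ab} ω^a ⊗ ω^b` in coordinates, where `{ω^a}` is the coframe
dual to `{e_a}`: `ω^a_μ` is the entry `(μ, a)` of the inverse of the matrix `(e_a^μ)`. -/
def metric (z : Coord) : Matrix (Fin 4) (Fin 4) ℝ :=
  Matrix.of fun μ ν =>
    ∑ a, ∑ b, eta a b * (u.frameMatrix z)⁻¹ μ a * (u.frameMatrix z)⁻¹ ν b

/-- The physical metric `g̃ = Θ⁻² g` in coordinates. -/
def physMetric (τ₀ : ℝ) (z : Coord) : Matrix (Fin 4) (Fin 4) ℝ :=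
  ((Theta τ₀ z.1) ^ 2)⁻¹ • u.metric z

end LocalFields

/-! ### Metrics in coordinates and the Einstein field equations -/

/-- The Christoffel symbol `Γ^l_{μν}` of a metric `g` given in coordinates on `D`. -/
def christoffel (D : Set Coord) (g : Coord → Matrix (Fin 4) (Fin 4) ℝ) (l μ ν : Fin 4)
    (z : Coord) : ℝ :=
  (1 / 2) * ∑ s, (g z)⁻¹ l s *
    (pd D μ (fun y => g y s ν) z + pd D ν (fun y => g y s μ) z - pd D s (fun y => g y μ ν) z)

/-- The Ricci tensor `R_{μν}` of a metric `g` given in coordinates on `D`. -/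
def ricci (D : Set Coord) (g : Coord → Matrix (Fin 4) (Fin 4) ℝ) (μ ν : Fin 4)
    (z : Coord) : ℝ :=
  ∑ l, (pd D l (christoffel D g l μ ν) z - pd D ν (christoffel D g l μ l) z)
    + ∑ l, ∑ s, (christoffel D g l l s z * christoffel D g s μ ν z
        - christoffel D g l ν s z * christoffel D g s μ l z)

/-- The symmetric bilinear form with matrix `A` is nondegenerate of signature `(-+++)`. -/
def IsLorentzian (A : Matrix (Fin 4) (Fin 4) ℝ) : Prop :=
  ∃ P : Matrix (Fin 4) (Fin 4) ℝ, P.det ≠ 0 ∧ A = P.transpose * Matrix.of eta * P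

/-- `g` is, in coordinates on `D`, a Lorentzian metric of class `C^k` which satisfies the vacuum
Einstein field equations `R_{μν} = l g_{μν}`. -/
structure SolvesVacuumEFE (k : ℕ) (l : ℝ) (D : Set Coord)
    (g : Coord → Matrix (Fin 4) (Fin 4) ℝ) : Prop where
  regular : ∀ μ ν, ContDiffOn ℝ k (fun z => g z μ ν) D
  lorentzian : ∀ z ∈ D, IsLorentzian (g z)
  einstein : ∀ z ∈ D, ∀ μ ν, ricci D g μ ν z = l * g z μ ν

/-! ### The conformal fields on `ℝ × M` -/

section Manifold

variable (M : Type*) [TopologicalSpace M] [ChartedSpace Space M]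

/-- The unknowns on the spacetime manifold: four vector fields `e_a` on `ℝ × M`, and the components
of the other fields with respect to them. Only their values on `[τ_⋆, τ_•) × M` are ever used. -/
structure Fields where
  e : Fin 4 → (p : ℝ × M) → ℝ × TangentSpace (𝓡 3) p.2
  Γ : Fin 4 → Fin 4 → Fin 4 → ℝ × M → ℝ
  L : Fin 4 → Fin 4 → ℝ × M → ℝ
  d : Fin 4 → Fin 4 → Fin 4 → Fin 4 → ℝ × M → ℝ

variable {M}

/-- The point with coordinates `z` in the chart `id × φ` of `ℝ × M`. -/
def chartPoint (φ : OpenPartialHomeomorph M Space) (z : Coord) : ℝ × M := (z.1, φ.symm z.2)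

/-- The region `[τ_⋆, τ_•) × M` in the chart `id × φ`. -/
def chartDomain (τs τe : ℝ) (φ : OpenPartialHomeomorph M Space) : Set Coord :=
  Set.Ico τs τe ×ˢ φ.target

/-- The expression of the fields in the chart `id × φ`. -/
def Fields.inChart (u : Fields M) (φ : OpenPartialHomeomorph M Space) : LocalFields where
  e a μ z :=
    let p := chartPoint φ z
    let v : Space := mfderiv (𝓡 3) (𝓡 3) φ p.2 (u.e a p).2
    Fin.cases (motive := fun _ => ℝ) (u.e a p).1 (fun i => v i) μ
  Γ a b c z := u.Γ a b c (chartPoint φ z)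
  L a b z := u.L a b (chartPoint φ z)
  d a b c e z := u.d a b c e (chartPoint φ z)

/-- `u` is a `C^k` solution on `[τ_⋆, τ_•) × M` of the conformal evolution equations in the
conformal Gaussian gauge with conformal factor `Θ(τ) = (1 - (τ - τ₀)²) / 2`. -/
def Fields.IsEvolutionSolution (u : Fields M) (k : ℕ) (τ₀ τs τe : ℝ) : Prop :=
  ∀ φ ∈ IsManifold.maximalAtlas (𝓡 3) ∞ M,
    (u.inChart φ).Regular (chartDomain τs τe φ) k ∧
    ∀ z ∈ chartDomain τs τe φ,
      (u.inChart φ).Algebraic z ∧ (u.inChart φ).Gauge z ∧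
      (u.inChart φ).Evolution (chartDomain τs τe φ) τ₀ z

/-- On the initial hypersurface `{τ_⋆} × M` the frame is adapted to the hypersurface, and all the
zero-quantities vanish. -/
def Fields.HasConstrainedData (u : Fields M) (τ₀ τs τe : ℝ) : Prop :=
  ∀ φ ∈ IsManifold.maximalAtlas (𝓡 3) ∞ M, ∀ z ∈ chartDomain τs τe φ, z.1 = τs →
    (u.inChart φ).AdaptedFrame z ∧ (u.inChart φ).Constraints (chartDomain τs τe φ) τ₀ z

/-- The part of `[τ_⋆, τ_•) × M` where `Θ ≠ 0`, in the chart `id × φ`. -/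
def physDomain (τ₀ τs τe : ℝ) (φ : OpenPartialHomeomorph M Space) : Set Coord :=
  {z ∈ chartDomain τs τe φ | Theta τ₀ z.1 ≠ 0}

end Manifold

end ConformalEFE

end

/-! The theorem is a propagation of constraints. In the conformal Gaussian gauge the evolution
equations of $e$, $\hat\Gamma$, $\hat L$ are ordinary differential equations along $\partial_\tau$.
The quantities $\hat L_{b0}$, $f_a$, $e_i{}^0$, then $\Theta\ell+(\tau-\tau_0)\chi-\delta$, then
$[\chi,\ell]$ and the antisymmetric parts of $\chi$ and $\ell$ each satisfy a homogeneous linear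
one, where $\chi_{ij}=\hat\Gamma_i{}^j{}_0$ and $\ell_{ij}=\hat L_{ij}$. They vanish initially,
hence always (`eq_zero_of_linear_evolution`). The connection is therefore metric. The same argument
run backwards in $\tau$ shows that the frame cannot degenerate.

What remains is described by the spatial frame $X$, the dualised spatial connection $n$, the
electric and magnetic parts $E$, $B$, and $K=\Theta'\ell+2\chi$. Since $\Theta'^2+2\Theta=1$, one
recovers $\chi=\Theta K-\Theta'\delta$ and $\ell=\Theta'K+2\delta$. The reduced system is thus
polynomial in $\Theta,\Theta'$ and regular where $\Theta=0$. The remaining zero-quantities become a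
torsion `T`, a Gauss constraint `R`, a Codazzi constraint `Y` for $K$, and the divergences `P`, `Q`
of $E$, $B$.

These satisfy a closed homogeneous system: transport equations for `T`, `R`, `Y` (`dt_T`, `dt_R`,
`dt_Y`), and for $P+iQ$ a Maxwell-like system whose principal part is a curl (`dt_Pi`). With the sum
of squares as energy and the Poynting-type vector $P\times Q$ as flux, the derivatives of the
zero-quantities cancel in the divergence (`isDominated_divergence`). A weighted divergence theorem
on a box (`energy_estimate`) then gives vanishing in a small domain of dependence. The vanishing is
chart independent (`chartEnergy_eq_zero`), and compactness of the spatial manifold makes the gain in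
time uniform, so a continuity argument in $\tau$ covers the whole interval
(`chartEnergy_propagation`).

Once torsion and curvature zero-quantities vanish, $\Theta e_a$ is an orthonormal frame of $\tilde
g$ with a known torsion-free metric connection (`isMetricFrame`). The coordinate Ricci tensor is the
contraction of its frame curvature (`ricci_eq`). That contraction equals $3\eta$ by trace-freeness
of $d$ and the relation between $\ell$ and $\chi$ (`ricci_trace`). -/

namespace ConformalEFE

/-! ### Directional derivatives within a domain -/

/-- A set on which derivatives are unique and second derivatives are symmetric. -/
structure IsRegularDomain (D : Set Coord) : Prop where
  uniqueDiffOn : UniqueDiffOn ℝ D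
  subset_closure : D ⊆ closure (interior D)

section der

variable {V : Type*} [NormedAddCommGroup V] [NormedSpace ℝ V]
variable {𝔸 : Type*} [NormedCommRing 𝔸] [NormedAlgebra ℝ 𝔸]

/-- The derivative within `D` of `F` at `z` in the direction `v`. -/
noncomputable def der (D : Set Coord) (v : Coord) (F : Coord → V) (z : Coord) : V :=
  fderivWithin ℝ F D z v

variable {D : Set Coord} {z v w : Coord} {F G : Coord → V} {a b : Coord → 𝔸}

theorem der_congr (h : ∀ y ∈ D, F y = G y) (hz : z ∈ D) : der D v F z = der D v G z := by
  unfold der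
  rw [fderivWithin_congr h (h z hz)]

theorem der_dir_add : der D (v + w) F z = der D v F z + der D w F z := by
  simp [der]

theorem der_dir_sub : der D (v - w) F z = der D v F z - der D w F z := by
  simp [der]

theorem der_dir_neg : der D (-v) F z = -der D v F z := by
  simp [der]

theorem der_dir_smul (r : ℝ) : der D (r • v) F z = r • der D v F z := by
  simp [der]

theorem der_dir_zero : der D 0 F z = 0 := by
  simp [der]

theorem der_dir_sum {ι : Type*} (s : Finset ι) (X : ι → Coord) :
    der D (∑ i ∈ s, X i) F z = ∑ i ∈ s, der D (X i) F z := by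
  simp [der]

theorem der_const (c : V) : der D v (fun _ => c) z = 0 := by
  simp [der]

theorem der_zero_fun (h : ∀ y ∈ D, F y = 0) (hz : z ∈ D) : der D v F z = 0 := by
  rw [der_congr h hz, der_const]

theorem der_add (hu : UniqueDiffWithinAt ℝ D z) (hF : DifferentiableWithinAt ℝ F D z)
    (hG : DifferentiableWithinAt ℝ G D z) :
    der D v (fun y => F y + G y) z = der D v F z + der D v G z := by
  simp [der, fderivWithin_fun_add hu hF hG]

theorem der_sub (hu : UniqueDiffWithinAt ℝ D z) (hF : DifferentiableWithinAt ℝ F D z)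
    (hG : DifferentiableWithinAt ℝ G D z) :
    der D v (fun y => F y - G y) z = der D v F z - der D v G z := by
  simp [der, fderivWithin_fun_sub hu hF hG]

theorem der_neg (hu : UniqueDiffWithinAt ℝ D z) :
    der D v (fun y => -F y) z = -der D v F z := by
  simp [der, fderivWithin_fun_neg hu]

theorem der_mul (hu : UniqueDiffWithinAt ℝ D z) (ha : DifferentiableWithinAt ℝ a D z)
    (hb : DifferentiableWithinAt ℝ b D z) :
    der D v (fun y => a y * b y) z = der D v a z * b z + a z * der D v b z := by
  simp [der, fderivWithin_fun_mul hu ha hb]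
  ring

theorem der_smul {r : Coord → ℝ} (hu : UniqueDiffWithinAt ℝ D z)
    (hr : DifferentiableWithinAt ℝ r D z) (hF : DifferentiableWithinAt ℝ F D z) :
    der D v (fun y => r y • F y) z = der D v r z • F z + r z • der D v F z := by
  simp [der, fderivWithin_fun_smul hu hr hF, add_comm]

theorem der_sum {ι : Type*} (s : Finset ι) {f : ι → Coord → V} (hu : UniqueDiffWithinAt ℝ D z)
    (hf : ∀ i ∈ s, DifferentiableWithinAt ℝ (f i) D z) :
    der D v (fun y => ∑ i ∈ s, f i y) z = ∑ i ∈ s, der D v (f i) z := by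
  simp [der, fderivWithin_fun_sum hu hf]

theorem der_clm {W : Type*} [NormedAddCommGroup W] [NormedSpace ℝ W] (l : V →L[ℝ] W)
    (hu : UniqueDiffWithinAt ℝ D z) (hF : DifferentiableWithinAt ℝ F D z) :
    der D v (fun y => l (F y)) z = l (der D v F z) := by
  have := (l.hasFDerivAt.comp_hasFDerivWithinAt z hF.hasFDerivWithinAt).fderivWithin hu
  unfold der
  rw [show (fun y => l (F y)) = l ∘ F from rfl, this]
  rfl

theorem der_ofReal {f : Coord → ℝ} (hu : UniqueDiffWithinAt ℝ D z)
    (hf : DifferentiableWithinAt ℝ f D z) :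
    der D v (fun y => (f y : ℂ)) z = ((der D v f z : ℝ) : ℂ) :=
  der_clm Complex.ofRealCLM hu hf

theorem contDiffOn_der {X : Coord → Coord} {k l : ℕ} (hD : UniqueDiffOn ℝ D)
    (hF : ContDiffOn ℝ l F D) (hX : ContDiffOn ℝ k X D) (hkl : k + 1 ≤ l) :
    ContDiffOn ℝ k (fun y => der D (X y) F y) D :=
  (hF.fderivWithin hD (by exact_mod_cast hkl)).clm_apply hX

/-- The direction is itself a function of the point, so the product rule gives the second derivative
plus a derivative along the differentiated direction. Only the first part is symmetric, and the
second is what survives in a commutator. -/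
theorem der_der {X : Coord → Coord} (hu : UniqueDiffOn ℝ D) (hz : z ∈ D)
    (hF : ContDiffOn ℝ 2 F D) (hX : DifferentiableWithinAt ℝ X D z) :
    der D v (fun y => der D (X y) F y) z
      = fderivWithin ℝ (fderivWithin ℝ F D) D z v (X z) + der D (der D v X z) F z := by
  have h1 : DifferentiableWithinAt ℝ (fderivWithin ℝ F D) D z :=
    ((hF.fderivWithin hu (m := 1) (by norm_num)).differentiableOn (by norm_num)) z hz
  have := (h1.hasFDerivWithinAt.clm_apply hX.hasFDerivWithinAt).fderivWithin (hu z hz)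
  unfold der
  rw [this]
  simp [add_comm]

/-- The commutator of two vector fields acts as their Lie bracket. -/
theorem der_comm {X Y : Coord → Coord} (hD : IsRegularDomain D) (hz : z ∈ D)
    (hF : ContDiffOn ℝ 2 F D) (hX : DifferentiableWithinAt ℝ X D z)
    (hY : DifferentiableWithinAt ℝ Y D z) :
    der D (X z) (fun y => der D (Y y) F y) z - der D (Y z) (fun y => der D (X y) F y) z
      = der D (der D (X z) Y z - der D (Y z) X z) F z := by
  rw [der_der hD.uniqueDiffOn hz hF hX, der_der hD.uniqueDiffOn hz hF hY,
    ((hF z hz).isSymmSndFDerivWithinAt (by simp) hD.uniqueDiffOn (hD.subset_closure hz) hz) (X z) (Y z),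
    der_dir_sub]
  abel

end der

/-! ### The reduced system -/

/-- Spatial indices are written as `m`, `m + 1`, `m + 2` modulo 3. Cross products and duals then
need no permutation symbol, and one identity in a free `m` with three positions of the second index
covers all components. -/
theorem sum_cyclic {A : Type*} [AddCommMonoid A] (m : Fin 3) (f : Fin 3 → A) :
    ∑ i, f i = f m + f (m + 1) + f (m + 2) := by
  fin_cases m <;> simp [Fin.sum_univ_three] <;> abel

theorem fin3_cyclic (m k : Fin 3) : k = m ∨ k = m + 1 ∨ k = m + 2 := by
  decide +revert

theorem fin3_add_one_add_one (m : Fin 3) : m + 1 + 1 = m + 2 := by decide +revert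
theorem fin3_add_one_add_two (m : Fin 3) : m + 1 + 2 = m := by decide +revert
theorem fin3_add_two_add_one (m : Fin 3) : m + 2 + 1 = m := by decide +revert
theorem fin3_add_two_add_two (m : Fin 3) : m + 2 + 2 = m + 1 := by decide +revert

theorem fin3_ne_cyclic (m : Fin 3) : m ≠ m + 1 ∧ m ≠ m + 2 ∧ m + 2 ≠ m + 1 := by decide +revert

/-- Trace-freeness in the form of a substitution eliminating one diagonal component, so that the
remaining components can be treated as independent. -/
theorem last_of_sum_eq_zero (m : Fin 3) {f : Fin 3 → ℝ} (h : ∑ i, f i = 0) :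
    f (m + 2) = -f m - f (m + 1) := by
  rw [sum_cyclic m] at h
  linear_combination h

/-- The Kronecker delta on spatial indices. -/
def delta (i j : Fin 3) : ℝ := if i = j then 1 else 0

theorem delta_self (i : Fin 3) : delta i i = 1 := by simp [delta]
theorem delta_add_one (i : Fin 3) : delta i (i + 1) = 0 := by
  have : ¬ i = i + 1 := by decide +revert
  simp [delta, this]
theorem delta_add_two (i : Fin 3) : delta i (i + 2) = 0 := by
  have : ¬ i = i + 2 := by decide +revert
  simp [delta, this]
theorem delta_comm (i j : Fin 3) : delta i j = delta j i := by
  simp [delta, eq_comm]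
theorem delta_add_one_left (i : Fin 3) : delta (i + 1) i = 0 := by
  rw [delta_comm, delta_add_one]
theorem delta_add_two_left (i : Fin 3) : delta (i + 2) i = 0 := by
  rw [delta_comm, delta_add_two]
theorem delta_one_two (i : Fin 3) : delta (i + 1) (i + 2) = 0 := by
  have : ¬ i + 1 = i + 2 := by decide +revert
  simp [delta, this]
theorem delta_two_one (i : Fin 3) : delta (i + 2) (i + 1) = 0 := by
  rw [delta_comm, delta_one_two]

/-- The cross product. -/
def cross {A : Type*} [Ring A] (a b : Fin 3 → A) (i : Fin 3) : A :=
  a (i + 1) * b (i + 2) - a (i + 2) * b (i + 1)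

/-- The variables of the reduced system: the spatial frame `X`, the connection `n` of the
hypersurfaces of constant `τ`, the rescaled second fundamental form `K`, the electric part `E` and
the magnetic part `B` of the rescaled Weyl tensor, the conformal factor `th` and its derivative
`th'`. -/
structure Reduced where
  X : Fin 3 → Coord → Coord
  n : Fin 3 → Fin 3 → Coord → ℝ
  K : Fin 3 → Fin 3 → Coord → ℝ
  E : Fin 3 → Fin 3 → Coord → ℝ
  B : Fin 3 → Fin 3 → Coord → ℝ
  th : Coord → ℝ
  th' : Coord → ℝ

/-- The vector field `∂_τ`. -/
def tvec : Coord := ((1 : ℝ), (0 : Space))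

namespace Reduced

variable (w : Reduced) (D : Set Coord)

/-- The second fundamental form of the hypersurfaces of constant `τ`. -/
def χ (i j : Fin 3) (z : Coord) : ℝ := w.th z * w.K i j z - w.th' z * delta i j

/-- The derivative along the frame. -/
noncomputable def dX {V : Type*} [NormedAddCommGroup V] [NormedSpace ℝ V] (i : Fin 3)
    (F : Coord → V) (z : Coord) : V :=
  der D (w.X i z) F z

/-- The covariant derivative of the electric part. -/
noncomputable def nabE (k i j : Fin 3) (z : Coord) : ℝ :=
  w.dX D k (w.E i j) z
    + (cross (fun l => w.n k l z) (fun l => w.E l j z) i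
      + cross (fun l => w.n k l z) (fun l => w.E i l z) j)
    - (cross (fun l => w.χ k l z) (fun l => w.B l j z) i
      + cross (fun l => w.χ k l z) (fun l => w.B i l z) j)

/-- The covariant derivative of the magnetic part. -/
noncomputable def nabB (k i j : Fin 3) (z : Coord) : ℝ :=
  w.dX D k (w.B i j) z
    + (cross (fun l => w.n k l z) (fun l => w.B l j z) i
      + cross (fun l => w.n k l z) (fun l => w.B i l z) j)
    + (cross (fun l => w.χ k l z) (fun l => w.E l j z) i
      + cross (fun l => w.χ k l z) (fun l => w.E i l z) j)

/-- Deliberately not symmetrised: the symmetric part drives the evolution of $B$, while the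
antisymmetric part is, for symmetric trace-free fields, a divergence. -/
noncomputable def curlE (i j : Fin 3) (z : Coord) : ℝ :=
  w.nabE D (i + 1) (i + 2) j z - w.nabE D (i + 2) (i + 1) j z

noncomputable def curlB (i j : Fin 3) (z : Coord) : ℝ :=
  w.nabB D (i + 1) (i + 2) j z - w.nabB D (i + 2) (i + 1) j z

/-- The divergence constraint of the electric part. -/
noncomputable def P (j : Fin 3) (z : Coord) : ℝ := ∑ i, w.nabE D i i j z

/-- The divergence constraint of the magnetic part. -/
noncomputable def Q (j : Fin 3) (z : Coord) : ℝ := ∑ i, w.nabB D i i j z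

/-- The trace of the connection. -/
def trn (z : Coord) : ℝ := ∑ i, w.n i i z

def trK (z : Coord) : ℝ := ∑ i, w.K i i z

def trχ (z : Coord) : ℝ := ∑ i, w.χ i i z

/-- The torsion of the spatial connection, dualised. -/
noncomputable def T (m : Fin 3) (z : Coord) : Coord :=
  w.dX D (m + 1) (w.X (m + 2)) z - w.dX D (m + 2) (w.X (m + 1)) z
    + ∑ f, w.n f m z • w.X f z - w.trn z • w.X m z

/-- The Gauss constraint. -/
noncomputable def R (m k : Fin 3) (z : Coord) : ℝ :=
  w.dX D (m + 1) (w.n (m + 2) k) z - w.dX D (m + 2) (w.n (m + 1) k) z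
    + cross (fun l => w.n (m + 1) l z) (fun l => w.n (m + 2) l z) k
    + ∑ f, w.n f m z * w.n f k z - w.trn z * w.n m k z
    - cross (fun l => w.χ (m + 1) l z) (fun l => w.χ (m + 2) l z) k
    - w.th z * w.E m k z - w.th' z * (w.K m k z - delta m k * w.trK z) + 4 * delta m k

/-- The Codazzi constraint. -/
noncomputable def Y (m k : Fin 3) (z : Coord) : ℝ :=
  w.dX D (m + 1) (w.K (m + 2) k) z - w.dX D (m + 2) (w.K (m + 1) k) z
    + cross (fun l => w.n (m + 1) l z) (fun l => w.K (m + 2) l z) k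
    - cross (fun l => w.n (m + 2) l z) (fun l => w.K (m + 1) l z) k
    + ∑ f, w.n f m z * w.K f k z - w.trn z * w.K m k z - w.B m k z

/-- The right-hand side of the evolution equation of `K`. -/
def rhsK (i j : Fin 3) (z : Coord) : ℝ :=
  -(∑ l, w.χ i l z * w.K l j z) + w.th' z * w.K i j z + 2 * delta i j - w.E i j z

/-- The right-hand side of the evolution equation of `n`. -/
def rhsn (i j : Fin 3) (z : Coord) : ℝ :=
  -(∑ l, w.χ i l z * w.n l j z) + w.th z * w.B i j z

/-- The reduced evolution equations. -/
structure Solves : Prop where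
  dom : IsRegularDomain D
  smooth_X : ∀ i, ContDiffOn ℝ 2 (w.X i) D
  smooth_n : ∀ i j, ContDiffOn ℝ 2 (w.n i j) D
  smooth_K : ∀ i j, ContDiffOn ℝ 2 (w.K i j) D
  smooth_E : ∀ i j, ContDiffOn ℝ 2 (w.E i j) D
  smooth_B : ∀ i j, ContDiffOn ℝ 2 (w.B i j) D
  smooth_th : ContDiffOn ℝ 2 w.th D
  smooth_th' : ContDiffOn ℝ 2 w.th' D
  symm_K : ∀ i j, ∀ z ∈ D, w.K i j z = w.K j i z
  symm_E : ∀ i j, ∀ z ∈ D, w.E i j z = w.E j i z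
  symm_B : ∀ i j, ∀ z ∈ D, w.B i j z = w.B j i z
  trace_E : ∀ z ∈ D, ∑ i, w.E i i z = 0
  trace_B : ∀ z ∈ D, ∑ i, w.B i i z = 0
  th_sq : ∀ z ∈ D, w.th' z ^ 2 = 1 - 2 * w.th z
  dt_th : ∀ z ∈ D, der D tvec w.th z = w.th' z
  dt_th' : ∀ z ∈ D, der D tvec w.th' z = -1
  dX_th : ∀ i, ∀ z ∈ D, w.dX D i w.th z = 0
  dX_th' : ∀ i, ∀ z ∈ D, w.dX D i w.th' z = 0
  dt_X : ∀ i, ∀ z ∈ D, der D tvec (w.X i) z = -∑ l, w.χ i l z • w.X l z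
  dt_n : ∀ i j, ∀ z ∈ D, der D tvec (w.n i j) z = w.rhsn i j z
  dt_K : ∀ i j, ∀ z ∈ D, der D tvec (w.K i j) z = w.rhsK i j z
  dt_E : ∀ i j, ∀ z ∈ D, der D tvec (w.E i j) z = (w.curlB D i j z + w.curlB D j i z) / 2
  dt_B : ∀ i j, ∀ z ∈ D, der D tvec (w.B i j) z = -((w.curlE D i j z + w.curlE D j i z) / 2)

variable {w D}

namespace Solves

variable {z : Coord} (h : w.Solves D)
include h

theorem ud (hz : z ∈ D) : UniqueDiffWithinAt ℝ D z := h.dom.uniqueDiffOn z hz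

theorem diff_X (hz : z ∈ D) (i : Fin 3) : DifferentiableWithinAt ℝ (w.X i) D z :=
  (h.smooth_X i).differentiableOn (by norm_num) z hz

theorem diff_n (hz : z ∈ D) (i j : Fin 3) : DifferentiableWithinAt ℝ (w.n i j) D z :=
  (h.smooth_n i j).differentiableOn (by norm_num) z hz

theorem diff_K (hz : z ∈ D) (i j : Fin 3) : DifferentiableWithinAt ℝ (w.K i j) D z :=
  (h.smooth_K i j).differentiableOn (by norm_num) z hz

theorem diff_E (hz : z ∈ D) (i j : Fin 3) : DifferentiableWithinAt ℝ (w.E i j) D z :=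
  (h.smooth_E i j).differentiableOn (by norm_num) z hz

theorem diff_B (hz : z ∈ D) (i j : Fin 3) : DifferentiableWithinAt ℝ (w.B i j) D z :=
  (h.smooth_B i j).differentiableOn (by norm_num) z hz

theorem diff_th (hz : z ∈ D) : DifferentiableWithinAt ℝ w.th D z :=
  h.smooth_th.differentiableOn (by norm_num) z hz

theorem diff_th' (hz : z ∈ D) : DifferentiableWithinAt ℝ w.th' D z :=
  h.smooth_th'.differentiableOn (by norm_num) z hz

theorem diff_χ (hz : z ∈ D) (i j : Fin 3) : DifferentiableWithinAt ℝ (w.χ i j) D z :=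
  ((h.diff_th hz).mul (h.diff_K hz i j)).sub ((h.diff_th' hz).mul_const _)

theorem contDiffOn_dX {V : Type*} [NormedAddCommGroup V] [NormedSpace ℝ V] {F : Coord → V}
    (hF : ContDiffOn ℝ 2 F D) (i : Fin 3) : ContDiffOn ℝ 1 (w.dX D i F) D :=
  contDiffOn_der (k := 1) (l := 2) h.dom.uniqueDiffOn hF ((h.smooth_X i).of_le (by norm_num))
    (by norm_num)

theorem diff_dX {V : Type*} [NormedAddCommGroup V] [NormedSpace ℝ V] {F : Coord → V}
    (hF : ContDiffOn ℝ 2 F D) (i : Fin 3) (hz : z ∈ D) :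
    DifferentiableWithinAt ℝ (w.dX D i F) D z :=
  (h.contDiffOn_dX hF i).differentiableOn (by norm_num) z hz

/-- The equation for $\partial_\tau X_i$ is the commutator $[\partial_\tau,X_i]=-\chi_i{}^lX_l$. -/
theorem dt_dX {V : Type*} [NormedAddCommGroup V] [NormedSpace ℝ V] {F : Coord → V}
    (hF : ContDiffOn ℝ 2 F D) (i : Fin 3) (hz : z ∈ D) :
    der D tvec (w.dX D i F) z
      = w.dX D i (der D tvec F) z - ∑ l, w.χ i l z • w.dX D l F z := by
  have := der_comm (X := fun _ => tvec) (Y := w.X i) h.dom hz hF (differentiableWithinAt_const _)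
    (h.diff_X hz i)
  simp only [der_const, sub_zero] at this
  rw [h.dt_X i z hz, der_dir_neg, der_dir_sum] at this
  simp only [der_dir_smul] at this
  rw [sub_eq_iff_eq_add] at this
  exact this.trans (by simp only [dX]; rw [neg_add_eq_sub])

/-- $\Theta$ and $\Theta'$ are constant along the spatial frame. -/
theorem dX_χ (hz : z ∈ D) (i j k : Fin 3) :
    w.dX D i (w.χ j k) z = w.th z * w.dX D i (w.K j k) z := by
  have e1 := h.dX_th i z hz
  have e2 := h.dX_th' i z hz
  unfold dX at *
  unfold χ
  have a1 := h.diff_K hz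
  have a2 := h.diff_th hz
  have a3 := h.diff_th' hz
  rw [der_sub (h.ud hz) (by fun_prop) (by fun_prop), der_mul (h.ud hz) (by fun_prop) (by fun_prop),
    der_mul (h.ud hz) (by fun_prop) (by fun_prop), e1, e2, der_const]
  ring

theorem dX_rhsK (hz : z ∈ D) (i j k : Fin 3) :
    w.dX D i (der D tvec (w.K j k)) z
      = -(∑ l, (w.th z * w.dX D i (w.K j l) z * w.K l k z + w.χ j l z * w.dX D i (w.K l k) z))
        + w.th' z * w.dX D i (w.K j k) z - w.dX D i (w.E j k) z := by
  have e2 := h.dX_th' i z hz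
  have e3 := fun a b => h.dX_χ hz i a b
  unfold dX at *
  rw [der_congr (h.dt_K j k) hz]
  unfold rhsK
  have hu := h.ud hz
  have a1 := h.diff_K hz
  have a2 := h.diff_χ hz
  have a3 := h.diff_th' hz
  have a4 := h.diff_E hz
  rw [der_sub hu (by fun_prop) (by fun_prop), der_add hu (by fun_prop) (by fun_prop),
    der_add hu (by fun_prop) (by fun_prop), der_neg hu, der_sum _ hu (fun l _ => by fun_prop),
    der_mul hu (by fun_prop) (by fun_prop), der_const, e2]
  simp only [der_mul hu (a2 _ _) (a1 _ _), e3]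
  ring

theorem dX_rhsn (hz : z ∈ D) (i j k : Fin 3) :
    w.dX D i (der D tvec (w.n j k)) z
      = -(∑ l, (w.th z * w.dX D i (w.K j l) z * w.n l k z + w.χ j l z * w.dX D i (w.n l k) z))
        + w.th z * w.dX D i (w.B j k) z := by
  have e2 := h.dX_th i z hz
  have e3 := fun a b => h.dX_χ hz i a b
  unfold dX at *
  rw [der_congr (h.dt_n j k) hz]
  unfold rhsn
  have hu := h.ud hz
  have a1 := h.diff_n hz
  have a2 := h.diff_χ hz
  have a3 := h.diff_th hz
  have a4 := h.diff_B hz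
  rw [der_add hu (by fun_prop) (by fun_prop), der_neg hu, der_sum _ hu (fun l _ => by fun_prop),
    der_mul hu (by fun_prop) (by fun_prop), e2]
  simp only [der_mul hu (a2 _ _) (a1 _ _), e3]
  ring

end Solves

end Reduced

/-! ### Transport equations of the Codazzi, Gauss and torsion constraints. -/

namespace Reduced
variable {w : Reduced} {D : Set Coord}
namespace Solves
variable {z : Coord} (h : w.Solves D)
include h

theorem dt_Y_expand (hz : z ∈ D) (m k : Fin 3) :
    der D tvec (w.Y D m k) z
      = der D tvec (w.dX D (m + 1) (w.K (m + 2) k)) z - der D tvec (w.dX D (m + 2) (w.K (m + 1) k)) z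
      + (w.rhsn (m + 1) (k + 1) z * w.K (m + 2) (k + 2) z
        + w.n (m + 1) (k + 1) z * w.rhsK (m + 2) (k + 2) z
        - (w.rhsn (m + 1) (k + 2) z * w.K (m + 2) (k + 1) z
        + w.n (m + 1) (k + 2) z * w.rhsK (m + 2) (k + 1) z))
      - (w.rhsn (m + 2) (k + 1) z * w.K (m + 1) (k + 2) z
        + w.n (m + 2) (k + 1) z * w.rhsK (m + 1) (k + 2) z
        - (w.rhsn (m + 2) (k + 2) z * w.K (m + 1) (k + 1) z
        + w.n (m + 2) (k + 2) z * w.rhsK (m + 1) (k + 1) z))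
      + ∑ f, (w.rhsn f m z * w.K f k z + w.n f m z * w.rhsK f k z)
      - ((∑ f, w.rhsn f f z) * w.K m k z + w.trn z * w.rhsK m k z) - der D tvec (w.B m k) z := by
  have hu := h.ud hz
  have a1 := h.diff_n hz
  have a2 := h.diff_K hz
  have a3 := h.diff_B hz
  have a4 := fun i j k => h.diff_dX (h.smooth_K j k) i hz
  have e1 := fun i j => h.dt_n i j z hz
  have e2 := fun i j => h.dt_K i j z hz
  unfold Y cross trn
  simp (disch := fun_prop) only [der_add hu, der_sub hu, der_mul hu, der_sum _ hu, e1, e2]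

omit h in
theorem dX_symm {F : Fin 3 → Fin 3 → Coord → ℝ} (hF : ∀ i j, ∀ y ∈ D, F i j y = F j i y)
    (hz : z ∈ D) (i j k : Fin 3) : w.dX D i (F j k) z = w.dX D i (F k j) z :=
  der_congr (hF j k) hz

theorem dX_trace {F : Fin 3 → Fin 3 → Coord → ℝ}
    (hd : ∀ i j, DifferentiableWithinAt ℝ (F i j) D z)
    (hF : ∀ y ∈ D, ∑ i, F i i y = 0) (hz : z ∈ D) (i : Fin 3) :
    ∑ j, w.dX D i (F j j) z = 0 := by
  unfold dX
  rw [← der_sum _ (h.ud hz) (fun j _ => hd j j)]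
  exact der_zero_fun hF hz

/-- $\partial_\tau K$ contributes the curl of $E$ unsymmetrised, $\partial_\tau B$ its
symmetrisation with the opposite sign. The difference is the antisymmetric part of the curl, which
is the divergence `P`. Everything else recombines into `Y`. -/
theorem dt_Y (hz : z ∈ D) (m k : Fin 3) :
    der D tvec (w.Y D m k) z
      = -w.trχ z * w.Y D m k z + ∑ l, w.χ m l z * w.Y D l k z + w.th' z * w.Y D m k z
        - w.th z * ∑ l, w.Y D m l z * w.K l k z
        - (1 / 2) * (if k = m + 1 then w.P D (m + 2) z else if k = m + 2 then -w.P D (m + 1) z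
          else 0) := by
  rw [h.dt_Y_expand hz, h.dt_dX (h.smooth_K _ _) _ hz, h.dt_dX (h.smooth_K _ _) _ hz,
    h.dX_rhsK hz, h.dX_rhsK hz, h.dt_B _ _ z hz]
  have sK := fun i j => h.symm_K i j z hz
  have sE := fun i j => h.symm_E i j z hz
  have sB := fun i j => h.symm_B i j z hz
  have tE := last_of_sum_eq_zero m (h.trace_E z hz)
  have tB := last_of_sum_eq_zero m (h.trace_B z hz)
  have tdE := fun i => last_of_sum_eq_zero m (h.dX_trace (h.diff_E hz) h.trace_E hz i)
  have sdE := fun i => dX_symm (w := w) h.symm_E hz i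
  have sdK := fun i => dX_symm (w := w) h.symm_K hz i
  have ne := fin3_ne_cyclic m
  simp only [Y, rhsK, rhsn, P, curlE, nabE, cross, trn, trχ, sum_cyclic m, smul_eq_mul, χ]
  -- After commuting $\partial_\tau$ past the frame derivatives and eliminating dependent components
  -- by symmetry and trace, a polynomial identity is left for each position of `k` relative to `m`.
  obtain hk | hk | hk := fin3_cyclic m k
  all_goals
    simp only [hk, fin3_add_one_add_one, fin3_add_one_add_two, fin3_add_two_add_one,
      fin3_add_two_add_two, delta_self, delta_add_one, delta_add_two, delta_add_one_left,
      delta_add_two_left, delta_one_two, delta_two_one, ne.1, ne.2.1, ne.2.2, if_true, if_false,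
      tE, tB, tdE, sK (m + 1) m, sK (m + 2) m, sK (m + 2) (m + 1),
      sE (m + 1) m, sE (m + 2) m, sE (m + 2) (m + 1), sB (m + 1) m, sB (m + 2) m,
      sB (m + 2) (m + 1), sdE _ (m + 1) m, sdE _ (m + 2) m, sdE _ (m + 2) (m + 1),
      sdK _ (m + 1) m, sdK _ (m + 2) m, sdK _ (m + 2) (m + 1)]
    ring

theorem dt_χ (hz : z ∈ D) (i j : Fin 3) :
    der D tvec (w.χ i j) z
      = w.th' z * w.K i j z + w.th z * w.rhsK i j z + delta i j := by
  unfold χ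
  have a1 := h.diff_K hz
  have a2 := h.diff_th hz
  have a3 := h.diff_th' hz
  have hu := h.ud hz
  simp (disch := fun_prop) only [der_sub hu, der_mul hu, der_const, h.dt_th z hz, h.dt_th' z hz,
    h.dt_K i j z hz]
  ring

theorem dt_R_expand (hz : z ∈ D) (m k : Fin 3) :
    der D tvec (w.R D m k) z
      = der D tvec (w.dX D (m + 1) (w.n (m + 2) k)) z - der D tvec (w.dX D (m + 2) (w.n (m + 1) k)) z
      + (w.rhsn (m + 1) (k + 1) z * w.n (m + 2) (k + 2) z
        + w.n (m + 1) (k + 1) z * w.rhsn (m + 2) (k + 2) z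
        - (w.rhsn (m + 1) (k + 2) z * w.n (m + 2) (k + 1) z
        + w.n (m + 1) (k + 2) z * w.rhsn (m + 2) (k + 1) z))
      + ∑ f, (w.rhsn f m z * w.n f k z + w.n f m z * w.rhsn f k z)
      - ((∑ f, w.rhsn f f z) * w.n m k z + w.trn z * w.rhsn m k z)
      - (der D tvec (w.χ (m + 1) (k + 1)) z * w.χ (m + 2) (k + 2) z
        + w.χ (m + 1) (k + 1) z * der D tvec (w.χ (m + 2) (k + 2)) z
        - (der D tvec (w.χ (m + 1) (k + 2)) z * w.χ (m + 2) (k + 1) z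
        + w.χ (m + 1) (k + 2) z * der D tvec (w.χ (m + 2) (k + 1)) z))
      - (w.th' z * w.E m k z + w.th z * der D tvec (w.E m k) z)
      - (-1 * (w.K m k z - delta m k * w.trK z)
        + w.th' z * (w.rhsK m k z - delta m k * ∑ f, w.rhsK f f z)) := by
  have hu := h.ud hz
  have a1 := h.diff_n hz
  have a2 := h.diff_K hz
  have a3 := h.diff_E hz
  have a4 := fun i j k => h.diff_dX (h.smooth_n j k) i hz
  have a5 := h.diff_χ hz
  have a6 := h.diff_th hz
  have a7 := h.diff_th' hz
  have e1 := fun i j => h.dt_n i j z hz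
  have e2 := fun i j => h.dt_K i j z hz
  unfold R cross trn trK
  simp (disch := fun_prop) only [der_add hu, der_sub hu, der_mul hu, der_sum _ hu, e1, e2,
    der_const, h.dt_th z hz, h.dt_th' z hz]
  ring

/-- The mechanism is that of `dt_Y`, with $n$ and $B$ in place of $K$ and $E$: the curls of $B$ from
$\partial_\tau n$ and from $\Theta\,\partial_\tau E$ differ by an antisymmetric part, which is `Q`.
-/
theorem dt_R (hz : z ∈ D) (m k : Fin 3) :
    der D tvec (w.R D m k) z
      = -w.trχ z * w.R D m k z + ∑ l, w.χ m l z * w.R D l k z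
        - w.th z * ∑ l, w.Y D m l z * w.n l k z
        + w.th z / 2 * (if k = m + 1 then w.Q D (m + 2) z else if k = m + 2 then -w.Q D (m + 1) z
          else 0) := by
  rw [h.dt_R_expand hz, h.dt_dX (h.smooth_n _ _) _ hz, h.dt_dX (h.smooth_n _ _) _ hz,
    h.dX_rhsn hz, h.dX_rhsn hz, h.dt_E _ _ z hz]
  simp only [h.dt_χ hz]
  have sK := fun i j => h.symm_K i j z hz
  have sE := fun i j => h.symm_E i j z hz
  have sB := fun i j => h.symm_B i j z hz
  have tE := last_of_sum_eq_zero m (h.trace_E z hz)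
  have tB := last_of_sum_eq_zero m (h.trace_B z hz)
  have tdB := fun i => last_of_sum_eq_zero m (h.dX_trace (h.diff_B hz) h.trace_B hz i)
  have sdB := fun i => dX_symm (w := w) h.symm_B hz i
  have sdK := fun i => dX_symm (w := w) h.symm_K hz i
  have ne := fin3_ne_cyclic m
  -- The identity holds only modulo $\Theta'^2=1-2\Theta$; eliminating $\Theta$ makes it a
  -- polynomial identity in $\Theta'$.
  have hth : w.th z = (1 - w.th' z ^ 2) / 2 := by linarith [h.th_sq z hz]
  simp only [R, Y, rhsK, rhsn, Q, curlB, nabB, cross, trn, trχ, trK, sum_cyclic m, smul_eq_mul, χ]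
  obtain hk | hk | hk := fin3_cyclic m k
  all_goals
    simp only [hk, fin3_add_one_add_one, fin3_add_one_add_two, fin3_add_two_add_one,
      fin3_add_two_add_two, delta_self, delta_add_one, delta_add_two, delta_add_one_left,
      delta_add_two_left, delta_one_two, delta_two_one, ne.1, ne.2.1, ne.2.2, if_true, if_false,
      tE, tB, tdB, sK (m + 1) m, sK (m + 2) m, sK (m + 2) (m + 1),
      sE (m + 1) m, sE (m + 2) m, sE (m + 2) (m + 1), sB (m + 1) m, sB (m + 2) m,
      sB (m + 2) (m + 1), sdB _ (m + 1) m, sdB _ (m + 2) m, sdB _ (m + 2) (m + 1),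
      sdK _ (m + 1) m, sdK _ (m + 2) m, sdK _ (m + 2) (m + 1), hth]
    ring

theorem dX_rhsX (hz : z ∈ D) (i j : Fin 3) :
    w.dX D i (der D tvec (w.X j)) z
      = -(∑ l, ((w.th z * w.dX D i (w.K j l) z) • w.X l z + w.χ j l z • w.dX D i (w.X l) z)) := by
  have e3 := fun a b => h.dX_χ hz i a b
  unfold dX at *
  rw [der_congr (h.dt_X j) hz]
  have hu := h.ud hz
  have a1 := h.diff_X hz
  have a2 := h.diff_χ hz
  rw [der_neg hu, der_sum _ hu (fun l _ => by fun_prop)]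
  simp only [der_smul hu (a2 _ _) (a1 _), e3]

/-- Commuting $\partial_\tau$ through the bracket differentiates $\chi$, and the term $\Theta B$ in
$\partial_\tau n$ is what completes these derivatives of $K$ to the Codazzi expression `Y`. -/
theorem dt_T (hz : z ∈ D) (m : Fin 3) :
    der D tvec (w.T D m) z
      = -w.trχ z • w.T D m z + ∑ l, w.χ m l z • w.T D l z
        - w.th z • ∑ l, w.Y D m l z • w.X l z := by
  have hu := h.ud hz
  have a1 := h.diff_n hz
  have a2 := h.diff_X hz
  have a4 := fun i j => h.diff_dX (h.smooth_X j) i hz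
  have e1 := fun i j => h.dt_n i j z hz
  have e2 := fun i => h.dt_X i z hz
  have key : der D tvec (w.T D m) z
      = der D tvec (w.dX D (m + 1) (w.X (m + 2))) z - der D tvec (w.dX D (m + 2) (w.X (m + 1))) z
        + ∑ f, (w.rhsn f m z • w.X f z + w.n f m z • -∑ l, w.χ f l z • w.X l z)
        - ((∑ f, w.rhsn f f z) • w.X m z + w.trn z • -∑ l, w.χ m l z • w.X l z) := by
    unfold T trn
    simp (disch := fun_prop) only [der_add hu, der_sub hu, der_smul hu, der_sum _ hu, e1, e2]
  rw [key, h.dt_dX (h.smooth_X _) _ hz, h.dt_dX (h.smooth_X _) _ hz, h.dX_rhsX hz, h.dX_rhsX hz]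
  have sK := fun i j => h.symm_K i j z hz
  have sB := fun i j => h.symm_B i j z hz
  have tB := last_of_sum_eq_zero m (h.trace_B z hz)
  have sdK := fun i => dX_symm (w := w) h.symm_K hz i
  simp only [T, Y, rhsn, cross, trn, trχ, sum_cyclic m, χ]
  simp only [fin3_add_one_add_one, fin3_add_one_add_two, fin3_add_two_add_one,
      fin3_add_two_add_two, delta_self, delta_add_one, delta_add_two, delta_add_one_left,
      delta_add_two_left, delta_one_two, delta_two_one,
      tB, sK (m + 1) m, sK (m + 2) m, sK (m + 2) (m + 1), sB (m + 1) m, sB (m + 2) m,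
      sdK _ (m + 1) m, sdK _ (m + 2) m, sdK _ (m + 2) (m + 1)]
  module

end Solves
end Reduced
-- Self-dual form of the system and evolution of the divergence constraints.
namespace Reduced

open Complex in
/-- The self-dual part of the rescaled Weyl tensor. -/
noncomputable def psi (w : Reduced) (i j : Fin 3) (z : Coord) : ℂ := w.E i j z + I * w.B i j z

open Complex in
/-- The self-dual connection. -/
noncomputable def alpha (w : Reduced) (i j : Fin 3) (z : Coord) : ℂ := w.n i j z + I * w.χ i j z

/-- The covariant derivative of the self-dual part of the rescaled Weyl tensor. -/
noncomputable def nabPsi (w : Reduced) (D : Set Coord) (k i j : Fin 3) (z : Coord) : ℂ :=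
  w.dX D k (w.psi i j) z
    + (cross (fun l => w.alpha k l z) (fun l => w.psi l j z) i
      + cross (fun l => w.alpha k l z) (fun l => w.psi i l z) j)

/-- The complex form of the divergence constraints. -/
noncomputable def Pi (w : Reduced) (D : Set Coord) (j : Fin 3) (z : Coord) : ℂ :=
  ∑ i, w.nabPsi D i i j z

open Complex in
/-- The complex form of the Gauss and Codazzi constraints. -/
noncomputable def Xi (w : Reduced) (D : Set Coord) (m k : Fin 3) (z : Coord) : ℂ :=
  w.R D m k z + I * (w.th z * w.Y D m k z)

variable {w : Reduced} {D : Set Coord}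
namespace Solves
variable {z : Coord} (h : w.Solves D)
include h

theorem contDiffOn_psi (i j : Fin 3) : ContDiffOn ℝ 2 (w.psi i j) D := by
  have h1 := Complex.ofRealCLM.contDiff.comp_contDiffOn (h.smooth_E i j)
  have h2 := Complex.ofRealCLM.contDiff.comp_contDiffOn (h.smooth_B i j)
  exact h1.add (contDiffOn_const.mul h2)

theorem contDiffOn_χ (i j : Fin 3) : ContDiffOn ℝ 2 (w.χ i j) D :=
  (h.smooth_th.mul (h.smooth_K i j)).sub (h.smooth_th'.mul contDiffOn_const)

theorem contDiffOn_alpha (i j : Fin 3) : ContDiffOn ℝ 2 (w.alpha i j) D := by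
  have h1 := Complex.ofRealCLM.contDiff.comp_contDiffOn (h.smooth_n i j)
  have h2 := Complex.ofRealCLM.contDiff.comp_contDiffOn (h.contDiffOn_χ i j)
  exact h1.add (contDiffOn_const.mul h2)

theorem diff_psi (hz : z ∈ D) (i j : Fin 3) : DifferentiableWithinAt ℝ (w.psi i j) D z :=
  (h.contDiffOn_psi i j).differentiableOn (by norm_num) z hz

theorem diff_alpha (hz : z ∈ D) (i j : Fin 3) : DifferentiableWithinAt ℝ (w.alpha i j) D z :=
  (h.contDiffOn_alpha i j).differentiableOn (by norm_num) z hz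

theorem der_add_I_mul {f g : Coord → ℝ} {v : Coord} (hz : z ∈ D)
    (hf : DifferentiableWithinAt ℝ f D z) (hg : DifferentiableWithinAt ℝ g D z) :
    der D v (fun y => (f y : ℂ) + Complex.I * (g y : ℂ)) z
      = (der D v f z : ℝ) + Complex.I * (der D v g z : ℝ) := by
  have hu := h.ud hz
  have h1 : DifferentiableWithinAt ℝ (fun y => (f y : ℂ)) D z :=
    Complex.ofRealCLM.differentiableAt.comp_differentiableWithinAt z hf
  have h2 : DifferentiableWithinAt ℝ (fun y => (g y : ℂ)) D z :=
    Complex.ofRealCLM.differentiableAt.comp_differentiableWithinAt z hg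
  rw [der_add hu (by fun_prop) (by fun_prop), der_mul hu (by fun_prop) (by fun_prop), der_const,
    der_ofReal hu hf, der_ofReal hu hg]
  ring

theorem der_psi (hz : z ∈ D) (v : Coord) (i j : Fin 3) :
    der D v (w.psi i j) z = (der D v (w.E i j) z : ℝ) + Complex.I * (der D v (w.B i j) z : ℝ) :=
  h.der_add_I_mul hz (h.diff_E hz i j) (h.diff_B hz i j)

theorem der_alpha (hz : z ∈ D) (v : Coord) (i j : Fin 3) :
    der D v (w.alpha i j) z = (der D v (w.n i j) z : ℝ) + Complex.I * (der D v (w.χ i j) z : ℝ) :=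
  h.der_add_I_mul hz (h.diff_n hz i j) (h.diff_χ hz i j)

/-- The real and imaginary parts of $\alpha\times\psi$ are $n\times E-\chi\times B$ and $n\times
B+\chi\times E$, exactly the signs in `nabE` and `nabB`. Complex notation halves the later
computation. -/
theorem nabPsi_eq (hz : z ∈ D) (k i j : Fin 3) :
    w.nabPsi D k i j z = w.nabE D k i j z + Complex.I * w.nabB D k i j z := by
  rw [nabPsi, dX, h.der_psi hz]
  simp only [cross, psi, alpha, nabE, nabB, dX]
  push_cast
  ring_nf
  simp only [Complex.I_sq]
  ring

theorem Pi_eq (hz : z ∈ D) (j : Fin 3) :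
    w.Pi D j z = w.P D j z + Complex.I * w.Q D j z := by
  simp only [Pi, P, Q, h.nabPsi_eq hz, Complex.ofReal_sum, Finset.sum_add_distrib, Finset.mul_sum]

/-- The two Bianchi evolution equations are the single equation
$\partial_\tau\psi=-i\,\mathrm{sym}\,\mathrm{curl}\,\psi$. -/
theorem dt_psi (hz : z ∈ D) (i j : Fin 3) :
    der D tvec (w.psi i j) z = -(Complex.I / 2)
      * ((w.nabPsi D (i + 1) (i + 2) j z - w.nabPsi D (i + 2) (i + 1) j z)
        + (w.nabPsi D (j + 1) (j + 2) i z - w.nabPsi D (j + 2) (j + 1) i z)) := by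
  rw [h.der_psi hz, h.dt_E i j z hz, h.dt_B i j z hz]
  simp only [h.nabPsi_eq hz, curlE, curlB]
  push_cast
  ring_nf
  simp only [Complex.I_sq]
  ring

/-- The imaginary part is the Riccati equation of $\chi$; the last bracket is the Schouten tensor
$\ell=\Theta'K+2\delta$. The relation between $\Theta'^2$ and $\Theta$ is needed to remove $K$ in
favour of $\chi$. -/
theorem dt_alpha (hz : z ∈ D) (i j : Fin 3) :
    der D tvec (w.alpha i j) z = -(∑ l, (w.χ i l z : ℂ) * w.alpha l j z)
      - Complex.I * w.th z * w.psi i j z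
      + Complex.I * (w.th' z * w.K i j z + 2 * delta i j) := by
  rw [h.der_alpha hz, h.dt_n i j z hz, h.dt_χ hz]
  have hth : (w.th' z : ℂ) ^ 2 = 1 - 2 * w.th z := by exact_mod_cast h.th_sq z hz
  simp only [rhsn, rhsK, alpha, psi, sum_cyclic i, χ]
  obtain hk | hk | hk := fin3_cyclic i j
  all_goals
    simp only [hk, delta_self, delta_add_one, delta_add_two, delta_add_one_left,
      delta_add_two_left, delta_one_two, delta_two_one]
    push_cast
    ring_nf
    simp only [Complex.I_sq, hth]
    ring

theorem dX_alpha (hz : z ∈ D) (i j k : Fin 3) :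
    w.dX D i (w.alpha j k) z
      = w.dX D i (w.n j k) z + Complex.I * (w.th z * w.dX D i (w.K j k) z) := by
  have := h.der_alpha hz (w.X i z) j k
  have h2 := h.dX_χ hz i j k
  unfold dX at *
  rw [this, h2]
  push_cast
  ring

/-- Gauss and Codazzi are the real and imaginary parts of the curvature of the self-dual connection
$\alpha$. The part $-\Theta'\delta$ of $\chi$ does not contribute to the Codazzi expression, because
$\delta$ is parallel; hence the factor $\Theta$ in front of `Y`. -/
theorem Xi_eq (hz : z ∈ D) (m k : Fin 3) :
    w.Xi D m k z = w.dX D (m + 1) (w.alpha (m + 2) k) z - w.dX D (m + 2) (w.alpha (m + 1) k) z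
      + cross (fun l => w.alpha (m + 1) l z) (fun l => w.alpha (m + 2) l z) k
      + ∑ f, (w.n f m z : ℂ) * w.alpha f k z - w.trn z * w.alpha m k z
      - w.th z * w.psi m k z - w.th' z * (w.K m k z - delta m k * w.trK z) + 4 * delta m k := by
  simp only [Xi, R, Y, h.dX_alpha hz]
  have sK := fun i j => h.symm_K i j z hz
  simp only [alpha, psi, cross, trn, trK, χ, sum_cyclic m]
  obtain hk | hk | hk := fin3_cyclic m k
  all_goals
    simp only [hk, fin3_add_one_add_one, fin3_add_one_add_two, fin3_add_two_add_one,
      fin3_add_two_add_two, delta_self, delta_add_one, delta_add_two, delta_add_one_left,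
      delta_add_two_left, delta_one_two, delta_two_one]
    push_cast
    ring_nf
    simp only [Complex.I_sq]
    ring

theorem diff_nabPsi (hz : z ∈ D) (k i j : Fin 3) :
    DifferentiableWithinAt ℝ (w.nabPsi D k i j) D z := by
  have a1 := h.diff_psi hz
  have a2 := h.diff_alpha hz
  have a4 := fun i j k => h.diff_dX (h.contDiffOn_psi j k) i hz
  unfold nabPsi cross
  fun_prop

theorem der_nabPsi (hz : z ∈ D) (v : Coord) (k i j : Fin 3) :
    der D v (w.nabPsi D k i j) z = der D v (w.dX D k (w.psi i j)) z
      + (cross (fun l => der D v (w.alpha k l) z) (fun l => w.psi l j z) i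
        + cross (fun l => der D v (w.alpha k l) z) (fun l => w.psi i l z) j)
      + (cross (fun l => w.alpha k l z) (fun l => der D v (w.psi l j) z) i
        + cross (fun l => w.alpha k l z) (fun l => der D v (w.psi i l) z) j) := by
  have hu := h.ud hz
  have a1 := h.diff_psi hz
  have a2 := h.diff_alpha hz
  have a4 := fun i j k => h.diff_dX (h.contDiffOn_psi j k) i hz
  unfold nabPsi cross
  simp (disch := fun_prop) only [der_add hu, der_sub hu, der_mul hu]
  ring

theorem dX_dt_psi (hz : z ∈ D) (k i j : Fin 3) :
    w.dX D k (der D tvec (w.psi i j)) z = -(Complex.I / 2)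
      * ((w.dX D k (w.nabPsi D (i + 1) (i + 2) j) z - w.dX D k (w.nabPsi D (i + 2) (i + 1) j) z)
        + (w.dX D k (w.nabPsi D (j + 1) (j + 2) i) z
          - w.dX D k (w.nabPsi D (j + 2) (j + 1) i) z)) := by
  have hu := h.ud hz
  have a1 := h.diff_nabPsi hz
  unfold dX
  rw [der_congr (fun y hy => h.dt_psi hy i j) hz]
  simp (disch := fun_prop) only [der_add hu, der_sub hu, der_mul hu, der_const]
  ring

/-- Spatial frame derivatives commute up to the connection terms contained in the definition of `T`;
the derivative along `T` is the error that must be kept. -/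
theorem dX_comm {V : Type*} [NormedAddCommGroup V] [NormedSpace ℝ V] {F : Coord → V}
    (hF : ContDiffOn ℝ 2 F D) (m : Fin 3) (hz : z ∈ D) :
    w.dX D (m + 1) (w.dX D (m + 2) F) z = w.dX D (m + 2) (w.dX D (m + 1) F) z
      + der D (w.T D m z) F z - ∑ f, w.n f m z • w.dX D f F z + w.trn z • w.dX D m F z := by
  have := der_comm h.dom hz hF (h.diff_X hz (m + 1)) (h.diff_X hz (m + 2))
  have e : der D (w.X (m + 1) z) (w.X (m + 2)) z - der D (w.X (m + 2) z) (w.X (m + 1)) z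
      = w.T D m z - ∑ f, w.n f m z • w.X f z + w.trn z • w.X m z := by
    simp only [T, dX]
    abel
  rw [e, der_dir_add, der_dir_sub, der_dir_sum, der_dir_smul] at this
  simp only [der_dir_smul] at this
  change w.dX D (m + 1) (w.dX D (m + 2) F) z - w.dX D (m + 2) (w.dX D (m + 1) F) z = _ at this
  rw [sub_eq_iff_eq_add] at this
  rw [this]
  simp only [dX]
  abel

end Solves
end Reduced
namespace Reduced
variable {w : Reduced} {D : Set Coord}
namespace Solves
variable {z : Coord} (h : w.Solves D)
include h

theorem psi_symm (hz : z ∈ D) (i j : Fin 3) : w.psi i j z = w.psi j i z := by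
  simp only [psi, h.symm_E i j z hz, h.symm_B i j z hz]

theorem psi_last (hz : z ∈ D) (m : Fin 3) :
    w.psi (m + 2) (m + 2) z = -w.psi m m z - w.psi (m + 1) (m + 1) z := by
  simp only [psi, last_of_sum_eq_zero m (h.trace_E z hz), last_of_sum_eq_zero m (h.trace_B z hz)]
  push_cast
  ring

theorem der_psi_symm (hz : z ∈ D) (v : Coord) (i j : Fin 3) :
    der D v (w.psi i j) z = der D v (w.psi j i) z :=
  der_congr (fun _ hy => h.psi_symm hy i j) hz

theorem der_psi_last (hz : z ∈ D) (v : Coord) (m : Fin 3) :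
    der D v (w.psi (m + 2) (m + 2)) z
      = -der D v (w.psi m m) z - der D v (w.psi (m + 1) (m + 1)) z := by
  have hu := h.ud hz
  have a1 := h.diff_psi hz
  rw [der_congr (fun _ hy => h.psi_last hy m) hz]
  simp (disch := fun_prop) only [der_sub hu, der_neg hu]

theorem dX_dX_psi_symm (hz : z ∈ D) (k l i j : Fin 3) :
    w.dX D k (w.dX D l (w.psi i j)) z = w.dX D k (w.dX D l (w.psi j i)) z :=
  der_congr (fun _ hy => h.der_psi_symm hy _ i j) hz

theorem dX_dX_psi_last (hz : z ∈ D) (k l m : Fin 3) :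
    w.dX D k (w.dX D l (w.psi (m + 2) (m + 2))) z
      = -w.dX D k (w.dX D l (w.psi m m)) z - w.dX D k (w.dX D l (w.psi (m + 1) (m + 1))) z := by
  have hu := h.ud hz
  have a4 := fun i j k => h.diff_dX (h.contDiffOn_psi j k) i hz
  have := der_congr (D := D) (v := w.X k z)
    (fun y hy => show w.dX D l (w.psi (m + 2) (m + 2)) y = _ from h.der_psi_last hy (w.X l y) m) hz
  unfold dX at *
  rw [this]
  simp (disch := fun_prop) only [der_sub hu, der_neg hu]

theorem dt_Pi_expand (hz : z ∈ D) (j : Fin 3) :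
    der D tvec (w.Pi D j) z = ∑ i, (w.dX D i (der D tvec (w.psi i j)) z
        - ∑ l, w.χ i l z • w.dX D l (w.psi i j) z
      + (cross (fun l => der D tvec (w.alpha i l) z) (fun l => w.psi l j z) i
        + cross (fun l => der D tvec (w.alpha i l) z) (fun l => w.psi i l z) j)
      + (cross (fun l => w.alpha i l z) (fun l => der D tvec (w.psi l j) z) i
        + cross (fun l => w.alpha i l z) (fun l => der D tvec (w.psi i l) z) j)) := by
  have hu := h.ud hz
  have a1 := h.diff_nabPsi hz
  unfold Pi
  simp (disch := fun_prop) only [der_sum _ hu, h.der_nabPsi hz]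
  simp only [h.dt_dX (h.contDiffOn_psi _ _) _ hz]

-- Differentiating the divergence of $\psi$ in $\tau$ yields the divergence of a symmetrised curl.
-- Exchanging the two derivatives turns it into half a curl of the divergence, plus the curvature of
-- $\alpha$ acting on $\psi$, plus torsion. The curvature is `Xi` up to terms in $\psi$, $K$ and
-- $\delta$ that cancel by symmetry and trace-freeness.
set_option maxRecDepth 20000 in
set_option maxHeartbeats 2000000 in
open Complex in
theorem dt_Pi (hz : z ∈ D) (j : Fin 3) :
    der D tvec (w.Pi D j) z
      = -(I / 2) * (w.dX D (j + 1) (w.Pi D (j + 2)) z - w.dX D (j + 2) (w.Pi D (j + 1)) z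
          + cross (fun l => w.alpha (j + 1) l z) (fun l => w.Pi D l z) (j + 2)
          - cross (fun l => w.alpha (j + 2) l z) (fun l => w.Pi D l z) (j + 1))
        - w.trχ z * w.Pi D j z
        - I * ∑ m, (cross (fun l => w.Xi D m l z) (fun l => w.psi l j z) m
          + cross (fun l => w.Xi D m l z) (fun l => w.psi m l z) j)
        - I * ∑ m, der D (w.T D m z) (w.psi m j) z := by
  have hu := h.ud hz
  have a1 := h.diff_nabPsi hz
  have a2 : ∀ i, w.dX D i (w.Pi D (j + 2)) z = ∑ l, w.dX D i (w.nabPsi D l l (j + 2)) z :=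
    fun i => der_sum _ hu fun l _ => a1 l l _
  have a3 : ∀ i, w.dX D i (w.Pi D (j + 1)) z = ∑ l, w.dX D i (w.nabPsi D l l (j + 1)) z :=
    fun i => der_sum _ hu fun l _ => a1 l l _
  have b1 : ∀ i k a b, w.dX D i (w.nabPsi D k a b) z = _ := fun i k a b =>
    h.der_nabPsi hz (w.X i z) k a b
  rw [h.dt_Pi_expand hz, a2, a3]
  simp only [h.dX_dt_psi hz, b1]
  simp only [h.dt_psi hz, h.dt_alpha hz, h.Xi_eq hz, Pi, nabPsi]
  have fold : ∀ i (F : Coord → ℂ), der D (w.X i z) F z = w.dX D i F z := fun _ _ => rfl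
  have sχ : ∀ i k, w.χ i k z = w.χ k i z := fun i k => by
    simp only [χ, h.symm_K i k z hz, delta_comm i k]
  have sK := fun i k => h.symm_K i k z hz
  have s1 := h.psi_symm hz
  have s2 : ∀ i a b, w.dX D i (w.psi a b) z = w.dX D i (w.psi b a) z :=
    fun i => h.der_psi_symm hz (w.X i z)
  have s3 := h.dX_dX_psi_symm hz
  have s4 := fun m => h.der_psi_symm hz (w.T D m z)
  have t1 := h.psi_last hz j
  have t2 : ∀ i, w.dX D i (w.psi (j + 2) (j + 2)) z = _ := fun i => h.der_psi_last hz (w.X i z) j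
  have t3 := fun k l => h.dX_dX_psi_last hz k l j
  have t4 := fun m => h.der_psi_last hz (w.T D m z) j
  -- Second derivatives of $\psi$ are brought to a single order, so that the remaining ones cancel
  -- as independent quantities.
  have c0 := fun a b => h.dX_comm (h.contDiffOn_psi a b) j hz
  have c1 := fun a b => h.dX_comm (h.contDiffOn_psi a b) (j + 1) hz
  have c2 := fun a b => h.dX_comm (h.contDiffOn_psi a b) (j + 2) hz
  -- $n$ is eliminated in favour of $\alpha$ and $\chi$, leaving one set of connection variables for
  -- the final identity.
  have hn : ∀ a b, (w.n a b z : ℂ) = w.alpha a b z - I * w.χ a b z := fun a b => by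
    simp only [alpha]
    ring
  simp only [trn, trχ, trK, sum_cyclic j, Complex.real_smul, cross, fin3_add_one_add_one,
    fin3_add_one_add_two, fin3_add_two_add_one, fin3_add_two_add_two] at c0 c1 c2 ⊢
  simp only [fold] at t2 ⊢
  simp only [c0, c1, c2, delta_self, delta_add_one, delta_add_two, delta_add_one_left,
    delta_add_two_left, delta_one_two, delta_two_one, Complex.ofReal_add, Complex.ofReal_zero, Complex.ofReal_one, hn]
  simp only [s1 (j + 1) j, s1 (j + 2) j, s1 (j + 2) (j + 1),
    s2 _ (j + 1) j, s2 _ (j + 2) j, s2 _ (j + 2) (j + 1),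
    s3 _ _ (j + 1) j, s3 _ _ (j + 2) j, s3 _ _ (j + 2) (j + 1),
    s4 _ (j + 1) j, s4 _ (j + 2) j,
    sχ (j + 1) j, sχ (j + 2) j, sχ (j + 2) (j + 1),
    sK (j + 1) j, sK (j + 2) j, sK (j + 2) (j + 1), t1, t2, t3, t4]
  ring_nf
  simp only [Complex.I_sq]
  ring
end Solves
end Reduced

/-! ### An energy estimate -/

open MeasureTheory Set in
/-- Divergence theorem on a box for fluxes vanishing on its faces. -/
theorem integral_divergence_eq_zero {a b : Fin 4 → ℝ} (hab : a ≤ b)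
    (F : Fin 4 → (Fin 4 → ℝ) → ℝ) (F' : Fin 4 → (Fin 4 → ℝ) → (Fin 4 → ℝ) →L[ℝ] ℝ)
    (hF : ∀ i, ContinuousOn (F i) (Icc a b))
    (hF' : ∀ y, (∀ i, a i < y i ∧ y i < b i) → ∀ i, HasFDerivAt (F i) (F' i y) y)
    (hc : ContinuousOn (fun y => ∑ i, F' i y (Pi.single i 1)) (Icc a b))
    (h0 : ∀ i, ∀ y ∈ Icc a b, y i = a i ∨ y i = b i → F i y = 0) :
    ∫ y in Icc a b, ∑ i, F' i y (Pi.single i 1) = 0 := by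
  rw [integral_divergence_of_hasFDerivAt_off_countable' a b hab F F' ∅ countable_empty hF
    (fun y hy i => hF' y (fun j => by simpa using hy.1 j (mem_univ j)) i)
    (hc.integrableOn_compact isCompact_Icc)]
  refine Finset.sum_eq_zero fun i _ => ?_
  have key : ∀ c : ℝ, (c = a i ∨ c = b i) →
      ∫ x in Icc (a ∘ Fin.succAbove i) (b ∘ Fin.succAbove i), F i (Fin.insertNth i c x) = 0 := by
    intro c hc
    refine setIntegral_eq_zero_of_forall_eq_zero fun x hx => h0 i _ ?_ (by simpa using hc)
    rw [Fin.insertNth_mem_Icc]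
    exact ⟨by rcases hc with rfl | rfl <;> simp [hab i], hx⟩
  rw [key _ (Or.inr rfl), key _ (Or.inl rfl), sub_zero]

/-- The function whose sublevel sets give the domain of dependence. -/
def coneFn (p : Fin 4 → ℝ) (ρ κ : ℝ) (y : Fin 4 → ℝ) : ℝ :=
  ρ ^ 2 - ∑ k : Fin 3, (y k.succ - p k.succ) ^ 2 - κ * (y 0 - p 0)

/-- The differential of `coneFn`. -/
noncomputable def coneFnDeriv (p : Fin 4 → ℝ) (κ : ℝ) (y : Fin 4 → ℝ) : (Fin 4 → ℝ) →L[ℝ] ℝ :=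
  -(∑ k : Fin 3, (2 * (y k.succ - p k.succ)) • ContinuousLinearMap.proj (R := ℝ) k.succ)
    - κ • ContinuousLinearMap.proj (R := ℝ) (φ := fun _ : Fin 4 => ℝ) 0

theorem hasFDerivAt_coneFn (p : Fin 4 → ℝ) (ρ κ : ℝ) (y : Fin 4 → ℝ) :
    HasFDerivAt (coneFn p ρ κ) (coneFnDeriv p κ y) y := by
  have hp : ∀ i, HasFDerivAt (fun y : Fin 4 → ℝ => y i)
      (ContinuousLinearMap.proj (R := ℝ) (φ := fun _ : Fin 4 => ℝ) i) y := fun i =>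
    (ContinuousLinearMap.proj (R := ℝ) (φ := fun _ : Fin 4 => ℝ) i).hasFDerivAt
  have h1 := HasFDerivAt.fun_sum (u := Finset.univ)
    fun (k : Fin 3) _ => ((hp k.succ).sub_const (p k.succ)).pow 2
  have h2 := ((hp 0).sub_const (p 0)).const_mul κ
  refine ((h1.const_sub (ρ ^ 2)).sub h2).congr_fderiv ?_
  simp [coneFnDeriv]

theorem coneFnDeriv_zero (p : Fin 4 → ℝ) (κ : ℝ) (y : Fin 4 → ℝ) :
    coneFnDeriv p κ y (Pi.single 0 1) = -κ := by
  simp [coneFnDeriv]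

theorem coneFnDeriv_succ (p : Fin 4 → ℝ) (κ : ℝ) (y : Fin 4 → ℝ) (k : Fin 3) :
    coneFnDeriv p κ y (Pi.single k.succ 1) = -(2 * (y k.succ - p k.succ)) := by
  simp [coneFnDeriv, Pi.single_apply]

/-- The weight of the energy estimate. -/
noncomputable def coneWeight (p : Fin 4 → ℝ) (ρ κ l : ℝ) (y : Fin 4 → ℝ) : ℝ :=
  Real.exp (-(l * (y 0 - p 0))) * expNegInvGlue (coneFn p ρ κ y)

/-- The differential of `coneWeight`. -/
noncomputable def coneWeightDeriv (p : Fin 4 → ℝ) (ρ κ l : ℝ) (y : Fin 4 → ℝ) :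
    (Fin 4 → ℝ) →L[ℝ] ℝ :=
  (Real.exp (-(l * (y 0 - p 0))) * deriv expNegInvGlue (coneFn p ρ κ y)) • coneFnDeriv p κ y
    - (l * coneWeight p ρ κ l y) • ContinuousLinearMap.proj (R := ℝ) (φ := fun _ : Fin 4 => ℝ) 0

theorem hasFDerivAt_coneWeight (p : Fin 4 → ℝ) (ρ κ l : ℝ) (y : Fin 4 → ℝ) :
    HasFDerivAt (coneWeight p ρ κ l) (coneWeightDeriv p ρ κ l y) y := by
  have hp : HasFDerivAt (fun y : Fin 4 → ℝ => y 0)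
      (ContinuousLinearMap.proj (R := ℝ) (φ := fun _ : Fin 4 => ℝ) 0) y :=
    (ContinuousLinearMap.proj (R := ℝ) (φ := fun _ : Fin 4 => ℝ) 0).hasFDerivAt
  have h1 := (((hp.sub_const (p 0)).const_mul l).neg).exp
  have hd : DifferentiableAt ℝ expNegInvGlue (coneFn p ρ κ y) :=
    (expNegInvGlue.contDiff (n := 1)).differentiable (by norm_num) _
  have h2 := hd.hasDerivAt.comp_hasFDerivAt y (hasFDerivAt_coneFn p ρ κ y)
  refine (h1.mul h2).congr_fderiv ?_
  ext v
  simp [coneWeightDeriv, coneWeight]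
  ring

theorem continuous_coneFn (p : Fin 4 → ℝ) (ρ κ : ℝ) : Continuous (coneFn p ρ κ) :=
  continuous_iff_continuousAt.2 fun y => (hasFDerivAt_coneFn p ρ κ y).continuousAt

theorem continuous_coneWeight (p : Fin 4 → ℝ) (ρ κ l : ℝ) : Continuous (coneWeight p ρ κ l) :=
  continuous_iff_continuousAt.2 fun y => (hasFDerivAt_coneWeight p ρ κ l y).continuousAt

theorem continuous_coneWeightDeriv_apply (p : Fin 4 → ℝ) (ρ κ l : ℝ) (v : Fin 4 → ℝ) :
    Continuous fun y => coneWeightDeriv p ρ κ l y v := by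
  have h1 := continuous_coneFn p ρ κ
  have h2 := continuous_coneWeight p ρ κ l
  have h3 : Continuous (deriv expNegInvGlue) :=
    (expNegInvGlue.contDiff (n := 1)).continuous_deriv (by norm_num)
  have h4 := h3.comp h1
  simp only [coneWeightDeriv, coneFnDeriv, _root_.sub_apply,
    _root_.smul_apply, _root_.neg_apply, _root_.sum_apply,
    ContinuousLinearMap.proj_apply, smul_eq_mul]
  simp only [Function.comp_def] at h4
  fun_prop

theorem coneWeight_nonneg (p : Fin 4 → ℝ) (ρ κ l : ℝ) (y : Fin 4 → ℝ) :
    0 ≤ coneWeight p ρ κ l y :=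
  mul_nonneg (Real.exp_nonneg _) (expNegInvGlue.nonneg _)

theorem coneWeight_eq_zero {p : Fin 4 → ℝ} {ρ κ l : ℝ} {y : Fin 4 → ℝ}
    (h : coneFn p ρ κ y ≤ 0) : coneWeight p ρ κ l y = 0 := by
  simp [coneWeight, expNegInvGlue.zero_of_nonpos h]

theorem coneWeight_pos {p : Fin 4 → ℝ} {ρ κ l : ℝ} {y : Fin 4 → ℝ}
    (h : 0 < coneFn p ρ κ y) : 0 < coneWeight p ρ κ l y :=
  mul_pos (Real.exp_pos _) (expNegInvGlue.pos_of_pos h)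

open MeasureTheory Set in
/-- A nonnegative density, the divergence of whose current it controls, and which controls its
current, vanishes in the domain of dependence of the set where it vanishes initially. -/
theorem energy_estimate {p : Fin 4 → ℝ} {ρ c C : ℝ} (hρ : 0 < ρ) (hc : 0 ≤ c)
    (F : Fin 4 → (Fin 4 → ℝ) → ℝ) (F' : Fin 4 → (Fin 4 → ℝ) → (Fin 4 → ℝ) →L[ℝ] ℝ)
    {Bx : Set (Fin 4 → ℝ)}
    (hBx : ∀ y, p 0 ≤ y 0 → y 0 ≤ p 0 + ρ → (∀ k : Fin 3, |y k.succ - p k.succ| ≤ ρ) → y ∈ Bx)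
    (hF : ∀ i, ContinuousOn (F i) Bx)
    (hF' : ∀ i, ContinuousOn (fun y => F' i y (Pi.single i 1)) Bx)
    (hd : ∀ y ∈ interior Bx, ∀ i, HasFDerivAt (F i) (F' i y) y)
    (hpos : ∀ y ∈ Bx, 0 ≤ F 0 y)
    (hcur : ∀ y ∈ Bx, ∀ k : Fin 3, |F k.succ y| ≤ c * F 0 y)
    (hdiv : ∀ y ∈ Bx, ∑ i, F' i y (Pi.single i 1) ≤ C * F 0 y)
    (hinit : ∀ y ∈ Bx, y 0 = p 0 → ∀ i, F i y = 0) :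
    ∃ ε > 0, ∀ y, p 0 ≤ y 0 → y 0 ≤ p 0 + ε → (∀ k : Fin 3, |y k.succ - p k.succ| ≤ ε) →
      F 0 y = 0 := by
  -- Two demands fix the slope. As $\kappa\rho/(6c+1)=\rho^2$, the cone closes at the lid of the
  -- box. And $6c\rho$ pays for three spatial directions, each with gradient at most $2\rho$ and
  -- flux at most $c$ times the density; the extra $\rho$ keeps $\kappa$ positive when $c=0$.
  set κ := ρ * (6 * c + 1) with hκ
  have hκpos : 0 < κ := by positivity
  -- The rate $C$ absorbs the divergence of the current; the additional unit leaves `W * F 0` itself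
  -- on the good side.
  set l := C + 1 with hl
  set a : Fin 4 → ℝ := Fin.cons (p 0) fun k => p k.succ - ρ with ha
  set b : Fin 4 → ℝ := Fin.cons (p 0 + ρ / (6 * c + 1)) fun k => p k.succ + ρ with hb
  have hT : 0 < ρ / (6 * c + 1) := by positivity
  have hT' : ρ / (6 * c + 1) ≤ ρ := div_le_self hρ.le (by linarith)
  have hlt : ∀ i, a i < b i := by
    intro i
    refine Fin.cases ?_ (fun k => ?_) i
    · simpa [ha, hb] using hT
    · simp only [ha, hb, Fin.cons_succ]
      linarith
  have hmem : ∀ y, y ∈ Icc a b ↔ (p 0 ≤ y 0 ∧ y 0 ≤ p 0 + ρ / (6 * c + 1)) ∧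
      ∀ k : Fin 3, |y k.succ - p k.succ| ≤ ρ := by
    intro y
    simp only [mem_Icc, Pi.le_def, Fin.forall_fin_succ (n := 3), ha, hb, Fin.cons_zero,
      Fin.cons_succ, abs_le]
    constructor
    · rintro ⟨⟨h1, h2⟩, h3, h4⟩
      exact ⟨⟨h1, h3⟩, fun k => ⟨by linarith [h2 k], by linarith [h4 k]⟩⟩
    · rintro ⟨⟨h1, h3⟩, h⟩
      exact ⟨⟨h1, fun k => by linarith [(h k).1]⟩, h3, fun k => by linarith [(h k).2]⟩
  have hsub : Icc a b ⊆ Bx := fun y hy => by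
    obtain ⟨⟨h1, h2⟩, h3⟩ := (hmem y).1 hy
    exact hBx y h1 (h2.trans (by linarith)) h3
  have hint : ∀ y, (∀ i, a i < y i ∧ y i < b i) → y ∈ interior Bx := by
    intro y hy
    refine interior_mono hsub ?_
    rw [← pi_univ_Icc, interior_pi_set finite_univ]
    intro i _
    simpa [interior_Icc] using hy i
  set W := coneWeight p ρ κ l with hW
  set W' := coneWeightDeriv p ρ κ l with hW'
  have hWc : Continuous W := continuous_coneWeight p ρ κ l
  have hcontG : ∀ i, ContinuousOn (fun y => (W y • F' i y + F i y • W' y) (Pi.single i 1))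
      (Icc a b) := by
    intro i
    simp only [_root_.add_apply, _root_.smul_apply, smul_eq_mul]
    exact (hWc.continuousOn.mul ((hF' i).mono hsub)).add
      (((hF i).mono hsub).mul (continuous_coneWeightDeriv_apply p ρ κ l _).continuousOn)
  have hsumc : ContinuousOn (fun y => ∑ i, (W y • F' i y + F i y • W' y) (Pi.single i 1))
      (Icc a b) := continuousOn_finsetSum _ fun i _ => hcontG i
  -- The weighted current vanishes on every face: on the bottom by the initial data, on the lid and
  -- the sides because the weight is zero outside the cone.
  have hzero := integral_divergence_eq_zero (a := a) (b := b) (fun i => (hlt i).le)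
    (fun i y => W y * F i y) (fun i y => W y • F' i y + F i y • W' y)
    (fun i => hWc.continuousOn.mul ((hF i).mono hsub))
    (fun y hy i => (hasFDerivAt_coneWeight p ρ κ l y).mul (hd y (hint y hy) i)) hsumc
    (by
      intro i y hy hface
      have hy' := (hmem y).1 hy
      have hs : 0 ≤ κ * (y 0 - p 0) := mul_nonneg hκpos.le (by linarith [hy'.1.1])
      revert hface
      refine Fin.cases ?_ (fun k => ?_) i
      · rintro (h | h)
        · rw [hinit y (hsub hy) (by simpa [ha] using h) 0, mul_zero]
        · have : coneFn p ρ κ y ≤ 0 := by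
            have h' : y 0 - p 0 = ρ / (6 * c + 1) := by
              rw [h]
              simp [hb]
            have hs2 : 0 ≤ ∑ k : Fin 3, (y k.succ - p k.succ) ^ 2 :=
              Finset.sum_nonneg fun k _ => sq_nonneg _
            have : κ * (ρ / (6 * c + 1)) = ρ ^ 2 := by
              rw [hκ]
              field_simp
            rw [coneFn, h', this]
            linarith
          rw [hW, coneWeight_eq_zero this, zero_mul]
      · intro h
        have hk : (y k.succ - p k.succ) ^ 2 = ρ ^ 2 := by
          rcases h with h | h <;> rw [h] <;> simp [ha, hb]
        have : coneFn p ρ κ y ≤ 0 := by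
          have hs2 : (y k.succ - p k.succ) ^ 2 ≤ ∑ k : Fin 3, (y k.succ - p k.succ) ^ 2 :=
            Finset.single_le_sum (f := fun k : Fin 3 => (y k.succ - p k.succ) ^ 2)
              (fun k _ => sq_nonneg _) (Finset.mem_univ k)
          rw [coneFn]
          linarith
        rw [hW, coneWeight_eq_zero this, zero_mul])
  -- A nonnegative density bounded by minus a divergence of zero integral has zero integral.
  have hle : ∀ y ∈ Icc a b, W y * F 0 y
      ≤ -∑ i, (W y • F' i y + F i y • W' y) (Pi.single i 1) := by
    intro y hy
    have hyB := hsub hy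
    obtain ⟨⟨h1, h2⟩, h3⟩ := (hmem y).1 hy
    have hq := hpos y hyB
    have hWn : 0 ≤ W y := coneWeight_nonneg p ρ κ l y
    have hG' : 0 ≤ Real.exp (-(l * (y 0 - p 0))) * deriv expNegInvGlue (coneFn p ρ κ y) :=
      mul_nonneg (Real.exp_nonneg _) (expNegInvGlue.monotone.deriv_nonneg)
    set g := Real.exp (-(l * (y 0 - p 0))) * deriv expNegInvGlue (coneFn p ρ κ y) with hg
    have e0 : W' y (Pi.single 0 1) = -(g * κ) - l * W y := by
      simp only [hW', coneWeightDeriv, _root_.sub_apply,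
        _root_.smul_apply, coneFnDeriv_zero, smul_eq_mul,
        ContinuousLinearMap.proj_apply, Pi.single_eq_same]
      ring
    have e1 : ∀ k : Fin 3, W' y (Pi.single k.succ 1) = -(g * (2 * (y k.succ - p k.succ))) := by
      intro k
      simp only [hW', coneWeightDeriv, _root_.sub_apply,
        _root_.smul_apply, coneFnDeriv_succ, smul_eq_mul,
        ContinuousLinearMap.proj_apply]
      rw [Pi.single_eq_of_ne (Fin.succ_ne_zero k).symm]
      ring
    have e2 : ∑ i, (W y • F' i y + F i y • W' y) (Pi.single i 1)
        = W y * ∑ i, F' i y (Pi.single i 1) + (F 0 y * W' y (Pi.single 0 1)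
          + ∑ k : Fin 3, F k.succ y * W' y (Pi.single k.succ 1)) := by
      rw [← Fin.sum_univ_succ (fun i : Fin 4 => F i y * W' y (Pi.single i 1)), Finset.mul_sum,
        ← Finset.sum_add_distrib]
      rfl
    have e3 : ∀ k : Fin 3, F k.succ y * W' y (Pi.single k.succ 1) ≤ g * (2 * ρ * c * F 0 y) := by
      intro k
      rw [e1 k]
      have h4 : |F k.succ y * (2 * (y k.succ - p k.succ))| ≤ (c * F 0 y) * (2 * ρ) := by
        rw [abs_mul, abs_mul, abs_two]
        exact mul_le_mul (hcur y hyB k) (by linarith [h3 k]) (by positivity) (by positivity)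
      have h5 := neg_abs_le (F k.succ y * (2 * (y k.succ - p k.succ)))
      nlinarith
    have e4 : ∑ k : Fin 3, F k.succ y * W' y (Pi.single k.succ 1)
        ≤ 3 * (g * (2 * ρ * c * F 0 y)) := by
      refine (Finset.sum_le_card_nsmul Finset.univ _ _ fun k _ => e3 k).trans ?_
      simp
    have e5 : W y * ∑ i, F' i y (Pi.single i 1) ≤ W y * (C * F 0 y) :=
      mul_le_mul_of_nonneg_left (hdiv y hyB) hWn
    rw [e2, e0]
    have e6 : 0 ≤ g * ρ * F 0 y := by positivity
    have e7 : F 0 y * (-(g * κ) - l * W y) = -(3 * (g * (2 * ρ * c * F 0 y))) - g * ρ * F 0 y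
        - W y * (C * F 0 y) - W y * F 0 y := by
      rw [hκ, hl]
      ring
    linarith
  have hWF : ContinuousOn (fun y => W y * F 0 y) (Icc a b) :=
    hWc.continuousOn.mul ((hF 0).mono hsub)
  have hnn : ∀ y ∈ Icc a b, 0 ≤ W y * F 0 y := fun y hy =>
    mul_nonneg (coneWeight_nonneg p ρ κ l y) (hpos y (hsub hy))
  have hI : ∫ y in Icc a b, W y * F 0 y = 0 := by
    refine le_antisymm ?_ (setIntegral_nonneg measurableSet_Icc hnn)
    refine (setIntegral_mono_on (hWF.integrableOn_compact isCompact_Icc)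
      (hsumc.neg.integrableOn_compact isCompact_Icc) measurableSet_Icc hle).trans ?_
    simp only [Pi.neg_apply]
    rw [integral_neg, hzero, neg_zero]
  have hae : (fun y => W y * F 0 y) =ᵐ[volume.restrict (Icc a b)] 0 := by
    rwa [setIntegral_eq_zero_iff_of_nonneg_ae
      ((ae_restrict_iff' measurableSet_Icc).2 (Filter.Eventually.of_forall hnn))
      (hWF.integrableOn_compact isCompact_Icc)] at hI
  -- Almost everywhere becomes everywhere by continuity, since the box lies in the closure of its
  -- interior.
  have hcl : Icc a b ⊆ closure (interior (Icc a b)) := by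
    rw [← pi_univ_Icc, interior_pi_set finite_univ, closure_pi_set]
    intro y hy i hi
    simpa only [closure_interior_Icc (hlt i).ne] using hy i hi
  have hEq := Measure.eqOn_of_ae_eq hae hWF continuousOn_const hcl
  -- The cone function equals $\rho^2$ at `p`, so the weight is positive nearby and can be divided
  -- out.
  have hnear : ∀ᶠ y in nhds p, 0 < coneFn p ρ κ y := by
    refine (continuous_coneFn p ρ κ).continuousAt.eventually (lt_mem_nhds ?_)
    simp [coneFn]
    positivity
  obtain ⟨δ, hδ, hball⟩ := Metric.eventually_nhds_iff.1 hnear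
  refine ⟨min (δ / 2) (ρ / (6 * c + 1)), by positivity, fun y h1 h2 h3 => ?_⟩
  have hy : y ∈ Icc a b := (hmem y).2 ⟨⟨h1, h2.trans (by linarith [min_le_right (δ / 2) (ρ / (6 * c + 1))])⟩,
    fun k => (h3 k).trans ((min_le_right _ _).trans hT')⟩
  have hdist : dist y p < δ := by
    refine lt_of_le_of_lt (b := δ / 2) ((dist_pi_le_iff (by positivity)).2 fun i => ?_)
      (half_lt_self hδ)
    rw [Real.dist_eq]
    refine Fin.cases ?_ (fun k => ?_) i
    · rw [abs_of_nonneg (by linarith)]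
      linarith [min_le_left (δ / 2) (ρ / (6 * c + 1))]
    · exact (h3 k).trans (min_le_left _ _)
  have := hEq hy
  exact (mul_eq_zero.1 this).resolve_left (coneWeight_pos (hball hdist)).ne'

/-! ### Domination of functions on a compact set -/

section Dominated

variable {V : Type*} [NormedAddCommGroup V] {𝔸 : Type*} [NormedCommRing 𝔸]

/-- `f` is bounded on `S` by a multiple of `N`. -/
def IsDominated (S : Set Coord) (N : Coord → ℝ) (f : Coord → V) : Prop :=
  ∃ C, 0 ≤ C ∧ ∀ z ∈ S, ‖f z‖ ≤ C * N z

variable {S : Set Coord} {N : Coord → ℝ}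

theorem IsDominated.add {f g : Coord → V} (hf : IsDominated S N f) (hg : IsDominated S N g) :
    IsDominated S N fun z => f z + g z := by
  obtain ⟨C, hC, h⟩ := hf
  obtain ⟨C', hC', h'⟩ := hg
  refine ⟨C + C', by positivity, fun z hz => (norm_add_le _ _).trans ?_⟩
  linarith [h z hz, h' z hz]

theorem IsDominated.neg {f : Coord → V} (hf : IsDominated S N f) :
    IsDominated S N fun z => -f z := by
  simpa [IsDominated] using hf

theorem IsDominated.sub {f g : Coord → V} (hf : IsDominated S N f) (hg : IsDominated S N g) :
    IsDominated S N fun z => f z - g z := by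
  simpa only [sub_eq_add_neg] using hf.add hg.neg

theorem IsDominated.zero : IsDominated S N fun _ => (0 : V) :=
  ⟨0, le_rfl, by simp⟩

theorem IsDominated.sum {ι : Type*} (s : Finset ι) {f : ι → Coord → V}
    (h : ∀ i ∈ s, IsDominated S N (f i)) : IsDominated S N fun z => ∑ i ∈ s, f i z := by
  classical
  induction s using Finset.induction_on with
  | empty => simpa using IsDominated.zero (S := S) (N := N)
  | insert a s ha ih =>
    simp only [Finset.sum_insert ha]
    exact (h a (by simp)).add (ih fun i hi => h i (by simp [hi]))

theorem IsDominated.congr {f g : Coord → V} (hf : IsDominated S N f) (h : ∀ z ∈ S, g z = f z) :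
    IsDominated S N g := by
  obtain ⟨C, hC, hf⟩ := hf
  exact ⟨C, hC, fun z hz => by rw [h z hz]; exact hf z hz⟩

theorem IsDominated.of_norm_le {W : Type*} [NormedAddCommGroup W]
    {f : Coord → V} {g : Coord → W} (hf : IsDominated S N f) (h : ∀ z ∈ S, ‖g z‖ ≤ ‖f z‖) :
    IsDominated S N g := by
  obtain ⟨C, hC, hf⟩ := hf
  exact ⟨C, hC, fun z hz => (h z hz).trans (hf z hz)⟩

theorem exists_norm_bound {W : Type*} [NormedAddCommGroup W] (hS : IsCompact S) {a : Coord → W}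
    (ha : ContinuousOn a S) : ∃ C, 0 ≤ C ∧ ∀ z ∈ S, ‖a z‖ ≤ C := by
  obtain ⟨C, hC⟩ := hS.exists_bound_of_continuousOn ha
  exact ⟨max C 0, le_max_right _ _, fun z hz => (hC z hz).trans (le_max_left _ _)⟩

theorem IsDominated.const_mul (hS : IsCompact S) {a f : Coord → 𝔸} (ha : ContinuousOn a S)
    (hf : IsDominated S N f) : IsDominated S N fun z => a z * f z := by
  obtain ⟨C, hC, h⟩ := hf
  obtain ⟨C', hC', h'⟩ := exists_norm_bound hS ha
  refine ⟨C' * C, by positivity, fun z hz => (norm_mul_le _ _).trans ?_⟩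
  rw [mul_assoc]
  exact mul_le_mul (h' z hz) (h z hz) (norm_nonneg _) hC'

theorem IsDominated.mul_const (hS : IsCompact S) {a f : Coord → 𝔸} (ha : ContinuousOn a S)
    (hf : IsDominated S N f) : IsDominated S N fun z => f z * a z := by
  simpa only [mul_comm] using hf.const_mul hS ha

theorem IsDominated.const_smul [NormedSpace ℝ V] (hS : IsCompact S) {a : Coord → ℝ} {f : Coord → V}
    (ha : ContinuousOn a S) (hf : IsDominated S N f) : IsDominated S N fun z => a z • f z := by
  obtain ⟨C, hC, h⟩ := hf
  obtain ⟨C', hC', h'⟩ := exists_norm_bound hS ha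
  refine ⟨C' * C, by positivity, fun z hz => (norm_smul_le _ _).trans ?_⟩
  rw [mul_assoc]
  exact mul_le_mul (h' z hz) (h z hz) (norm_nonneg _) hC'

theorem IsDominated.smul_const [NormedSpace ℝ V] (hS : IsCompact S) {f : Coord → ℝ} {a : Coord → V}
    (ha : ContinuousOn a S) (hf : IsDominated S N f) : IsDominated S N fun z => f z • a z := by
  obtain ⟨C, hC, h⟩ := hf
  obtain ⟨C', hC', h'⟩ := exists_norm_bound hS ha
  refine ⟨C' * C, by positivity, fun z hz => (norm_smul_le _ _).trans ?_⟩
  rw [mul_comm, mul_assoc]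
  exact mul_le_mul (h' z hz) (h z hz) (norm_nonneg _) hC'

theorem IsDominated.clm_apply [NormedSpace ℝ V] (hS : IsCompact S) {f : Coord → Coord} {a : Coord → Coord →L[ℝ] V}
    (ha : ContinuousOn a S) (hf : IsDominated S N f) : IsDominated S N fun z => a z (f z) := by
  obtain ⟨C, hC, h⟩ := hf
  obtain ⟨C', hC', h'⟩ := exists_norm_bound hS ha
  refine ⟨C' * C, by positivity, fun z hz => ((a z).le_opNorm _).trans ?_⟩
  rw [mul_assoc]
  exact mul_le_mul (h' z hz) (h z hz) (norm_nonneg _) hC'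

theorem IsDominated.ofReal {f : Coord → ℝ} (hf : IsDominated S N f) :
    IsDominated S N fun z => (f z : ℂ) :=
  hf.of_norm_le fun z _ => by simp

theorem IsDominated.re {f : Coord → ℂ} (hf : IsDominated S N f) :
    IsDominated S N fun z => (f z).re :=
  hf.of_norm_le fun _ _ => Complex.abs_re_le_norm _

theorem IsDominated.im {f : Coord → ℂ} (hf : IsDominated S N f) :
    IsDominated S N fun z => (f z).im :=
  hf.of_norm_le fun _ _ => Complex.abs_im_le_norm _

/-- Zero-quantities are controlled by the root of the energy, so expressions quadratic in them are
controlled by the energy. -/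
theorem IsDominated.mul {q : Coord → ℝ} (hq : ∀ z, 0 ≤ q z) {f g : Coord → ℝ}
    (hf : IsDominated S (fun z => √(q z)) f) (hg : IsDominated S (fun z => √(q z)) g) :
    IsDominated S q fun z => f z * g z := by
  obtain ⟨C, hC, h⟩ := hf
  obtain ⟨C', hC', h'⟩ := hg
  refine ⟨C * C', by positivity, fun z hz => ?_⟩
  rw [norm_mul]
  refine (mul_le_mul (h z hz) (h' z hz) (norm_nonneg _) (by positivity)).trans ?_
  rw [mul_mul_mul_comm, Real.mul_self_sqrt (hq z)]

end Dominated

/-- The coordinates of spacetime as a continuous linear equivalence. -/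
noncomputable def coordEquiv : (Fin 4 → ℝ) ≃L[ℝ] Coord :=
  LinearEquiv.toContinuousLinearEquiv
    { toFun := fun y => (y 0, WithLp.toLp 2 fun k : Fin 3 => y k.succ)
      invFun := fun z => Fin.cons z.1 fun k => z.2 k
      map_add' := fun _ _ => rfl
      map_smul' := fun _ _ => rfl
      left_inv := fun y => by
        ext i
        refine Fin.cases ?_ (fun k => ?_) i <;> simp
      right_inv := fun z => by simp }

theorem coordEquiv_apply (y : Fin 4 → ℝ) :
    coordEquiv y = (y 0, WithLp.toLp 2 fun k : Fin 3 => y k.succ) := rfl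

theorem coordEquiv_symm_zero (z : Coord) : coordEquiv.symm z 0 = z.1 := rfl

theorem coordEquiv_symm_succ (z : Coord) (k : Fin 3) : coordEquiv.symm z k.succ = z.2 k := rfl

theorem coordEquiv_single (i : Fin 4) : coordEquiv (Pi.single i 1) = coordVec i := by
  rw [coordEquiv_apply]
  refine Fin.cases ?_ (fun k => ?_) i
  · simp [coordVec]
    ext k
    simp
  · simp only [coordVec, Fin.cases_succ]
    refine Prod.ext (by simp) ?_
    ext l
    simp [Pi.single_apply]

theorem sum_coordVec (z : Coord) : ∑ μ, coordEquiv.symm z μ • coordVec μ = z := by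
  apply coordEquiv.symm.injective
  rw [map_sum]
  ext i
  simp [map_smul, ← coordEquiv_single, Pi.single_apply]

/-! ### Energy, flux and lower-order bounds for the zero-quantities. -/

namespace Reduced

/-- The index set of the components of the zero quantities. -/
abbrev ZeroIndex : Type :=
  (Fin 3 × Fin 4) ⊕ (Fin 3 × Fin 3) ⊕ (Fin 3 × Fin 3) ⊕ Fin 3 ⊕ Fin 3

/-- The components of the zero quantities of the reduced system. -/
noncomputable def zeroQty (w : Reduced) (D : Set Coord) : ZeroIndex → Coord → ℝ
  | .inl i => fun z => coordEquiv.symm (w.T D i.1 z) i.2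
  | .inr (.inl i) => w.R D i.1 i.2
  | .inr (.inr (.inl i)) => w.Y D i.1 i.2
  | .inr (.inr (.inr (.inl j))) => w.P D j
  | .inr (.inr (.inr (.inr j))) => w.Q D j

/-- The sum of the squares of the zero quantities. -/
noncomputable def energy (w : Reduced) (D : Set Coord) (z : Coord) : ℝ :=
  ∑ i, w.zeroQty D i z ^ 2

/-- The flux of the energy. -/
noncomputable def flux (w : Reduced) (D : Set Coord) (k : Fin 3) (z : Coord) : ℝ :=
  ∑ i, (w.X i z).2 k * cross (fun l => w.P D l z) (fun l => w.Q D l z) i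

/-- The principal part of the evolution of the zero quantities. -/
noncomputable def principal (w : Reduced) (D : Set Coord) : ZeroIndex → Coord → ℝ
  | .inl _ => fun _ => 0
  | .inr (.inl _) => fun _ => 0
  | .inr (.inr (.inl _)) => fun _ => 0
  | .inr (.inr (.inr (.inl j))) => fun z =>
      (w.dX D (j + 1) (w.Q D (j + 2)) z - w.dX D (j + 2) (w.Q D (j + 1)) z) / 2
  | .inr (.inr (.inr (.inr j))) => fun z =>
      -((w.dX D (j + 1) (w.P D (j + 2)) z - w.dX D (j + 2) (w.P D (j + 1)) z) / 2)

variable {w : Reduced} {D : Set Coord}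

theorem energy_nonneg (z : Coord) : 0 ≤ w.energy D z :=
  Finset.sum_nonneg fun _ _ => sq_nonneg _

theorem energy_eq_zero_iff (z : Coord) : w.energy D z = 0 ↔ ∀ i, w.zeroQty D i z = 0 := by
  rw [energy, Finset.sum_eq_zero_iff_of_nonneg fun _ _ => sq_nonneg _]
  simp

theorem T_eq_sum (m : Fin 3) (z : Coord) :
    w.T D m z = ∑ μ, w.zeroQty D (.inl (m, μ)) z • coordVec μ :=
  (sum_coordVec _).symm

theorem isDominated_zeroQty {S : Set Coord} (i : ZeroIndex) :
    IsDominated S (fun z => √(w.energy D z)) (w.zeroQty D i) := by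
  refine ⟨1, zero_le_one, fun z _ => ?_⟩
  rw [one_mul, Real.norm_eq_abs]
  refine Real.abs_le_sqrt ?_
  exact Finset.single_le_sum (f := fun i => w.zeroQty D i z ^ 2) (fun _ _ => sq_nonneg _)
    (Finset.mem_univ i)

theorem isDominated_R {S : Set Coord} (m k : Fin 3) :
    IsDominated S (fun z => √(w.energy D z)) (w.R D m k) :=
  isDominated_zeroQty (.inr (.inl (m, k)))

theorem isDominated_Y {S : Set Coord} (m k : Fin 3) :
    IsDominated S (fun z => √(w.energy D z)) (w.Y D m k) :=
  isDominated_zeroQty (.inr (.inr (.inl (m, k))))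

theorem isDominated_P {S : Set Coord} (j : Fin 3) :
    IsDominated S (fun z => √(w.energy D z)) (w.P D j) :=
  isDominated_zeroQty (.inr (.inr (.inr (.inl j))))

theorem isDominated_Q {S : Set Coord} (j : Fin 3) :
    IsDominated S (fun z => √(w.energy D z)) (w.Q D j) :=
  isDominated_zeroQty (.inr (.inr (.inr (.inr j))))

theorem isDominated_T {S : Set Coord} (hS : IsCompact S) (m : Fin 3) :
    IsDominated S (fun z => √(w.energy D z)) (w.T D m) :=
  (IsDominated.sum Finset.univ fun μ _ =>
    (isDominated_zeroQty (.inl (m, μ))).smul_const hS (a := fun _ => coordVec μ)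
      continuousOn_const).congr fun z _ => T_eq_sum m z

theorem isDominated_cross {S : Set Coord} (hS : IsCompact S) {a b : Fin 3 → Coord → ℂ} {N : Coord → ℝ}
    (ha : ∀ i, IsDominated S N (a i)) (hb : ∀ i, ContinuousOn (b i) S) (k : Fin 3) :
    IsDominated S N fun z => cross (fun l => a l z) (fun l => b l z) k :=
  ((ha _).mul_const hS (hb _)).sub ((ha _).mul_const hS (hb _))

theorem isDominated_cross' {S : Set Coord} (hS : IsCompact S) {a b : Fin 3 → Coord → ℂ} {N : Coord → ℝ}
    (ha : ∀ i, ContinuousOn (a i) S) (hb : ∀ i, IsDominated S N (b i)) (k : Fin 3) :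
    IsDominated S N fun z => cross (fun l => a l z) (fun l => b l z) k :=
  ((hb _).const_mul hS (ha _)).sub ((hb _).const_mul hS (ha _))

namespace Solves
variable (h : w.Solves D)
include h

theorem contDiffOn_nabE (k i j : Fin 3) : ContDiffOn ℝ 1 (w.nabE D k i j) D := by
  have a1 := fun i j => (h.smooth_n i j).of_le (m := 1) (by norm_num)
  have a2 := fun i j => (h.smooth_E i j).of_le (m := 1) (by norm_num)
  have a3 := fun i j => (h.smooth_B i j).of_le (m := 1) (by norm_num)
  have a4 := fun i j => (h.contDiffOn_χ i j).of_le (m := 1) (by norm_num)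
  have a5 := h.contDiffOn_dX (h.smooth_E i j) k
  unfold nabE cross
  fun_prop

theorem contDiffOn_nabB (k i j : Fin 3) : ContDiffOn ℝ 1 (w.nabB D k i j) D := by
  have a1 := fun i j => (h.smooth_n i j).of_le (m := 1) (by norm_num)
  have a2 := fun i j => (h.smooth_E i j).of_le (m := 1) (by norm_num)
  have a3 := fun i j => (h.smooth_B i j).of_le (m := 1) (by norm_num)
  have a4 := fun i j => (h.contDiffOn_χ i j).of_le (m := 1) (by norm_num)
  have a5 := h.contDiffOn_dX (h.smooth_B i j) k
  unfold nabB cross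
  fun_prop

theorem contDiffOn_P (j : Fin 3) : ContDiffOn ℝ 1 (w.P D j) D :=
  ContDiffOn.sum fun i _ => h.contDiffOn_nabE i i j

theorem contDiffOn_Q (j : Fin 3) : ContDiffOn ℝ 1 (w.Q D j) D :=
  ContDiffOn.sum fun i _ => h.contDiffOn_nabB i i j

theorem contDiffOn_T (m : Fin 3) : ContDiffOn ℝ 1 (w.T D m) D := by
  have a1 := fun i j => (h.smooth_n i j).of_le (m := 1) (by norm_num)
  have a2 := fun i => (h.smooth_X i).of_le (m := 1) (by norm_num)
  have a5 := fun i j => h.contDiffOn_dX (h.smooth_X j) i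
  have a6 : ContDiffOn ℝ 1 w.trn D := ContDiffOn.sum fun i _ => a1 i i
  have a7 : ContDiffOn ℝ 1 (fun z => ∑ f, w.n f m z • w.X f z) D :=
    ContDiffOn.sum fun i _ => (a1 i m).smul (a2 i)
  exact (((a5 _ _).sub (a5 _ _)).add a7).sub (a6.smul (a2 m))

theorem contDiffOn_R (m k : Fin 3) : ContDiffOn ℝ 1 (w.R D m k) D := by
  have a1 := fun i j => (h.smooth_n i j).of_le (m := 1) (by norm_num)
  have a2 := fun i j => (h.smooth_E i j).of_le (m := 1) (by norm_num)
  have a3 := fun i j => (h.smooth_K i j).of_le (m := 1) (by norm_num)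
  have a4 := fun i j => (h.contDiffOn_χ i j).of_le (m := 1) (by norm_num)
  have a5 := fun i j k => h.contDiffOn_dX (h.smooth_n j k) i
  have a6 := h.smooth_th.of_le (m := 1) (by norm_num)
  have a7 := h.smooth_th'.of_le (m := 1) (by norm_num)
  unfold R cross trn trK
  fun_prop

theorem contDiffOn_Y (m k : Fin 3) : ContDiffOn ℝ 1 (w.Y D m k) D := by
  have a1 := fun i j => (h.smooth_n i j).of_le (m := 1) (by norm_num)
  have a2 := fun i j => (h.smooth_B i j).of_le (m := 1) (by norm_num)
  have a3 := fun i j => (h.smooth_K i j).of_le (m := 1) (by norm_num)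
  have a5 := fun i j k => h.contDiffOn_dX (h.smooth_K j k) i
  unfold Y cross trn
  fun_prop

theorem contDiffOn_zeroQty (i : ZeroIndex) : ContDiffOn ℝ 1 (w.zeroQty D i) D := by
  match i with
  | .inl i =>
    have e : w.zeroQty D (.inl i) = fun z =>
        (ContinuousLinearMap.proj (R := ℝ) (φ := fun _ : Fin 4 => ℝ) i.2).comp
          (coordEquiv.symm : Coord →L[ℝ] Fin 4 → ℝ) (w.T D i.1 z) := rfl
    rw [e]
    exact (ContinuousLinearMap.contDiff _).comp_contDiffOn (h.contDiffOn_T i.1)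
  | .inr (.inl i) => exact h.contDiffOn_R i.1 i.2
  | .inr (.inr (.inl i)) => exact h.contDiffOn_Y i.1 i.2
  | .inr (.inr (.inr (.inl j))) => exact h.contDiffOn_P j
  | .inr (.inr (.inr (.inr j))) => exact h.contDiffOn_Q j

theorem contDiffOn_energy : ContDiffOn ℝ 1 (w.energy D) D :=
  ContDiffOn.sum fun i _ => (h.contDiffOn_zeroQty i).pow 2

theorem contDiffOn_X_coord (i k : Fin 3) : ContDiffOn ℝ 1 (fun z => (w.X i z).2 k) D := by
  have e : (fun z => (w.X i z).2 k) = fun z =>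
      ((EuclideanSpace.proj k : Space →L[ℝ] ℝ).comp (ContinuousLinearMap.snd ℝ ℝ Space))
        (w.X i z) := rfl
  rw [e]
  exact (ContinuousLinearMap.contDiff _).comp_contDiffOn ((h.smooth_X i).of_le (by norm_num))

theorem contDiffOn_flux (k : Fin 3) : ContDiffOn ℝ 1 (w.flux D k) D := by
  have a1 := h.contDiffOn_P
  have a2 := h.contDiffOn_Q
  have a3 := h.contDiffOn_X_coord
  unfold flux cross
  fun_prop

section Domination

variable {S : Set Coord} (hS : IsCompact S) (hSD : S ⊆ D)
include hS hSD

theorem isDominated_dt_T (m : Fin 3) :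
    IsDominated S (fun z => √(w.energy D z)) (der D tvec (w.T D m)) := by
  have cχ : ∀ i j, ContinuousOn (w.χ i j) S := fun i j => (h.contDiffOn_χ i j).continuousOn.mono hSD
  have ctr : ContinuousOn w.trχ S := continuousOn_finsetSum _ fun i _ => cχ i i
  have cth : ContinuousOn w.th S := h.smooth_th.continuousOn.mono hSD
  have cX : ∀ i, ContinuousOn (w.X i) S := fun i => (h.smooth_X i).continuousOn.mono hSD
  refine IsDominated.congr ?_ fun z hz => h.dt_T (hSD hz) m
  exact (((isDominated_T hS m).const_smul hS ctr.neg).add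
    (IsDominated.sum _ fun l _ => (isDominated_T hS l).const_smul hS (cχ m l))).sub
    ((IsDominated.sum _ fun l _ => (isDominated_Y m l).smul_const hS (cX l)).const_smul hS cth)

theorem isDominated_dt_R (m k : Fin 3) :
    IsDominated S (fun z => √(w.energy D z)) (der D tvec (w.R D m k)) := by
  have cχ : ∀ i j, ContinuousOn (w.χ i j) S := fun i j => (h.contDiffOn_χ i j).continuousOn.mono hSD
  have ctr : ContinuousOn w.trχ S := continuousOn_finsetSum _ fun i _ => cχ i i
  have cth : ContinuousOn w.th S := h.smooth_th.continuousOn.mono hSD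
  have cn : ∀ i j, ContinuousOn (w.n i j) S := fun i j => (h.smooth_n i j).continuousOn.mono hSD
  refine IsDominated.congr ?_ fun z hz => h.dt_R (hSD hz) m k
  refine ((((isDominated_R m k).const_mul hS ctr.neg).add
    (IsDominated.sum _ fun l _ => (isDominated_R l k).const_mul hS (cχ m l))).sub
    ((IsDominated.sum _ fun l _ => (isDominated_Y m l).mul_const hS (cn l k)).const_mul hS cth)).add
    (IsDominated.const_mul hS (cth.div_const 2) ?_)
  split_ifs
  · exact isDominated_Q _
  · exact (isDominated_Q _).neg
  · exact IsDominated.zero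

theorem isDominated_dt_Y (m k : Fin 3) :
    IsDominated S (fun z => √(w.energy D z)) (der D tvec (w.Y D m k)) := by
  have cχ : ∀ i j, ContinuousOn (w.χ i j) S := fun i j => (h.contDiffOn_χ i j).continuousOn.mono hSD
  have ctr : ContinuousOn w.trχ S := continuousOn_finsetSum _ fun i _ => cχ i i
  have cth : ContinuousOn w.th S := h.smooth_th.continuousOn.mono hSD
  have cth' : ContinuousOn w.th' S := h.smooth_th'.continuousOn.mono hSD
  have cK : ∀ i j, ContinuousOn (w.K i j) S := fun i j => (h.smooth_K i j).continuousOn.mono hSD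
  refine IsDominated.congr ?_ fun z hz => h.dt_Y (hSD hz) m k
  refine (((((isDominated_Y m k).const_mul hS ctr.neg).add
    (IsDominated.sum _ fun l _ => (isDominated_Y l k).const_mul hS (cχ m l))).add
    ((isDominated_Y m k).const_mul hS cth')).sub
    ((IsDominated.sum _ fun l _ => (isDominated_Y m l).mul_const hS (cK l k)).const_mul hS cth)).sub
    (IsDominated.const_mul hS continuousOn_const ?_)
  split_ifs
  · exact isDominated_P _
  · exact (isDominated_P _).neg
  · exact IsDominated.zero

theorem isDominated_Pi (j : Fin 3) : IsDominated S (fun z => √(w.energy D z)) (w.Pi D j) :=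
  ((isDominated_P j).ofReal.add ((isDominated_Q j).ofReal.const_mul hS
    (a := fun _ => Complex.I) continuousOn_const)).congr fun _ hz => h.Pi_eq (hSD hz) j

theorem isDominated_Xi (m k : Fin 3) : IsDominated S (fun z => √(w.energy D z)) (w.Xi D m k) := by
  have cth : ContinuousOn (fun z => (w.th z : ℂ)) S :=
    Complex.continuous_ofReal.comp_continuousOn (h.smooth_th.continuousOn.mono hSD)
  exact (isDominated_R m k).ofReal.add (((isDominated_Y m k).ofReal.const_mul hS cth).const_mul hS
    (a := fun _ => Complex.I) continuousOn_const)

-- The curl is the only place where derivatives of zero-quantities enter `dt_Pi`. After it is moved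
-- to the left, everything is linear in them with coefficients continuous on the compact set.
open Complex in
theorem isDominated_dt_Pi (j : Fin 3) :
    IsDominated S (fun z => √(w.energy D z)) fun z => der D tvec (w.Pi D j) z
      + I / 2 * (w.dX D (j + 1) (w.Pi D (j + 2)) z - w.dX D (j + 2) (w.Pi D (j + 1)) z) := by
  have cχ : ∀ i j, ContinuousOn (w.χ i j) S := fun i j => (h.contDiffOn_χ i j).continuousOn.mono hSD
  have ctr : ContinuousOn (fun z => (w.trχ z : ℂ)) S :=
    Complex.continuous_ofReal.comp_continuousOn (continuousOn_finsetSum _ fun i _ => cχ i i)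
  have ca : ∀ i j, ContinuousOn (w.alpha i j) S :=
    fun i j => (h.contDiffOn_alpha i j).continuousOn.mono hSD
  have cp : ∀ i j, ContinuousOn (w.psi i j) S :=
    fun i j => (h.contDiffOn_psi i j).continuousOn.mono hSD
  have cd : ∀ i j, ContinuousOn (fderivWithin ℝ (w.psi i j) D) S := fun i j =>
    ((h.contDiffOn_psi i j).continuousOn_fderivWithin h.dom.uniqueDiffOn (by norm_num)).mono hSD
  have dPi := fun j => h.isDominated_Pi hS hSD j
  have dXi := fun m k => h.isDominated_Xi hS hSD m k
  have cI : ∀ c : ℂ, ContinuousOn (fun _ : Coord => c) S := fun c => continuousOn_const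
  have d1 := ((isDominated_cross' hS (ca (j + 1)) dPi (j + 2)).sub
    (isDominated_cross' hS (ca (j + 2)) dPi (j + 1))).const_mul hS (cI (-(I / 2)))
  have d2 := (dPi j).const_mul hS ctr
  have d3 := (IsDominated.sum Finset.univ fun m _ =>
    (isDominated_cross hS (dXi m) (fun l => cp l j) m).add
      (isDominated_cross hS (dXi m) (fun l => cp m l) j)).const_mul hS (cI I)
  have d4 := (IsDominated.sum Finset.univ fun m _ =>
    (isDominated_T (w := w) (D := D) hS m).clm_apply hS (cd m j)).const_mul hS (cI I)
  refine (((d1.sub d2).sub d3).sub d4).congr fun z hz => ?_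
  rw [h.dt_Pi (hSD hz) j]
  simp only [der]
  ring

end Domination

end Solves
end Reduced
-- Divergence of the energy current and local propagation.
namespace Reduced
variable {w : Reduced} {D : Set Coord}
namespace Solves
variable (h : w.Solves D)
include h

omit h in
theorem diff_of_contDiffOn {V : Type*} [NormedAddCommGroup V] [NormedSpace ℝ V] {F : Coord → V}
    {z : Coord} (hF : ContDiffOn ℝ 1 F D) (hz : z ∈ D) : DifferentiableWithinAt ℝ F D z :=
  hF.differentiableOn (by norm_num) z hz

theorem der_Pi {z : Coord} (hz : z ∈ D) (v : Coord) (j : Fin 3) :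
    der D v (w.Pi D j) z = (der D v (w.P D j) z : ℝ) + Complex.I * (der D v (w.Q D j) z : ℝ) := by
  rw [der_congr (fun y hy => h.Pi_eq hy j) hz]
  exact h.der_add_I_mul hz (diff_of_contDiffOn (h.contDiffOn_P j) hz)
    (diff_of_contDiffOn (h.contDiffOn_Q j) hz)

-- The part of $\partial_\tau$ of the energy containing derivatives of the constraints is
-- $P\cdot\mathrm{curl}\,Q-Q\cdot\mathrm{curl}\,P$. The halves in `principal` cancel the 2 from the
-- squares.
omit h in
theorem sum_principal (z : Coord) :
    ∑ i, 2 * (w.zeroQty D i z * w.principal D i z) =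
      ∑ j, (w.P D j z * (w.dX D (j + 1) (w.Q D (j + 2)) z - w.dX D (j + 2) (w.Q D (j + 1)) z)
        - w.Q D j z
          * (w.dX D (j + 1) (w.P D (j + 2)) z - w.dX D (j + 2) (w.P D (j + 1)) z)) := by
  simp only [Fintype.sum_sum_type, zeroQty, principal, mul_zero, Finset.sum_const_zero, zero_add,
    ← Finset.sum_add_distrib]
  exact Finset.sum_congr rfl fun j _ => by ring

section Domination

variable {S : Set Coord} (hS : IsCompact S) (hSD : S ⊆ D)
include hS hSD

/-- For `P` and `Q` these are the real and imaginary parts of the bound on `Pi`; the other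
zero-quantities have no principal part. -/
theorem isDominated_dt_zeroQty (i : ZeroIndex) :
    IsDominated S (fun z => √(w.energy D z))
      fun z => der D tvec (w.zeroQty D i) z - w.principal D i z := by
  match i with
  | .inl i =>
    refine ((h.isDominated_dt_T hS hSD i.1).clm_apply hS (a := fun _ =>
      (ContinuousLinearMap.proj (R := ℝ) (φ := fun _ : Fin 4 => ℝ) i.2).comp
          (coordEquiv.symm : Coord →L[ℝ] Fin 4 → ℝ)) continuousOn_const).congr fun z hz => ?_
    simp only [principal, sub_zero]
    exact der_clm ((ContinuousLinearMap.proj (R := ℝ) (φ := fun _ : Fin 4 => ℝ) i.2).comp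
          (coordEquiv.symm : Coord →L[ℝ] Fin 4 → ℝ)) (h.ud (hSD hz)) (diff_of_contDiffOn (h.contDiffOn_T i.1) (hSD hz))
  | .inr (.inl i) => exact (h.isDominated_dt_R hS hSD i.1 i.2).congr fun z _ => sub_zero _
  | .inr (.inr (.inl i)) => exact (h.isDominated_dt_Y hS hSD i.1 i.2).congr fun z _ => sub_zero _
  | .inr (.inr (.inr (.inl j))) =>
    refine (h.isDominated_dt_Pi hS hSD j).re.congr fun z hz => ?_
    simp only [dX, h.der_Pi (hSD hz), zeroQty, principal]
    simp
    ring
  | .inr (.inr (.inr (.inr j))) =>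
    refine (h.isDominated_dt_Pi hS hSD j).im.congr fun z hz => ?_
    simp only [dX, h.der_Pi (hSD hz), zeroQty, principal]
    simp
    ring

/-- The derivatives of the zero-quantities cancel between $\partial_\tau$ of the energy and the
divergence of the flux; only derivatives of the frame coefficients survive, multiplying quadratic
terms. -/
theorem isDominated_divergence (hX : ∀ i, ∀ z ∈ D, (w.X i z).1 = 0) :
    IsDominated S (w.energy D) fun z => der D tvec (w.energy D) z
      + ∑ k : Fin 3, der D (coordVec k.succ) (w.flux D k) z := by
  have d1 := IsDominated.sum Finset.univ fun i (_ : i ∈ Finset.univ) =>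
    ((isDominated_zeroQty (w := w) (D := D) i).mul energy_nonneg
      (h.isDominated_dt_zeroQty hS hSD i)).const_mul hS (a := fun _ => 2) continuousOn_const
  have dc : ∀ i, IsDominated S (w.energy D) fun z =>
      cross (fun l => w.P D l z) (fun l => w.Q D l z) i := fun i =>
    ((isDominated_P _).mul energy_nonneg (isDominated_Q _)).sub
      ((isDominated_P _).mul energy_nonneg (isDominated_Q _))
  have cX : ∀ i k v, ContinuousOn (der D v (fun z => (w.X i z).2 k)) S := fun i k v =>
    (((h.contDiffOn_X_coord i k).continuousOn_fderivWithin h.dom.uniqueDiffOn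
      (by norm_num)).mono hSD).clm_apply continuousOn_const
  have d2 := IsDominated.sum Finset.univ fun k (_ : k ∈ Finset.univ) =>
    IsDominated.sum Finset.univ fun i (_ : i ∈ Finset.univ) =>
      (dc i).const_mul hS (cX i k (coordVec k.succ))
  refine (d1.add d2).congr fun z hz => ?_
  have hzD := hSD hz
  have hu := h.ud hzD
  have a1 := fun j => diff_of_contDiffOn (h.contDiffOn_P j) hzD
  have a2 := fun j => diff_of_contDiffOn (h.contDiffOn_Q j) hzD
  have a3 := fun i k => diff_of_contDiffOn (h.contDiffOn_X_coord i k) hzD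
  have a4 := fun i => diff_of_contDiffOn (h.contDiffOn_zeroQty i) hzD
  have e1 : der D tvec (w.energy D) z
      = ∑ i, 2 * (w.zeroQty D i z * der D tvec (w.zeroQty D i) z) := by
    unfold energy
    simp only [pow_two]
    rw [der_sum _ hu fun i _ => (a4 i).fun_mul (a4 i)]
    refine Finset.sum_congr rfl fun i _ => ?_
    rw [der_mul hu (a4 i) (a4 i)]
    ring
  have e2 : ∀ v k, der D v (w.flux D k) z = ∑ i, (der D v (fun z => (w.X i z).2 k) z
        * cross (fun l => w.P D l z) (fun l => w.Q D l z) i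
      + (w.X i z).2 k
        * der D v (fun z => cross (fun l => w.P D l z) (fun l => w.Q D l z) i) z) := by
    intro v k
    have a5 : ∀ i, DifferentiableWithinAt ℝ
        (fun z => cross (fun l => w.P D l z) (fun l => w.Q D l z) i) D z := by
      intro i
      unfold cross
      fun_prop
    unfold flux
    rw [der_sum _ hu fun i _ => (a3 i k).fun_mul (a5 i)]
    exact Finset.sum_congr rfl fun i _ => der_mul hu (a3 i k) (a5 i)
  -- Because $X_i$ has no $\partial_\tau$ component, the spatial coordinate derivatives alone
  -- reproduce the derivative along $X_i$.
  have e3 : ∀ i (F : Coord → ℝ), ∑ k : Fin 3, (w.X i z).2 k * der D (coordVec k.succ) F z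
      = w.dX D i F z := by
    intro i F
    have : w.X i z = ∑ k : Fin 3, (w.X i z).2 k • coordVec k.succ := by
      conv_lhs => rw [← sum_coordVec (w.X i z)]
      rw [Fin.sum_univ_succ, coordEquiv_symm_zero, hX i z hzD, zero_smul, zero_add]
      rfl
    unfold dX
    conv_rhs => rw [this]
    rw [der_dir_sum]
    simp only [der_dir_smul, smul_eq_mul]
  have e4 : ∀ i, w.dX D i (fun z => cross (fun l => w.P D l z) (fun l => w.Q D l z) i) z
      = w.dX D i (w.P D (i + 1)) z * w.Q D (i + 2) z + w.P D (i + 1) z * w.dX D i (w.Q D (i + 2)) z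
        - (w.dX D i (w.P D (i + 2)) z * w.Q D (i + 1) z
          + w.P D (i + 2) z * w.dX D i (w.Q D (i + 1)) z) := by
    intro i
    unfold dX cross
    simp (disch := fun_prop) only [der_sub hu, der_mul hu]
  -- The identity $\mathrm{div}(P\times Q)=Q\cdot\mathrm{curl}\,P-P\cdot\mathrm{curl}\,Q$, at the
  -- level of principal parts.
  have e5 : ∑ i, 2 * (w.zeroQty D i z * w.principal D i z)
      + ∑ i, w.dX D i (fun z => cross (fun l => w.P D l z) (fun l => w.Q D l z) i) z = 0 := by
    rw [sum_principal]
    simp only [e4, Fin.sum_univ_three]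
    simp only [Fin.isValue, zero_add, Fin.reduceAdd]
    ring
  have e6 : ∑ k : Fin 3, ∑ i, (w.X i z).2 k
        * der D (coordVec k.succ) (fun z => cross (fun l => w.P D l z) (fun l => w.Q D l z) i) z
      = ∑ i, w.dX D i (fun z => cross (fun l => w.P D l z) (fun l => w.Q D l z) i) z := by
    rw [Finset.sum_comm]
    exact Finset.sum_congr rfl fun i _ => e3 i _
  simp only [e1, e2, Finset.sum_add_distrib, e6, mul_sub, Finset.sum_sub_distrib]
  linarith [e5]

theorem isDominated_flux (k : Fin 3) : IsDominated S (w.energy D) (w.flux D k) :=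
  IsDominated.sum _ fun i _ => IsDominated.const_mul hS
    ((h.contDiffOn_X_coord i k).continuousOn.mono hSD)
    (((isDominated_P _).mul energy_nonneg (isDominated_Q _)).sub
      ((isDominated_P _).mul energy_nonneg (isDominated_Q _)))

end Domination

open Set in
/-- Zero quantities which vanish on a hypersurface of constant `τ` vanish in its domain of
dependence. -/
theorem local_propagation {τs τe : ℝ} {U : Set Space} (hD : D = Ico τs τe ×ˢ U) (hU : IsOpen U)
    (hX : ∀ i, ∀ z ∈ D, (w.X i z).1 = 0) {t₁ : ℝ} {x₀ : Space} (hx₀ : (t₁, x₀) ∈ D)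
    (h0 : ∀ x ∈ U, w.energy D (t₁, x) = 0) :
    ∃ ε > 0, ∀ z : Coord, t₁ ≤ z.1 → z.1 ≤ t₁ + ε → dist z.2 x₀ ≤ ε → w.energy D z = 0 := by
  rw [hD, mem_prod] at hx₀
  obtain ⟨⟨ht1, ht2⟩, hxU⟩ := hx₀
  simp only at ht1 ht2 hxU
  set p : Fin 4 → ℝ := coordEquiv.symm (t₁, x₀) with hp
  have hp0 : p 0 = t₁ := rfl
  have hcont : ContinuousAt (fun y : Fin 4 → ℝ => (coordEquiv y).2) p :=
    (continuous_snd.comp coordEquiv.continuous).continuousAt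
  have hev : ∀ᶠ y in nhds p, (coordEquiv y).2 ∈ U := by
    refine hcont.eventually (hU.mem_nhds ?_)
    simpa [hp] using hxU
  obtain ⟨δ, hδ, hball⟩ := Metric.eventually_nhds_iff.1 hev
  -- The box must stay inside the chart and end strictly before $\tau_\bullet$.
  set ρ := min (δ / 2) ((τe - t₁) / 2) with hρ
  have hρpos : 0 < ρ := lt_min (by linarith) (by linarith)
  have hρδ : ρ < δ := (min_le_left _ _).trans_lt (by linarith)
  have hρτ : ρ < τe - t₁ := (min_le_right _ _).trans_lt (by linarith)
  set a : Fin 4 → ℝ := Fin.cons (p 0) fun k => p k.succ - ρ with ha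
  set b : Fin 4 → ℝ := Fin.cons (p 0 + ρ) fun k => p k.succ + ρ with hb
  have hmem : ∀ y, y ∈ Icc a b ↔ (p 0 ≤ y 0 ∧ y 0 ≤ p 0 + ρ) ∧
      ∀ k : Fin 3, |y k.succ - p k.succ| ≤ ρ := by
    intro y
    simp only [mem_Icc, Pi.le_def, Fin.forall_fin_succ (n := 3), ha, hb, Fin.cons_zero,
      Fin.cons_succ, abs_le]
    constructor
    · rintro ⟨⟨h1, h2⟩, h3, h4⟩
      exact ⟨⟨h1, h3⟩, fun k => ⟨by linarith [h2 k], by linarith [h4 k]⟩⟩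
    · rintro ⟨⟨h1, h3⟩, h⟩
      exact ⟨⟨h1, fun k => by linarith [(h k).1]⟩, h3, fun k => by linarith [(h k).2]⟩
  have hBD : ∀ y ∈ Icc a b, coordEquiv y ∈ D := by
    intro y hy
    obtain ⟨⟨h1, h2⟩, h3⟩ := (hmem y).1 hy
    rw [hD]
    refine ⟨⟨?_, ?_⟩, hball ?_⟩
    · exact ht1.trans h1
    · change y 0 < τe
      linarith
    · refine lt_of_le_of_lt (b := ρ) ((dist_pi_le_iff hρpos.le).2 fun i => ?_) hρδ
      rw [Real.dist_eq]
      refine Fin.cases ?_ h3 i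
      rw [abs_of_nonneg (by linarith)]
      linarith
  set S := coordEquiv '' Icc a b with hSdef
  have hS : IsCompact S := isCompact_Icc.image coordEquiv.continuous
  have hSD : S ⊆ D := by
    rintro _ ⟨y, hy, rfl⟩
    exact hBD y hy
  obtain ⟨C, hC, hdiv⟩ := h.isDominated_divergence hS hSD hX
  choose c hc hcur using h.isDominated_flux hS hSD
  set F₀ : Fin 4 → Coord → ℝ := Fin.cons (w.energy D) (w.flux D) with hF₀
  have hsm : ∀ i, ContDiffOn ℝ 1 (F₀ i) D := fun i =>
    Fin.cases h.contDiffOn_energy h.contDiffOn_flux i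
  have hmaps : MapsTo coordEquiv (Icc a b) D := hBD
  have hest := energy_estimate (p := p) (ρ := ρ) (c := ∑ k, c k) (C := C) hρpos
    (Finset.sum_nonneg fun k _ => hc k) (fun i y => F₀ i (coordEquiv y))
    (fun i y => (fderivWithin ℝ (F₀ i) D (coordEquiv y)).comp
      (coordEquiv : (Fin 4 → ℝ) →L[ℝ] Coord)) (Bx := Icc a b)
    (fun y h1 h2 h3 => (hmem y).2 ⟨⟨h1, h2⟩, h3⟩)
    (fun i => (hsm i).continuousOn.comp coordEquiv.continuous.continuousOn hmaps)
    (fun i => (((hsm i).continuousOn_fderivWithin h.dom.uniqueDiffOn (by norm_num)).comp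
      coordEquiv.continuous.continuousOn hmaps).clm_apply continuousOn_const)
    (by
      intro y hy i
      -- The slab contains its initial face and is not a neighbourhood of the points there, but
      -- two-sided derivatives are required only in the interior of the box.
      have hmem : D ∈ nhds (coordEquiv y) := by
        have h1 := coordEquiv.toHomeomorph.isOpenMap.image_mem_nhds (mem_interior_iff_mem_nhds.1 hy)
        exact Filter.mem_of_superset h1 hSD
      have h2 : DifferentiableAt ℝ (F₀ i) (coordEquiv y) :=
        (((hsm i).differentiableOn (by norm_num)) _ (mem_of_mem_nhds hmem)).differentiableAt hmem
      rw [fderivWithin_of_mem_nhds hmem]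
      exact h2.hasFDerivAt.comp y coordEquiv.hasFDerivAt)
    (fun y _ => energy_nonneg _)
    (by
      intro y hy k
      refine (hcur k _ (mem_image_of_mem _ hy)).trans ?_
      exact mul_le_mul_of_nonneg_right (Finset.single_le_sum (fun k _ => hc k) (Finset.mem_univ k))
        (energy_nonneg _))
    (by
      intro y hy
      refine le_trans (le_of_eq ?_) ((le_abs_self _).trans (hdiv _ (mem_image_of_mem _ hy)))
      rw [Fin.sum_univ_succ]
      simp only [ContinuousLinearMap.comp_apply, ContinuousLinearEquiv.coe_coe, coordEquiv_single]
      rfl)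
    (by
      intro y hy hy0 i
      have hyD := hBD y hy
      have he : w.energy D (coordEquiv y) = 0 := by
        have : coordEquiv y = (t₁, (coordEquiv y).2) := Prod.ext hy0 rfl
        rw [this]
        rw [hD] at hyD
        exact h0 _ hyD.2
      refine Fin.cases he (fun k => ?_) i
      have := hcur k _ (mem_image_of_mem _ hy)
      rw [he, mul_zero] at this
      exact norm_le_zero_iff.1 this)
  obtain ⟨ε, hε, hfin⟩ := hest
  refine ⟨ε, hε, fun z h1 h2 h3 => ?_⟩
  have := hfin (coordEquiv.symm z) h1 h2 fun k => by
    rw [coordEquiv_symm_succ, hp, coordEquiv_symm_succ, ← Real.norm_eq_abs, ← PiLp.sub_apply]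
    refine (PiLp.norm_apply_le _ k).trans ?_
    rwa [← dist_eq_norm]
  simpa [hF₀] using this

end Solves
end Reduced

/-! ### Index calculus -/

theorem sum_four {A : Type*} [AddCommMonoid A] (f : Fin 4 → A) :
    ∑ i, f i = f 0 + ∑ i : Fin 3, f i.succ := Fin.sum_univ_succ f

theorem eta_zero_zero : eta 0 0 = -1 := by simp [eta]
theorem eta_zero_succ (i : Fin 3) : eta 0 i.succ = 0 := by
  simp [eta, (Fin.succ_ne_zero i).symm]
theorem eta_succ_zero (i : Fin 3) : eta i.succ 0 = 0 := by simp [eta]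
theorem eta_succ_succ (i j : Fin 3) : eta i.succ j.succ = delta i j := by
  simp [eta, delta]
theorem kron_zero_zero : kron 0 0 = 1 := by simp [kron]
theorem kron_zero_succ (i : Fin 3) : kron 0 i.succ = 0 := by
  simp [kron, (Fin.succ_ne_zero i).symm]
theorem kron_succ_zero (i : Fin 3) : kron i.succ 0 = 0 := by simp [kron]
theorem kron_succ_succ (i j : Fin 3) : kron i.succ j.succ = delta i j := by
  simp [kron, delta]

theorem sum_delta_mul (i : Fin 3) (f : Fin 3 → ℝ) : ∑ j, delta i j * f j = f i := by
  simp [delta]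

theorem sum_mul_delta' (i : Fin 3) (f : Fin 3 → ℝ) : ∑ j, f j * delta j i = f i := by
  simp [delta]

/-! ### Slabs and linear ordinary differential equations -/

/-- The coordinate region `[τ_⋆, τ_•) × U`. -/
def slab (τs τe : ℝ) (U : Set Space) : Set Coord := Set.Ico τs τe ×ˢ U

theorem isRegularDomain_slab (τs τe : ℝ) {U : Set Space} (hU : IsOpen U) :
    IsRegularDomain (slab τs τe U) := by
  refine ⟨(uniqueDiffOn_Ico τs τe).prod hU.uniqueDiffOn, ?_⟩
  rw [slab, interior_prod_eq, closure_prod_eq, hU.interior_eq, interior_Ico]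
  rintro ⟨t, x⟩ ⟨ht, hx⟩
  refine ⟨?_, subset_closure hx⟩
  rw [closure_Ioo (ht.1.trans_lt ht.2).ne]
  exact Set.Ico_subset_Icc_self ht

theorem hasDerivWithinAt_slab {V : Type*} [NormedAddCommGroup V] [NormedSpace ℝ V] {τs τe : ℝ}
    {U : Set Space} {F : Coord → V} {t : ℝ} {x : Space} (hx : x ∈ U)
    (hF : DifferentiableWithinAt ℝ F (slab τs τe U) (t, x)) :
    HasDerivWithinAt (fun s => F (s, x)) (der (slab τs τe U) tvec F (t, x)) (Set.Ico τs τe) t := by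
  have h1 : HasDerivWithinAt (fun s : ℝ => ((s, x) : Coord)) tvec (Set.Ico τs τe) t :=
    ((hasDerivAt_id t).prodMk (hasDerivAt_const t x)).hasDerivWithinAt
  have hm : Set.MapsTo (fun s : ℝ => ((s, x) : Coord)) (Set.Ico τs τe) (slab τs τe U) :=
    fun s hs => ⟨hs, hx⟩
  exact HasFDerivWithinAt.comp_hasDerivWithinAt t hF.hasFDerivWithinAt h1 hm

theorem eq_zero_of_norm_deriv_le {E : Type*} [NormedAddCommGroup E] [NormedSpace ℝ E]
    {f f' : ℝ → E} {a b K : ℝ} (hf : ContinuousOn f (Set.Icc a b))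
    (hf' : ∀ t ∈ Set.Ico a b, HasDerivWithinAt f (f' t) (Set.Ici t) t) (ha : f a = 0)
    (hb : ∀ t ∈ Set.Ico a b, ‖f' t‖ ≤ K * ‖f t‖) : ∀ t ∈ Set.Icc a b, f t = 0 := by
  intro t ht
  have := norm_le_gronwallBound_of_norm_deriv_right_le (δ := 0) (ε := 0) hf hf' (by simp [ha])
    (by simpa using hb) t ht
  rw [gronwallBound_ε0_δ0] at this
  exact norm_le_zero_iff.1 this

/-- The forward Gronwall estimate after reversing time by $s\mapsto a+b-s$. The backward direction
serves to carry a degeneracy of the frame back to the initial hypersurface. -/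
theorem eq_zero_of_norm_deriv_le_left {E : Type*} [NormedAddCommGroup E] [NormedSpace ℝ E]
    {f f' : ℝ → E} {a b K : ℝ} (hf : ContinuousOn f (Set.Icc a b))
    (hf' : ∀ t ∈ Set.Ioc a b, HasDerivWithinAt f (f' t) (Set.Iic t) t) (hb : f b = 0)
    (hK : ∀ t ∈ Set.Ioc a b, ‖f' t‖ ≤ K * ‖f t‖) : ∀ t ∈ Set.Icc a b, f t = 0 := by
  have hmaps : Set.MapsTo (fun s => a + b - s) (Set.Icc a b) (Set.Icc a b) := fun s hs =>
    ⟨by linarith [hs.2], by linarith [hs.1]⟩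
  have key := eq_zero_of_norm_deriv_le (f := fun s => f (a + b - s))
    (f' := fun s => -f' (a + b - s)) (a := a) (b := b) (K := K)
    (hf.comp (by fun_prop) hmaps)
    (by
      intro s hs
      have h1 := hf' (a + b - s) ⟨by linarith [hs.2], by linarith [hs.1]⟩
      have h2 : HasDerivWithinAt (fun s => a + b - s) (-1) (Set.Ici s) s :=
        ((hasDerivAt_id s).const_sub (a + b)).hasDerivWithinAt
      have := h1.scomp s h2 fun r hr => by
        simp only [Set.mem_Ici, Set.mem_Iic] at *
        linarith
      simpa [Function.comp_def] using this)
    (by simpa using hb)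
    (by
      intro s hs
      rw [norm_neg]
      exact hK _ ⟨by linarith [hs.2], by linarith [hs.1]⟩)
  intro t ht
  have := key (a + b - t) (hmaps ht)
  simpa using this

/-- The size of a finite family of functions. -/
def famNorm {ι : Type*} [Fintype ι] (v : ι → Coord → ℝ) (z : Coord) : ℝ := ∑ j, |v j z|

theorem isDominated_famNorm {ι : Type*} [Fintype ι] (v : ι → Coord → ℝ) {S : Set Coord} (i : ι) :
    IsDominated S (famNorm v) (v i) :=
  ⟨1, zero_le_one, fun z _ => by
    rw [one_mul]
    exact Finset.single_le_sum (f := fun j => |v j z|) (fun _ _ => abs_nonneg _)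
      (Finset.mem_univ i)⟩

/-- A family of functions with a homogeneous linear evolution vanishes if it vanishes at one
time. -/
theorem eq_zero_of_linear_evolution {ι : Type*} [Fintype ι] {τs τe : ℝ} {U : Set Space}
    {v : ι → Coord → ℝ} (hv : ∀ i, DifferentiableOn ℝ (v i) (slab τs τe U))
    (hdom : ∀ S, IsCompact S → S ⊆ slab τs τe U → ∀ i,
      IsDominated S (famNorm v) (der (slab τs τe U) tvec (v i)))
    {x : Space} (hx : x ∈ U) {t₁ : ℝ} (ht₁ : t₁ ∈ Set.Ico τs τe) (h0 : ∀ i, v i (t₁, x) = 0) :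
    ∀ t ∈ Set.Ico τs τe, ∀ i, v i (t, x) = 0 := by
  -- The segment over a compact time interval is compact, so the domination constants are uniform
  -- along it; the factor `Fintype.card ι` compares the sum norm of the family with its sup norm.
  have main : ∀ a b : ℝ, a ∈ Set.Ico τs τe → b ∈ Set.Ico τs τe →
      ∃ K, ∀ t ∈ Set.Icc a b, ‖fun i => der (slab τs τe U) tvec (v i) (t, x)‖
        ≤ K * ‖fun i => v i (t, x)‖ := by
    intro a b ha hb
    have hS : IsCompact ((fun s : ℝ => ((s, x) : Coord)) '' Set.Icc a b) :=
      isCompact_Icc.image (by fun_prop)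
    have hSD : (fun s : ℝ => ((s, x) : Coord)) '' Set.Icc a b ⊆ slab τs τe U := by
      rintro _ ⟨s, hs, rfl⟩
      exact ⟨⟨ha.1.trans hs.1, hs.2.trans_lt hb.2⟩, hx⟩
    choose C hC h using hdom _ hS hSD
    refine ⟨(∑ i, C i) * Fintype.card ι, fun t ht => ?_⟩
    have hfam : famNorm v (t, x) ≤ Fintype.card ι * ‖fun i => v i (t, x)‖ := by
      refine (Finset.sum_le_card_nsmul Finset.univ _ _ fun i _ =>
        norm_le_pi_norm (fun i => v i (t, x)) i).trans ?_
      simp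
    have hfam0 : 0 ≤ famNorm v (t, x) := Finset.sum_nonneg fun _ _ => abs_nonneg _
    have hC0 : 0 ≤ ∑ i, C i := Finset.sum_nonneg fun i _ => hC i
    refine (pi_norm_le_iff_of_nonneg (by positivity)).2 fun i => ?_
    refine (h i _ ⟨t, ht, rfl⟩).trans ?_
    rw [mul_assoc]
    exact mul_le_mul (Finset.single_le_sum (fun i _ => hC i) (Finset.mem_univ i)) hfam hfam0 hC0
  have hder : ∀ t ∈ Set.Ico τs τe, HasDerivWithinAt (fun s i => v i (s, x))
      (fun i => der (slab τs τe U) tvec (v i) (t, x)) (Set.Ico τs τe) t := fun t ht =>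
    hasDerivWithinAt_pi.2 fun i => hasDerivWithinAt_slab hx (hv i _ ⟨ht, hx⟩)
  have hcont : ContinuousOn (fun s i => v i (s, x)) (Set.Ico τs τe) := fun t ht =>
    (hder t ht).continuousWithinAt
  intro t ht
  rcases le_total t₁ t with hle | hle
  · obtain ⟨K, hK⟩ := main t₁ t ht₁ ht
    have hsub : Set.Icc t₁ t ⊆ Set.Ico τs τe := fun s hs =>
      ⟨ht₁.1.trans hs.1, hs.2.trans_lt ht.2⟩
    have := eq_zero_of_norm_deriv_le (hcont.mono hsub) (fun s hs =>
      (hder s (hsub (Set.Ico_subset_Icc_self hs))).mono_of_mem_nhdsWithin (by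
        have hs' := hsub (Set.Ico_subset_Icc_self hs)
        exact Filter.mem_of_superset (Ico_mem_nhdsGE hs'.2) (Set.Ico_subset_Ico_left hs'.1)))
      (funext h0) (fun s hs => hK s (Set.Ico_subset_Icc_self hs)) t ⟨hle, le_rfl⟩
    exact congrFun this
  · obtain ⟨K, hK⟩ := main t t₁ ht ht₁
    have hsub : Set.Icc t t₁ ⊆ Set.Ico τs τe := fun s hs =>
      ⟨ht.1.trans hs.1, hs.2.trans_lt ht₁.2⟩
    have := eq_zero_of_norm_deriv_le_left (hcont.mono hsub) (fun s hs =>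
      (hder s (hsub (Set.Ioc_subset_Icc_self hs))).mono_of_mem_nhdsWithin (by
        have hs' := hsub (Set.Ioc_subset_Icc_self hs)
        have h1 : τs < s := lt_of_le_of_lt ht.1 hs.1
        exact Filter.mem_of_superset (Ioc_mem_nhdsLE h1) fun r hr =>
          ⟨hr.1.le, hr.2.trans_lt hs'.2⟩))
      (funext h0) (fun s hs => hK s (Set.Ioc_subset_Icc_self hs)) t ⟨le_rfl, hle⟩
    exact congrFun this

/-! ### Solutions in a chart -/

theorem hasDerivAt_Theta (τ₀ t : ℝ) : HasDerivAt (Theta τ₀) (-(t - τ₀)) t := by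
  have := (((hasDerivAt_id t).sub_const τ₀).pow 2).const_sub 1 |>.div_const 2
  refine this.congr_deriv ?_
  simp
  ring

/-- The derivative of the conformal factor. -/
theorem deriv_Theta (τ₀ t : ℝ) : deriv (Theta τ₀) t = -(t - τ₀) := (hasDerivAt_Theta τ₀ t).deriv

/-- The hypotheses of the main theorem, in a chart. -/
structure LocalSolution (u : LocalFields) (τ₀ τs τe : ℝ) (U : Set Space) : Prop where
  isOpen : IsOpen U
  start : τs < τe
  theta_start : Theta τ₀ τs ≠ 0
  regular : u.Regular (slab τs τe U) 2
  algebraic : ∀ z ∈ slab τs τe U, u.Algebraic z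
  gauge : ∀ z ∈ slab τs τe U, u.Gauge z
  evolution : ∀ z ∈ slab τs τe U, u.Evolution (slab τs τe U) τ₀ z
  adapted : ∀ x ∈ U, u.AdaptedFrame (τs, x)
  constraints : ∀ x ∈ U, u.Constraints (slab τs τe U) τ₀ (τs, x)

/-- The frame vector `e_a` in coordinates. -/
noncomputable def LocalFields.frameVec (u : LocalFields) (a : Fin 4) (z : Coord) : Coord :=
  ∑ μ, u.e a μ z • coordVec μ

theorem LocalFields.dirD_eq (u : LocalFields) (D : Set Coord) (a : Fin 4) (F : Coord → ℝ)
    (z : Coord) : u.dirD D a F z = der D (u.frameVec a z) F z := by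
  simp only [LocalFields.dirD, LocalFields.frameVec, der_dir_sum, der_dir_smul, smul_eq_mul]
  rfl

theorem coordEquiv_symm_frameVec (u : LocalFields) (a μ : Fin 4) (z : Coord) :
    coordEquiv.symm (u.frameVec a z) μ = u.e a μ z := by
  simp [LocalFields.frameVec, map_sum, ← coordEquiv_single, Pi.single_apply]

namespace LocalSolution

variable {u : LocalFields} {τ₀ τs τe : ℝ} {U : Set Space} (h : LocalSolution u τ₀ τs τe U)
include h

theorem dom : IsRegularDomain (slab τs τe U) := isRegularDomain_slab τs τe h.isOpen

theorem mem_start {x : Space} (hx : x ∈ U) : ((τs, x) : Coord) ∈ slab τs τe U :=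
  ⟨⟨le_rfl, h.start⟩, hx⟩

theorem diff_e {z : Coord} (hz : z ∈ slab τs τe U) (a μ : Fin 4) :
    DifferentiableWithinAt ℝ (u.e a μ) (slab τs τe U) z :=
  (h.regular.e a μ).differentiableOn (by norm_num) z hz

theorem diff_Γ {z : Coord} (hz : z ∈ slab τs τe U) (a b c : Fin 4) :
    DifferentiableWithinAt ℝ (u.Γ a b c) (slab τs τe U) z :=
  (h.regular.Γ a b c).differentiableOn (by norm_num) z hz

theorem diff_L {z : Coord} (hz : z ∈ slab τs τe U) (a b : Fin 4) :
    DifferentiableWithinAt ℝ (u.L a b) (slab τs τe U) z :=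
  (h.regular.L a b).differentiableOn (by norm_num) z hz

theorem dirD_zero {z : Coord} (hz : z ∈ slab τs τe U) (F : Coord → ℝ) :
    u.dirD (slab τs τe U) 0 F z = der (slab τs τe U) tvec F z := by
  simp only [LocalFields.dirD, (h.gauge z hz).frame, sum_four, kron_zero_zero, kron_zero_succ,
    zero_mul, Finset.sum_const_zero, add_zero, one_mul]
  rfl

omit h in
theorem dirD_const {z : Coord} (hz : z ∈ slab τs τe U) (a : Fin 4) {F : Coord → ℝ} (c : ℝ)
    (hF : ∀ y ∈ slab τs τe U, F y = c) : u.dirD (slab τs τe U) a F z = 0 := by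
  rw [u.dirD_eq, der_congr hF hz, der_const]

/-- With $e_0=\partial_\tau$, $\hat\Gamma_0=0$ and $\hat L_{0a}=0$ constant along the frame, the
equations of the frame, the connection and the Schouten tensor contain no derivative besides
$\partial_\tau$. This and the next two lemmas record the resulting ordinary differential equations.
-/
theorem dt_e {z : Coord} (hz : z ∈ slab τs τe U) (b ν : Fin 4) :
    der (slab τs τe U) tvec (u.e b ν) z = -∑ c, u.Γ b c 0 z * u.e c ν z := by
  have := (h.evolution z hz).frame b ν
  rw [LocalFields.torsionZero, h.dirD_zero hz,
    dirD_const hz b (kron 0 ν) fun y hy => (h.gauge y hy).frame ν] at this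
  simp only [(h.gauge z hz).connection, zero_sub, neg_mul, Finset.sum_neg_distrib] at this
  linarith

theorem dt_Γ {z : Coord} (hz : z ∈ slab τs τe U) (b c d : Fin 4) :
    der (slab τs τe U) tvec (u.Γ b c d) z = -(∑ f, u.Γ b f 0 z * u.Γ f c d z)
      + (Theta τ₀ z.1 * u.dUp c d 0 b z + ∑ e, S d 0 c e * u.L b e z) := by
  have := (h.evolution z hz).connection c d b
  rw [LocalFields.curvZero, LocalFields.geomCurv, LocalFields.algCurv, h.dirD_zero hz,
    dirD_const hz b 0 fun y hy => (h.gauge y hy).connection c d] at this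
  simp only [(h.gauge z hz).connection, (h.gauge z hz).schouten, sub_zero, mul_zero, zero_mul,
    Finset.sum_const_zero, add_zero] at this
  simp only [mul_comm (u.Γ b _ 0 z)]
  linarith

theorem dt_L {z : Coord} (hz : z ∈ slab τs τe U) (b c : Fin 4) :
    der (slab τs τe U) tvec (u.L b c) z = -(∑ e, u.Γ b e 0 z * u.L e c z)
      + -(z.1 - τ₀) * u.dUp 0 c 0 b z := by
  have := (h.evolution z hz).schouten b c
  rw [LocalFields.cottonZero, LocalFields.hatNabla₂, LocalFields.hatNabla₂, h.dirD_zero hz,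
    dirD_const hz b 0 fun y hy => (h.gauge y hy).schouten c] at this
  simp only [(h.gauge z hz).connection, (h.gauge z hz).schouten, sub_zero, mul_zero, zero_mul,
    Finset.sum_const_zero, zero_sub, dcov, sum_four, if_true, Fin.succ_ne_zero, if_false,
    add_zero, deriv_Theta] at this
  rw [sum_four, (h.gauge z hz).schouten c]
  linarith

/-- A family with a homogeneous linear evolution and vanishing initial values vanishes. -/
theorem eq_zero {ι : Type*} [Fintype ι] {v : ι → Coord → ℝ}
    (hv : ∀ i, DifferentiableOn ℝ (v i) (slab τs τe U))
    (hdom : ∀ S, IsCompact S → S ⊆ slab τs τe U → ∀ i,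
      IsDominated S (famNorm v) (der (slab τs τe U) tvec (v i)))
    (h0 : ∀ x ∈ U, ∀ i, v i (τs, x) = 0) : ∀ z ∈ slab τs τe U, ∀ i, v i z = 0 := by
  rintro ⟨t, x⟩ ⟨ht, hx⟩ i
  exact eq_zero_of_linear_evolution hv hdom hx ⟨le_rfl, h.start⟩ (h0 x hx) t ht i

theorem cont_Γ {S : Set Coord} (hS : S ⊆ slab τs τe U) (a b c : Fin 4) :
    ContinuousOn (u.Γ a b c) S := (h.regular.Γ a b c).continuousOn.mono hS

theorem e_spatial_start {x : Space} (hx : x ∈ U) (i : Fin 3) : u.e i.succ 0 (τs, x) = 0 :=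
  (h.adapted x hx).tangent i

theorem Γ_zero_zero {z : Coord} (hz : z ∈ slab τs τe U) (a : Fin 4) : u.Γ a 0 0 z = u.f a z := by
  have := (h.algebraic z hz).weyl_connection a 0 0
  simp only [sum_four, eta_zero_zero, eta_zero_succ, zero_mul, Finset.sum_const_zero] at this
  linarith

/-- The derivative along a spatial frame vector of a function of `τ` on the initial
hypersurface. -/
theorem dirD_time_start {x : Space} (hx : x ∈ U) (i : Fin 3) {g : ℝ → ℝ}
    (hg : DifferentiableAt ℝ g τs) :
    u.dirD (slab τs τe U) i.succ (fun y => g y.1) (τs, x) = 0 := by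
  have hz := h.mem_start hx
  have h1 : HasFDerivWithinAt (fun y : Coord => g y.1)
      ((deriv g τs) • ContinuousLinearMap.fst ℝ ℝ Space) (slab τs τe U) (τs, x) :=
    (hg.hasDerivAt.comp_hasFDerivAt (f := fun y : Coord => y.1) (τs, x)
      (ContinuousLinearMap.fst ℝ ℝ Space).hasFDerivAt).hasFDerivWithinAt
  rw [u.dirD_eq, der, h1.fderivWithin (h.dom.uniqueDiffOn _ hz)]
  have : (u.frameVec i.succ (τs, x)).1 = u.e i.succ 0 (τs, x) := by
    rw [← coordEquiv_symm_frameVec, coordEquiv_symm_zero]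
  simp [this, h.e_spatial_start hx]

/-- In $\delta_i=0$ both $d_i$ and $\partial_i\Theta$ vanish, which leaves $\Theta f_i=0$ with
$\Theta(\tau_\star)\ne0$. -/
theorem f_start {x : Space} (hx : x ∈ U) (a : Fin 4) : u.f a (τs, x) = 0 := by
  refine Fin.cases ?_ (fun i => ?_) a
  · simp [LocalFields.f, (h.gauge _ (h.mem_start hx)).connection]
  · have := (h.constraints x hx).delta i.succ
    rw [LocalFields.deltaZero, h.dirD_time_start hx i (hasDerivAt_Theta τ₀ τs).differentiableAt]
      at this
    simp only [dcov, Fin.succ_ne_zero, if_false, zero_sub, sub_zero, neg_eq_zero] at this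
    exact (mul_eq_zero.1 this).resolve_left h.theta_start

/-- This is $\Theta\gamma_{ib}=0$. The quadratic term in $\beta_0=\Theta^{-1}\Theta'$ and the
cosmological term, for which $\lambda/6=\tfrac12$, combine to
$\tfrac12\Theta^{-2}\big((\tau-\tau_0)^2-1\big)\eta=-\Theta^{-1}\eta$. -/
theorem gamma_start {x : Space} (hx : x ∈ U) (i : Fin 3) (b : Fin 4) :
    Theta τ₀ τs * u.L i.succ b (τs, x) + (τs - τ₀) * u.Γ i.succ 0 b (τs, x)
      - eta i.succ b = 0 := by
  have hz := h.mem_start hx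
  have hΘ := h.theta_start
  have hγ := (h.constraints x hx).gamma i.succ b
  have hβ : ∀ c : Fin 3, ∀ y, LocalFields.beta τ₀ c.succ y = 0 := fun c y => by
    simp [LocalFields.beta, dcov]
  have hβ0 : ∀ y, LocalFields.beta τ₀ 0 y = (Theta τ₀ y.1)⁻¹ * -(y.1 - τ₀) := fun y => by
    simp [LocalFields.beta, dcov, deriv_Theta]
  have hd : u.dirD (slab τs τe U) i.succ (LocalFields.beta τ₀ b) (τs, x) = 0 := by
    refine Fin.cases ?_ (fun c => ?_) b
    · have e : LocalFields.beta τ₀ 0 = fun y => (fun t => (Theta τ₀ t)⁻¹ * -(t - τ₀)) y.1 := funext hβ0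
      rw [e]
      refine h.dirD_time_start hx i (g := fun t => (Theta τ₀ t)⁻¹ * -(t - τ₀)) ?_
      have := (hasDerivAt_Theta τ₀ τs).differentiableAt
      fun_prop (disch := exact hΘ)
    · exact dirD_const hz _ 0 fun y _ => hβ c y
  simp only [LocalFields.gammaZero, LocalFields.hatNabla₁, hd, sum_four, hβ, hβ0, mul_zero,
    Finset.sum_const_zero, add_zero, zero_sub, zero_mul, Finset.sum_const_zero, lam] at hγ
  have hS : S i.succ b 0 0 = eta i.succ b := by
    refine Fin.cases ?_ (fun c => ?_) b <;>
      simp [S, kron_succ_zero, eta_succ_zero, eta_zero_zero]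
  rw [hS] at hγ
  have e1 : Theta τ₀ τs * (u.L i.succ b (τs, x) + (τs - τ₀) * (Theta τ₀ τs)⁻¹ * u.Γ i.succ 0 b (τs, x)
     + 1 / 2 * eta i.succ b * (Theta τ₀ τs)⁻¹ ^ 2 * ((τs - τ₀) ^ 2 - 1)) = 0 := by
    rw [mul_eq_zero]
    right
    rw [← hγ, inv_pow]
    ring
  have e2 : (τs - τ₀) ^ 2 - 1 = -(2 * Theta τ₀ τs) := by
    rw [Theta]
    ring
  rw [e2] at e1
  have e3 : Theta τ₀ τs * (Theta τ₀ τs)⁻¹ = 1 := mul_inv_cancel₀ hΘ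
  linear_combination e1 - ((τs - τ₀) * u.Γ i.succ 0 b (τs, x)) * e3
    + eta i.succ b * (Theta τ₀ τs * (Theta τ₀ τs)⁻¹ + 1) * e3

/-- The inhomogeneous term in the equation for $\hat L_{b0}$ is the Weyl component $d^0{}_{00b}$,
which is zero by antisymmetry. -/
theorem L_right_zero {z : Coord} (hz : z ∈ slab τs τe U) (b : Fin 4) : u.L b 0 z = 0 := by
  refine h.eq_zero (v := fun b => u.L b 0) (fun b y hy => h.diff_L hy b 0) ?_ ?_ z hz b
  · intro C hC hSD b
    refine IsDominated.congr (f := fun z => -∑ e, u.Γ b e 0 z * u.L e 0 z) ?_ fun y hy => ?_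
    · exact (IsDominated.sum _ fun e _ =>
        (isDominated_famNorm (fun b => u.L b 0) e).const_mul hC (h.cont_Γ hSD b e 0)).neg
    · rw [h.dt_L (hSD hy)]
      have : u.dUp 0 0 0 b y = 0 := by
        refine Finset.sum_eq_zero fun x _ => ?_
        refine Fin.cases ?_ (fun k => by rw [eta_zero_succ, zero_mul]) x
        have := (h.algebraic y (hSD hy)).antisymm_left 0 0 0 b
        rw [show u.d 0 0 0 b y = 0 by linarith, mul_zero]
      rw [this, mul_zero, add_zero]
  · intro x hx b
    refine Fin.cases ((h.gauge _ (h.mem_start hx)).schouten 0) (fun i => ?_) b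
    have := h.gamma_start hx i 0
    rw [h.Γ_zero_zero (h.mem_start hx), h.f_start hx, eta_succ_zero, mul_zero, add_zero,
      sub_zero] at this
    exact (mul_eq_zero.1 this).resolve_left h.theta_start

/-- Tracing the connection equation removes the Weyl term by antisymmetry and reduces the Schouten
term to $4\hat L_{b0}$, zero by `L_right_zero`. What is left is homogeneous in $f$. -/
theorem f_eq_zero {z : Coord} (hz : z ∈ slab τs τe U) (a : Fin 4) : u.f a z = 0 := by
  have hdiff : ∀ a, DifferentiableOn ℝ (u.f a) (slab τs τe U) := fun a y hy => by
    have := h.diff_Γ hy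
    unfold LocalFields.f
    fun_prop
  refine h.eq_zero (v := fun b => u.f b) hdiff ?_ (fun x hx b => h.f_start hx b) z hz a
  intro C hC hSD b
  refine IsDominated.congr (f := fun z => -∑ e, u.Γ b e 0 z * u.f e z) ?_ fun y hy => ?_
  · exact (IsDominated.sum _ fun e _ =>
      (isDominated_famNorm (fun b => u.f b) e).const_mul hC (h.cont_Γ hSD b e 0)).neg
  · have hy := hSD hy
    have hu := h.dom.uniqueDiffOn y hy
    have a1 := h.diff_Γ hy
    have e1 : der (slab τs τe U) tvec (u.f b) y
        = 1 / 4 * ∑ c, der (slab τs τe U) tvec (u.Γ b c c) y := by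
      unfold LocalFields.f
      rw [der_mul hu (by fun_prop) (by fun_prop), der_const, der_sum _ hu fun c _ => a1 b c c]
      ring
    have e2 : ∑ c, (Theta τ₀ y.1 * u.dUp c c 0 b y + ∑ e, S c 0 c e * u.L b e y) = 0 := by
      have hd : ∀ c, u.dUp c c 0 b y = 0 := by
        intro c
        refine Finset.sum_eq_zero fun x _ => ?_
        by_cases hcx : c = x
        · subst hcx
          have := (h.algebraic y hy).antisymm_left c c 0 b
          rw [show u.d c c 0 b y = 0 by linarith, mul_zero]
        · simp [eta, hcx]
      have hS : ∀ e, ∑ c, S c 0 c e = 4 * kron 0 e := by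
        intro e
        fin_cases e <;> simp [Fin.sum_univ_four, S, kron, eta]; norm_num
      simp only [hd, mul_zero, zero_add]
      rw [Finset.sum_comm]
      simp only [← Finset.sum_mul, hS]
      simp [kron, h.L_right_zero hy b]
    rw [e1]
    simp only [h.dt_Γ hy, Finset.sum_add_distrib] at e2 ⊢
    rw [e2, add_zero, Finset.sum_neg_distrib, Finset.sum_comm]
    simp only [LocalFields.f, ← Finset.mul_sum]
    rw [mul_neg, Finset.mul_sum]
    congr 1
    refine Finset.sum_congr rfl fun e _ => ?_
    ring

/-- The coefficient of $e_0{}^0=1$ in the evolution is $\hat\Gamma_i{}^0{}_0=f_i=0$, so the equation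
is homogeneous in the spatial vectors. -/
theorem e_spatial_zero {z : Coord} (hz : z ∈ slab τs τe U) (i : Fin 3) : u.e i.succ 0 z = 0 := by
  refine h.eq_zero (v := fun i : Fin 3 => u.e i.succ 0) (fun i y hy => h.diff_e hy _ _) ?_
    (fun x hx i => h.e_spatial_start hx i) z hz i
  intro C hC hSD i
  refine IsDominated.congr (f := fun z => -∑ j : Fin 3, u.Γ i.succ j.succ 0 z * u.e j.succ 0 z) ?_
    fun y hy => ?_
  · exact (IsDominated.sum _ fun j _ =>
      (isDominated_famNorm (fun i : Fin 3 => u.e i.succ 0) j).const_mul hC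
        (h.cont_Γ hSD _ _ 0)).neg
  · rw [h.dt_e (hSD hy), sum_four, h.Γ_zero_zero (hSD hy), h.f_eq_zero (hSD hy), zero_mul, zero_add]

/-- The connection is metric. -/
theorem metric_connection {z : Coord} (hz : z ∈ slab τs τe U) (a b c : Fin 4) :
    (∑ x, eta b x * u.Γ a x c z) + (∑ x, eta c x * u.Γ a x b z) = 0 := by
  rw [(h.algebraic z hz).weyl_connection, h.f_eq_zero hz]
  ring

theorem Γ_zero_succ {z : Coord} (hz : z ∈ slab τs τe U) (a : Fin 4) (j : Fin 3) :
    u.Γ a 0 j.succ z = u.Γ a j.succ 0 z := by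
  have := h.metric_connection hz a 0 j.succ
  simp only [sum_four, eta_zero_zero, eta_zero_succ, eta_succ_zero, eta_succ_succ, zero_mul,
    Finset.sum_const_zero, sum_delta_mul] at this
  linarith

theorem Γ_antisymm {z : Coord} (hz : z ∈ slab τs τe U) (a : Fin 4) (i j : Fin 3) :
    u.Γ a i.succ j.succ z = -u.Γ a j.succ i.succ z := by
  have := h.metric_connection hz a i.succ j.succ
  simp only [sum_four, eta_succ_zero, eta_succ_succ, zero_mul, sum_delta_mul] at this
  linarith

theorem Γ_zero_zero' {z : Coord} (hz : z ∈ slab τs τe U) (a : Fin 4) : u.Γ a 0 0 z = 0 := by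
  rw [h.Γ_zero_zero hz, h.f_eq_zero hz]

end LocalSolution

/-! ### Second fundamental form, spatial Schouten tensor and their symmetries. -/

namespace LocalFields

/-- The Weingarten map of the hypersurfaces of constant `τ`. -/
def chi (u : LocalFields) (i j : Fin 3) (z : Coord) : ℝ := u.Γ i.succ j.succ 0 z

/-- The spatial components of the Schouten tensor. -/
def ell (u : LocalFields) (i j : Fin 3) (z : Coord) : ℝ := u.L i.succ j.succ z

/-- The electric part of the rescaled Weyl tensor. -/
def elec (u : LocalFields) (i j : Fin 3) (z : Coord) : ℝ := u.d 0 i.succ 0 j.succ z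

end LocalFields

namespace LocalSolution

variable {u : LocalFields} {τ₀ τs τe : ℝ} {U : Set Space} (h : LocalSolution u τ₀ τs τe U)
include h

theorem diff_chi {z : Coord} (hz : z ∈ slab τs τe U) (i j : Fin 3) :
    DifferentiableWithinAt ℝ (u.chi i j) (slab τs τe U) z := h.diff_Γ hz _ _ _

theorem diff_ell {z : Coord} (hz : z ∈ slab τs τe U) (i j : Fin 3) :
    DifferentiableWithinAt ℝ (u.ell i j) (slab τs τe U) z := h.diff_L hz _ _

theorem cont_chi {C : Set Coord} (hC : C ⊆ slab τs τe U) (i j : Fin 3) :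
    ContinuousOn (u.chi i j) C := h.cont_Γ hC _ _ _

theorem cont_ell {C : Set Coord} (hC : C ⊆ slab τs τe U) (i j : Fin 3) :
    ContinuousOn (u.ell i j) C := (h.regular.L _ _).continuousOn.mono hC

theorem elec_symm {z : Coord} (hz : z ∈ slab τs τe U) (i j : Fin 3) :
    u.elec i j z = u.elec j i z := (h.algebraic z hz).pair_symm _ _ _ _

theorem dt_chi {z : Coord} (hz : z ∈ slab τs τe U) (i j : Fin 3) :
    der (slab τs τe U) tvec (u.chi i j) z = -(∑ k, u.chi i k z * u.chi k j z)
      - Theta τ₀ z.1 * u.elec i j z + u.ell i j z := by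
  have e1 := h.dt_Γ hz i.succ j.succ 0
  have e2 : u.dUp j.succ 0 0 i.succ z = -u.elec i j z := by
    have := (h.algebraic z hz).antisymm_left j.succ 0 0 i.succ
    simp only [LocalFields.dUp, sum_four, eta_succ_zero, eta_succ_succ, zero_mul, sum_delta_mul,
      zero_add]
    rw [this, h.elec_symm hz]
    rfl
  have e3 : ∑ e, S 0 0 j.succ e * u.L i.succ e z = u.ell i j z := by
    simp [sum_four, S, kron_zero_succ, eta_zero_zero, eta_succ_zero, eta_succ_succ,
      sum_delta_mul, LocalFields.ell]
  rw [e2, e3, sum_four, (h.gauge z hz).connection, mul_zero, zero_add] at e1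
  unfold LocalFields.chi
  rw [e1]
  ring

theorem dt_ell {z : Coord} (hz : z ∈ slab τs τe U) (i j : Fin 3) :
    der (slab τs τe U) tvec (u.ell i j) z = -(∑ k, u.chi i k z * u.ell k j z)
      + (z.1 - τ₀) * u.elec i j z := by
  have e1 := h.dt_L hz i.succ j.succ
  have e2 : u.dUp 0 j.succ 0 i.succ z = -u.elec i j z := by
    simp only [LocalFields.dUp, sum_four, eta_zero_zero, eta_zero_succ, zero_mul,
      Finset.sum_const_zero]
    rw [h.elec_symm hz]
    simp [LocalFields.elec]
  rw [e2, sum_four, (h.gauge z hz).schouten, mul_zero, zero_add] at e1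
  unfold LocalFields.ell LocalFields.chi
  rw [e1]
  ring

omit h in
theorem diff_Theta {z : Coord} :
    DifferentiableWithinAt ℝ (fun y : Coord => Theta τ₀ y.1) (slab τs τe U) z := by
  exact (hasDerivAt_Theta τ₀ z.1).differentiableAt.comp_differentiableWithinAt z
    differentiableWithinAt_fst

theorem dt_Theta {z : Coord} (hz : z ∈ slab τs τe U) :
    der (slab τs τe U) tvec (fun y : Coord => Theta τ₀ y.1) z = -(z.1 - τ₀) := by
  have h1 : HasFDerivWithinAt (fun y : Coord => Theta τ₀ y.1)
      ((-(z.1 - τ₀)) • ContinuousLinearMap.fst ℝ ℝ Space) (slab τs τe U) z :=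
    ((hasDerivAt_Theta τ₀ z.1).comp_hasFDerivAt (f := fun y : Coord => y.1) z
      (ContinuousLinearMap.fst ℝ ℝ Space).hasFDerivAt).hasFDerivWithinAt
  rw [der, h1.fderivWithin (h.dom.uniqueDiffOn _ hz)]
  simp [tvec]

theorem der_time {z : Coord} (hz : z ∈ slab τs τe U) (v : Coord) :
    der (slab τs τe U) v (fun y : Coord => y.1 - τ₀) z = v.1 := by
  have h1 : HasFDerivWithinAt (fun y : Coord => y.1 - τ₀)
      (ContinuousLinearMap.fst ℝ ℝ Space) (slab τs τe U) z :=
    ((ContinuousLinearMap.fst ℝ ℝ Space).hasFDerivWithinAt).sub_const τ₀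
  rw [der, h1.fderivWithin (h.dom.uniqueDiffOn _ hz)]
  rfl

/-- The conformal transformation law of the Schouten tensor. -/
theorem schouten_relation {z : Coord} (hz : z ∈ slab τs τe U) (i j : Fin 3) :
    Theta τ₀ z.1 * u.ell i j z + (z.1 - τ₀) * u.chi i j z = delta i j := by
  let G : Fin 3 × Fin 3 → Coord → ℝ := fun p z =>
    Theta τ₀ z.1 * u.ell p.1 p.2 z + (z.1 - τ₀) * u.chi p.1 p.2 z - delta p.1 p.2
  suffices H : G (i, j) z = 0 from sub_eq_zero.1 H
  refine h.eq_zero (v := G) ?_ ?_ ?_ z hz (i, j)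
  · rintro ⟨i, j⟩ y hy
    have a1 := h.diff_chi hy
    have a2 := h.diff_ell hy
    have a3 := diff_Theta (τ₀ := τ₀) (τs := τs) (τe := τe) (U := U) (z := y)
    fun_prop
  -- $E$ enters $\Theta\,\partial_\tau\ell$ and $(\tau-\tau_0)\,\partial_\tau\chi$ with opposite
  -- signs and cancels, as do the terms $(\tau-\tau_0)\ell$; the rest is $-\chi G$.
  · rintro C hC hCD ⟨i, j⟩
    refine IsDominated.congr (f := fun z => -∑ k, u.chi i k z * G (k, j) z) ?_ fun y hy => ?_
    · exact (IsDominated.sum _ fun k _ =>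
        (isDominated_famNorm G (k, j)).const_mul hC (h.cont_chi hCD i k)).neg
    · have hy := hCD hy
      have hu := h.dom.uniqueDiffOn y hy
      have a1 := h.diff_chi hy
      have a2 := h.diff_ell hy
      have a3 := diff_Theta (τ₀ := τ₀) (τs := τs) (τe := τe) (U := U) (z := y)
      simp only [G]
      rw [der_sub hu (by fun_prop) (by fun_prop), der_add hu (by fun_prop) (by fun_prop),
        der_mul hu (by fun_prop) (by fun_prop), der_mul hu (by fun_prop) (by fun_prop),
        der_const, h.dt_Theta hy, h.der_time hy, h.dt_chi hy, h.dt_ell hy]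
      simp only [mul_sub, mul_add, Finset.sum_sub_distrib, Finset.sum_add_distrib,
        sum_mul_delta']
      have e1 : ∑ k, u.chi i k y * (Theta τ₀ y.1 * u.ell k j y)
          = Theta τ₀ y.1 * ∑ k, u.chi i k y * u.ell k j y := by
        rw [Finset.mul_sum]
        exact Finset.sum_congr rfl fun k _ => by ring
      have e2 : ∑ k, u.chi i k y * ((y.1 - τ₀) * u.chi k j y)
          = (y.1 - τ₀) * ∑ k, u.chi i k y * u.chi k j y := by
        rw [Finset.mul_sum]
        exact Finset.sum_congr rfl fun k _ => by ring
      rw [e1, e2]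
      simp only [tvec]
      ring
  · rintro x hx ⟨i, j⟩
    have := h.gamma_start hx i j.succ
    rw [h.Γ_zero_succ (h.mem_start hx), eta_succ_succ] at this
    exact this

/-- The only source in the evolution of $[\ell,\chi]$ is the commutator of $E$ with
$\Theta\ell+(\tau-\tau_0)\chi$, which is the identity by `schouten_relation`. Initially $\Theta\ne0$
makes $\ell$ affine in $\chi$. Evolving the commutator avoids division by $\Theta$ later on. -/
theorem chi_ell_comm {z : Coord} (hz : z ∈ slab τs τe U) (i j : Fin 3) :
    ∑ k, u.ell i k z * u.chi k j z = ∑ k, u.chi i k z * u.ell k j z := by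
  let W : Fin 3 × Fin 3 → Coord → ℝ := fun p z =>
    ∑ k, u.ell p.1 k z * u.chi k p.2 z - ∑ k, u.chi p.1 k z * u.ell k p.2 z
  suffices H : W (i, j) z = 0 from sub_eq_zero.1 H
  refine h.eq_zero (v := W) ?_ ?_ ?_ z hz (i, j)
  · rintro ⟨i, j⟩ y hy
    have a1 := h.diff_chi hy
    have a2 := h.diff_ell hy
    fun_prop
  · rintro C hC hCD ⟨i, j⟩
    refine IsDominated.congr (f := fun z => -2 * ∑ k, u.chi i k z * W (k, j) z
      - ∑ k, W (i, k) z * u.chi k j z) ?_ fun y hy => ?_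
    · exact ((IsDominated.sum _ fun k _ =>
        (isDominated_famNorm W (k, j)).const_mul hC (h.cont_chi hCD i k)).const_mul hC
          continuousOn_const).sub
        (IsDominated.sum _ fun k _ =>
          (isDominated_famNorm W (i, k)).mul_const hC (h.cont_chi hCD k j))
    · have hy := hCD hy
      have hu := h.dom.uniqueDiffOn y hy
      have a1 := h.diff_chi hy
      have a2 := h.diff_ell hy
      have s := h.schouten_relation hy
      simp only [W]
      rw [der_sub hu (by fun_prop) (by fun_prop), der_sum _ hu (fun k _ => by fun_prop),
        der_sum _ hu (fun k _ => by fun_prop)]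
      simp only [der_mul hu (a2 _ _) (a1 _ _), der_mul hu (a1 _ _) (a2 _ _), h.dt_chi hy,
        h.dt_ell hy]
      have key : ∑ k, (u.ell i k y * (Theta τ₀ y.1 * u.elec k j y)
          + u.chi i k y * ((y.1 - τ₀) * u.elec k j y))
          = ∑ k, ((u.elec i k y) * (Theta τ₀ y.1 * u.ell k j y)
            + u.elec i k y * ((y.1 - τ₀) * u.chi k j y)) := by
        have l : ∀ k, u.ell i k y * (Theta τ₀ y.1 * u.elec k j y)
            + u.chi i k y * ((y.1 - τ₀) * u.elec k j y) = delta i k * u.elec k j y := fun k => by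
          rw [← s]; ring
        have r : ∀ k, u.elec i k y * (Theta τ₀ y.1 * u.ell k j y)
            + u.elec i k y * ((y.1 - τ₀) * u.chi k j y) = u.elec i k y * delta k j := fun k => by
          rw [← s]; ring
        simp only [l, r, sum_delta_mul, sum_mul_delta']
      simp only [Fin.sum_univ_three] at key ⊢
      linear_combination -key
  · rintro x hx ⟨i, j⟩
    have s := h.schouten_relation (h.mem_start hx)
    refine (mul_eq_zero.1 (?_ : Theta τ₀ τs * _ = 0)).resolve_left h.theta_start
    have e1 : ∀ k, Theta τ₀ τs * (u.ell i k (τs, x) * u.chi k j (τs, x))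
        = delta i k * u.chi k j (τs, x)
          - (τs - τ₀) * (u.chi i k (τs, x) * u.chi k j (τs, x)) := fun k => by
      rw [← s]; ring
    have e2 : ∀ k, Theta τ₀ τs * (u.chi i k (τs, x) * u.ell k j (τs, x))
        = u.chi i k (τs, x) * delta k j
          - (τs - τ₀) * (u.chi i k (τs, x) * u.chi k j (τs, x)) := fun k => by
      rw [← s]; ring
    simp only [W]
    rw [mul_sub, Finset.mul_sum, Finset.mul_sum]
    simp only [e1, e2, Finset.sum_sub_distrib, sum_delta_mul, sum_mul_delta', sub_self]

theorem chi_start_symm {x : Space} (hx : x ∈ U) (i j : Fin 3) :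
    u.chi i j (τs, x) = u.chi j i (τs, x) := by
  have hz := h.mem_start hx
  have := (h.constraints x hx).torsion i.succ j.succ 0
  rw [LocalFields.torsionZero, dirD_const hz _ 0 fun y hy => h.e_spatial_zero hy j,
    dirD_const hz _ 0 fun y hy => h.e_spatial_zero hy i, sum_four, h.Γ_zero_succ hz,
    h.Γ_zero_succ hz, (h.gauge _ hz).frame, kron_zero_zero] at this
  simp only [h.e_spatial_zero hz, mul_zero, Finset.sum_const_zero] at this
  unfold LocalFields.chi
  linarith

theorem ell_start_symm {x : Space} (hx : x ∈ U) (i j : Fin 3) :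
    u.ell i j (τs, x) = u.ell j i (τs, x) := by
  have hz := h.mem_start hx
  have := (h.constraints x hx).sigma i.succ j.succ
  rw [LocalFields.sigmaZero, LocalFields.hatNabla₁, LocalFields.hatNabla₁,
    dirD_const hz _ 0 fun y hy => h.f_eq_zero hy _,
    dirD_const hz _ 0 fun y hy => h.f_eq_zero hy _] at this
  simp only [h.f_eq_zero hz, mul_zero, Finset.sum_const_zero] at this
  unfold LocalFields.ell
  linarith

/-- The symmetric $E$ drops out of the antisymmetric parts, which form a coupled homogeneous system.
For $\ell$ the product $\chi\ell$ must first be reordered by `chi_ell_comm`. -/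
theorem chi_ell_symm {z : Coord} (hz : z ∈ slab τs τe U) (i j : Fin 3) :
    u.chi i j z = u.chi j i z ∧ u.ell i j z = u.ell j i z := by
  let A : (Fin 3 × Fin 3) ⊕ (Fin 3 × Fin 3) → Coord → ℝ :=
    Sum.elim (fun p z => u.chi p.1 p.2 z - u.chi p.2 p.1 z)
      (fun p z => u.ell p.1 p.2 z - u.ell p.2 p.1 z)
  suffices H : ∀ i, A i z = 0 from
    ⟨sub_eq_zero.1 (H (.inl (i, j))), sub_eq_zero.1 (H (.inr (i, j)))⟩
  refine h.eq_zero (v := A) ?_ ?_ ?_ z hz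
  · rintro (⟨i, j⟩ | ⟨i, j⟩) y hy
    · exact (h.diff_chi hy i j).sub (h.diff_chi hy j i)
    · exact (h.diff_ell hy i j).sub (h.diff_ell hy j i)
  · rintro C hC hCD (⟨i, j⟩ | ⟨i, j⟩)
    · refine IsDominated.congr (f := fun z => A (.inr (i, j)) z
        - ∑ k, (A (.inl (i, k)) z * u.chi k j z + u.chi k i z * A (.inl (k, j)) z)) ?_
        fun y hy => ?_
      · exact (isDominated_famNorm A _).sub (IsDominated.sum _ fun k _ =>
          ((isDominated_famNorm A _).mul_const hC (h.cont_chi hCD k j)).add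
            ((isDominated_famNorm A _).const_mul hC (h.cont_chi hCD k i)))
      · have hy := hCD hy
        have hu := h.dom.uniqueDiffOn y hy
        have a1 := h.diff_chi hy
        simp only [A, Sum.elim_inl, Sum.elim_inr]
        rw [der_sub hu (by fun_prop) (by fun_prop), h.dt_chi hy, h.dt_chi hy, h.elec_symm hy j i]
        simp only [Fin.sum_univ_three]
        ring
    · refine IsDominated.congr (f := fun z =>
        -∑ k, (A (.inl (i, k)) z * u.ell k j z + u.chi k i z * A (.inr (k, j)) z)) ?_
        fun y hy => ?_
      · exact (IsDominated.sum _ fun k _ =>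
          ((isDominated_famNorm A _).mul_const hC (h.cont_ell hCD k j)).add
            ((isDominated_famNorm A _).const_mul hC (h.cont_chi hCD k i))).neg
      · have hy := hCD hy
        have hu := h.dom.uniqueDiffOn y hy
        have a1 := h.diff_ell hy
        simp only [A, Sum.elim_inl, Sum.elim_inr]
        rw [der_sub hu (by fun_prop) (by fun_prop), h.dt_ell hy, h.dt_ell hy, h.elec_symm hy j i,
          ← h.chi_ell_comm hy j i]
        simp only [Fin.sum_univ_three]
        ring
  · rintro x hx (⟨i, j⟩ | ⟨i, j⟩)
    · exact sub_eq_zero.2 (h.chi_start_symm hx i j)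
    · exact sub_eq_zero.2 (h.ell_start_symm hx i j)

/-- The fields `e_a` remain linearly independent. -/
theorem frame_nondegenerate {z : Coord} (hz : z ∈ slab τs τe U) :
    (u.frameMatrix z).det ≠ 0 := by
  obtain ⟨t, x⟩ := z
  intro hdet
  -- For a fixed null vector `y`, the numbers $\sum_\nu e_b{}^\nu y_\nu$ obey the homogeneous frame
  -- equation. If they vanish at one time they vanish at $\tau_\star$, where the frame is
  -- nondegenerate.
  obtain ⟨y, hy0, hy⟩ := Matrix.exists_mulVec_eq_zero_iff.2 hdet
  let v : Fin 4 → Coord → ℝ := fun b z => ∑ ν, u.e b ν z * y ν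
  have h0 : ∀ b, v b (t, x) = 0 := fun b => congrFun hy b
  have hv := eq_zero_of_linear_evolution (v := v) (τs := τs) (τe := τe) (U := U)
    (fun b w hw => by
      have := h.diff_e hw
      fun_prop)
    (fun C hC hCD b => by
      refine IsDominated.congr (f := fun z => -∑ c, u.Γ b c 0 z * v c z) ?_ fun w hw => ?_
      · exact (IsDominated.sum _ fun c _ =>
          (isDominated_famNorm v c).const_mul hC (h.cont_Γ hCD b c 0)).neg
      · have hw := hCD hw
        have hu := h.dom.uniqueDiffOn w hw
        have a1 := h.diff_e hw
        simp only [v]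
        rw [der_sum _ hu (fun ν _ => by fun_prop)]
        simp only [der_mul hu (a1 _ _) (differentiableWithinAt_const _), der_const, mul_zero,
          add_zero, h.dt_e hw]
        simp only [Fin.sum_univ_four]
        ring)
    hz.2 hz.1 h0 τs ⟨le_rfl, h.start⟩
  refine (h.adapted x hz.2).nondegenerate (Matrix.exists_mulVec_eq_zero_iff.1 ⟨y, hy0, ?_⟩)
  exact funext hv

end LocalSolution

/-! ### Electric and magnetic parts of Weyl tensors -/

/-- `w` is the Weyl-like tensor with electric part `e` and magnetic part `b`. -/
structure WeylBlock (w : Fin 4 → Fin 4 → Fin 4 → Fin 4 → ℝ) (e b : Fin 3 → Fin 3 → ℝ) : Prop where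
  antisymm_left : ∀ p q r s, w p q r s = -w q p r s
  antisymm_right : ∀ p q r s, w p q r s = -w p q s r
  tt : ∀ i j : Fin 3, w 0 i.succ 0 j.succ = e i j
  ts : ∀ i n : Fin 3, w 0 i.succ (n + 1).succ (n + 2).succ = -b n i
  st : ∀ i n : Fin 3, w (n + 1).succ (n + 2).succ 0 i.succ = -b n i
  ss : ∀ m n : Fin 3, w (m + 1).succ (m + 2).succ (n + 1).succ (n + 2).succ = -e m n

namespace WeylBlock

variable {w : Fin 4 → Fin 4 → Fin 4 → Fin 4 → ℝ} {e b : Fin 3 → Fin 3 → ℝ} (h : WeylBlock w e b)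
include h

theorem self_left (p r s : Fin 4) : w p p r s = 0 := by
  linarith [h.antisymm_left p p r s]

theorem self_right (p q r : Fin 4) : w p q r r = 0 := by
  linarith [h.antisymm_right p q r r]

theorem tt₁ (i j : Fin 3) : w i.succ 0 0 j.succ = -e i j := by
  rw [h.antisymm_left, h.tt]

theorem tt₂ (i j : Fin 3) : w 0 i.succ j.succ 0 = -e i j := by
  rw [h.antisymm_right, h.tt]

theorem tt₃ (i j : Fin 3) : w i.succ 0 j.succ 0 = e i j := by
  rw [h.antisymm_left, h.tt₂, neg_neg]

theorem ts₁ (i n : Fin 3) : w i.succ 0 (n + 1).succ (n + 2).succ = b n i := by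
  rw [h.antisymm_left, h.ts, neg_neg]

theorem ts₂ (i n : Fin 3) : w 0 i.succ (n + 2).succ (n + 1).succ = b n i := by
  rw [h.antisymm_right, h.ts, neg_neg]

theorem ts_add_one (i n : Fin 3) : w 0 i.succ n.succ (n + 1).succ = -b (n + 2) i := by
  have := h.ts i (n + 2)
  rwa [fin3_add_two_add_one, fin3_add_two_add_two] at this

theorem ts_add_two (i n : Fin 3) : w 0 i.succ n.succ (n + 2).succ = b (n + 1) i := by
  have := h.ts₂ i (n + 1)
  rwa [fin3_add_one_add_one, fin3_add_one_add_two] at this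

theorem st_add_one (i n : Fin 3) : w n.succ (n + 1).succ 0 i.succ = -b (n + 2) i := by
  have := h.st i (n + 2)
  rwa [fin3_add_two_add_one, fin3_add_two_add_two] at this

theorem st_add_two (i n : Fin 3) : w n.succ (n + 2).succ 0 i.succ = b (n + 1) i := by
  have := h.st i (n + 1)
  rw [fin3_add_one_add_one, fin3_add_one_add_two] at this
  rw [h.antisymm_left, this, neg_neg]

theorem st_add_one_left (i n : Fin 3) : w (n + 1).succ n.succ 0 i.succ = b (n + 2) i := by
  rw [h.antisymm_left, h.st_add_one, neg_neg]

theorem st_add_two_left (i n : Fin 3) : w (n + 2).succ n.succ 0 i.succ = -b (n + 1) i := by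
  rw [h.antisymm_left, h.st_add_two]

theorem ss_add_one (m j : Fin 3) :
    w (m + 1).succ (m + 2).succ (j + 1).succ j.succ = e m (j + 2) := by
  have := h.ss m (j + 2)
  rw [fin3_add_two_add_one, fin3_add_two_add_two] at this
  rw [h.antisymm_right, this, neg_neg]

theorem ss_add_two (m j : Fin 3) :
    w (m + 1).succ (m + 2).succ (j + 2).succ j.succ = -e m (j + 1) := by
  have := h.ss m (j + 1)
  rwa [fin3_add_one_add_one, fin3_add_one_add_two] at this

theorem ss_left_add_one (m j : Fin 3) :
    w j.succ (j + 1).succ (m + 1).succ (m + 2).succ = -e (j + 2) m := by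
  have := h.ss (j + 2) m
  rwa [fin3_add_two_add_one, fin3_add_two_add_two] at this

theorem ss_left_add_two (m j : Fin 3) :
    w j.succ (j + 2).succ (m + 1).succ (m + 2).succ = e (j + 1) m := by
  have := h.ss (j + 1) m
  rw [fin3_add_one_add_one, fin3_add_one_add_two] at this
  rw [h.antisymm_left, this, neg_neg]

end WeylBlock

theorem eps_self₁₃ (a b d : Fin 4) : eps a b a d = 0 :=
  Matrix.det_zero_of_row_eq (i := 0) (j := 2) (by decide) (by ext j; simp)
theorem eps_self₁₄ (a b c : Fin 4) : eps a b c a = 0 :=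
  Matrix.det_zero_of_row_eq (i := 0) (j := 3) (by decide) (by ext j; simp)
theorem eps_self₂₃ (a b d : Fin 4) : eps a b b d = 0 :=
  Matrix.det_zero_of_row_eq (i := 1) (j := 2) (by decide) (by ext j; simp)
theorem eps_self₂₄ (a b c : Fin 4) : eps a b c b = 0 :=
  Matrix.det_zero_of_row_eq (i := 1) (j := 3) (by decide) (by ext j; simp)
theorem eps_self₃₄ (a b c : Fin 4) : eps a b c c = 0 :=
  Matrix.det_zero_of_row_eq (i := 2) (j := 3) (by decide) (by ext j; simp)

theorem eps_swap (a b c d : Fin 4) : eps b a c d = -eps a b c d := by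
  have := Matrix.det_permute (Equiv.swap (0 : Fin 4) 1)
    (Matrix.of fun i j : Fin 4 => kron (![a, b, c, d] i) j)
  rw [Equiv.Perm.sign_swap (by decide)] at this
  simp only [Units.val_neg, Units.val_one, Int.cast_neg, Int.cast_one, neg_mul, one_mul] at this
  rw [eps, eps, ← this]
  congr 1
  ext i j
  fin_cases i <;> simp [Equiv.swap_apply_def]

theorem eps_swap_right (a b c d : Fin 4) : eps a b d c = -eps a b c d := by
  have := Matrix.det_permute (Equiv.swap (2 : Fin 4) 3)
    (Matrix.of fun i j : Fin 4 => kron (![a, b, c, d] i) j)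
  rw [Equiv.Perm.sign_swap (by decide)] at this
  simp only [Units.val_neg, Units.val_one, Int.cast_neg, Int.cast_one, neg_mul, one_mul] at this
  rw [eps, eps, ← this]
  congr 1
  ext i j
  fin_cases i <;> simp [Equiv.swap_apply_def]

theorem eps_swap_mid (a b c d : Fin 4) : eps a c b d = -eps a b c d := by
  have := Matrix.det_permute (Equiv.swap (1 : Fin 4) 2)
    (Matrix.of fun i j : Fin 4 => kron (![a, b, c, d] i) j)
  rw [Equiv.Perm.sign_swap (by decide)] at this
  simp only [Units.val_neg, Units.val_one, Int.cast_neg, Int.cast_one, neg_mul, one_mul] at this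
  rw [eps, eps, ← this]
  congr 1
  ext i j
  fin_cases i <;> simp [Equiv.swap_apply_def]

theorem eps_one : eps 0 1 2 3 = 1 := by
  rw [eps, ← Matrix.det_one (n := Fin 4)]
  congr 1
  ext i j
  fin_cases i <;> fin_cases j <;> simp [kron]

theorem eps_time (i : Fin 3) : eps 0 i.succ (i + 1).succ (i + 2).succ = 1 := by
  fin_cases i
  · exact eps_one
  · change eps 0 2 3 1 = 1
    rw [eps_swap_right 0 2 1 3, eps_swap_mid 0 1 2 3, eps_one, neg_neg]
  · change eps 0 3 1 2 = 1
    rw [eps_swap_mid 0 1 3 2, eps_swap_right 0 1 2 3, eps_one, neg_neg]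

theorem eps_space (i : Fin 3) : eps (i + 1).succ (i + 2).succ 0 i.succ = 1 := by
  rw [eps_swap_mid, eps_swap, eps_swap_right, eps_swap_mid, eps_time]
  norm_num

theorem sum_eta_eta (F : Fin 4 → Fin 4 → ℝ) (e f : Fin 4) :
    ∑ x, ∑ y, F x y * eta x e * eta y f = F e f * eta e e * eta f f := by
  simp [eta]

namespace LocalFields

variable (u : LocalFields)

/-- The magnetic part of the rescaled Weyl tensor. -/
def magn (n k : Fin 3) (z : Coord) : ℝ := u.d k.succ 0 (n + 1).succ (n + 2).succ z

variable {u} {z : Coord}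

/-- This is the cyclic identity on the four distinct indices 0, 1, 2, 3. -/
theorem Algebraic.magn_trace (h : u.Algebraic z) : ∑ i, u.magn i i z = 0 := by
  have := h.cyclic 0 1 2 3
  have e1 := h.antisymm_left 0 1 2 3
  have e2 := h.antisymm_left 0 2 3 1
  have e3 := h.antisymm_left 0 3 1 2
  simp only [magn, Fin.sum_univ_three]
  change u.d 1 0 2 3 z + u.d 2 0 3 1 z + u.d 3 0 1 2 z = 0
  linarith

theorem Algebraic.elec_trace (h : u.Algebraic z) : ∑ i, u.elec i i z = 0 := by
  have := h.trace_free 0 0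
  simp only [sum_four, eta_zero_zero, eta_zero_succ, eta_succ_zero, eta_succ_succ, zero_mul,
    Finset.sum_const_zero, sum_delta_mul, zero_add, add_zero] at this
  have e0 : u.d 0 0 0 0 z = 0 := by linarith [h.antisymm_left 0 0 0 0]
  rw [e0, mul_zero, zero_add] at this
  rw [← this]
  refine Finset.sum_congr rfl fun i _ => ?_
  rw [h.antisymm_left, h.antisymm_right, neg_neg]
  rfl

/-- The $(0,m)$ trace condition has two surviving terms, which are the two off-diagonal magnetic
components up to sign. -/
theorem Algebraic.magn_symm (h : u.Algebraic z) (i j : Fin 3) : u.magn i j z = u.magn j i z := by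
  have key : ∀ m : Fin 3, u.magn (m + 1) (m + 2) z = u.magn (m + 2) (m + 1) z := fun m => by
    have := h.trace_free 0 m.succ
    simp only [sum_four, eta_zero_zero, eta_zero_succ, eta_succ_zero, eta_succ_succ, zero_mul,
      Finset.sum_const_zero, sum_delta_mul, zero_add, add_zero] at this
    have e0 : u.d 0 0 0 m.succ z = 0 := by linarith [h.antisymm_left 0 0 0 m.succ]
    have e1 : u.d m.succ 0 m.succ m.succ z = 0 := by
      linarith [h.antisymm_right m.succ 0 m.succ m.succ]
    have e2 := h.antisymm_right (m + 1).succ 0 (m + 1).succ m.succ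
    rw [e0, mul_zero, zero_add, sum_cyclic m, e1] at this
    simp only [magn, fin3_add_one_add_one, fin3_add_one_add_two, fin3_add_two_add_one,
      fin3_add_two_add_two]
    linarith
  rcases fin3_cyclic i j with rfl | rfl | rfl
  · rfl
  · have := key (i + 2)
    rwa [fin3_add_two_add_one, fin3_add_two_add_two] at this
  · have := key (i + 1)
    rw [fin3_add_one_add_one, fin3_add_one_add_two] at this
    exact this.symm

/-- The content lies in the purely spatial block: in three dimensions it is determined by its
contraction, and trace-freeness in four dimensions identifies that contraction with $E$. -/
theorem Algebraic.weylBlock (h : u.Algebraic z) :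
    WeylBlock (fun a b c e => u.d a b c e z) (fun i j => u.elec i j z)
      (fun i j => u.magn i j z) where
  antisymm_left p q r s := h.antisymm_left p q r s
  antisymm_right p q r s := h.antisymm_right p q r s
  tt _ _ := rfl
  ts i n := h.antisymm_left _ _ _ _
  st i n := by
    rw [h.pair_symm]
    exact h.antisymm_left _ _ _ _
  ss m n := by
    have tf : ∀ i j : Fin 3, ∑ k : Fin 3, u.d k.succ i.succ k.succ j.succ z = u.elec i j z :=
      fun i j => by
        have := h.trace_free i.succ j.succ
        simp only [sum_four, eta_zero_zero, eta_zero_succ, eta_succ_zero, eta_succ_succ, zero_mul,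
          Finset.sum_const_zero, sum_delta_mul, zero_add, add_zero] at this
        unfold elec
        linarith
    have hz : ∀ a c e, u.d a a c e z = 0 := fun a c e => by linarith [h.antisymm_left a a c e]
    have hz' : ∀ a c e, u.d a c e e z = 0 := fun a c e => by linarith [h.antisymm_right a c e e]
    have d1 := fun i : Fin 3 => tf i i
    have tr := h.elec_trace
    rw [sum_cyclic m, ← tf m m, ← tf (m + 1) (m + 1), ← tf (m + 2) (m + 2)] at tr
    simp only [sum_cyclic m, hz, zero_add, add_zero] at tr
    have s : ∀ a b, u.d a b a b z = u.d b a b a z := fun a b => by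
      rw [h.antisymm_left, h.antisymm_right, neg_neg]
    rcases fin3_cyclic m n with rfl | rfl | rfl
    · have a1 := tf n n
      rw [sum_cyclic n, hz, zero_add] at a1
      rw [← a1]
      linarith [s n.succ (n + 1).succ, s n.succ (n + 2).succ, s (n + 1).succ (n + 2).succ]
    · have a1 := tf m (m + 1)
      rw [sum_cyclic m, hz, hz', zero_add, zero_add] at a1
      rw [fin3_add_one_add_one, fin3_add_one_add_two, ← a1, h.pair_symm, h.antisymm_left,
        h.pair_symm, h.antisymm_left, h.antisymm_right]
      linarith [h.pair_symm (m + 2).succ (m + 1).succ (m + 2).succ m.succ]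
    · have a1 := tf m (m + 2)
      rw [sum_cyclic m, hz, hz', zero_add, add_zero] at a1
      rw [fin3_add_two_add_one, fin3_add_two_add_two, ← a1]
      linarith [h.antisymm_right (m + 1).succ (m + 2).succ m.succ (m + 1).succ,
        h.antisymm_right (m + 1).succ (m + 2).succ (m + 1).succ m.succ,
        h.pair_symm (m + 1).succ (m + 2).succ (m + 1).succ m.succ]

theorem dualWeyl_time (h : u.Algebraic z) (i : Fin 3) (c d : Fin 4) :
    u.dualWeyl 0 i.succ c d z = u.d c d (i + 1).succ (i + 2).succ z := by
  have e0 := h.antisymm_right c d (i + 1).succ (i + 2).succ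
  simp only [dualWeyl, sum_eta_eta]
  simp only [sum_four, sum_cyclic i, eps_self₁₃, eps_self₁₄, eps_self₂₃,
    eps_self₂₄, eps_self₃₄, eps_swap_right 0 i.succ (i + 1).succ (i + 2).succ, eps_time,
    eta_succ_succ, delta_self]
  linarith

theorem dualWeyl_space (h : u.Algebraic z) (i : Fin 3) (c d : Fin 4) :
    u.dualWeyl (i + 1).succ (i + 2).succ c d z = -u.d c d 0 i.succ z := by
  have e0 := h.antisymm_right c d 0 i.succ
  simp only [dualWeyl, sum_eta_eta]
  simp only [sum_four, sum_cyclic i, eps_self₁₃, eps_self₁₄, eps_self₂₃,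
    eps_self₂₄, eps_self₃₄, eps_swap_right (i + 1).succ (i + 2).succ 0 i.succ, eps_space,
    eta_succ_succ, eta_zero_zero, delta_self]
  linarith

/-- Duality acts by $(E,B)\mapsto(-B,E)$, so the divergence of the dual tensor follows from the
formulas for a general `WeylBlock`. -/
theorem Algebraic.weylBlock_dual (h : u.Algebraic z) :
    WeylBlock (fun a b c e => u.dualWeyl a b c e z) (fun i j => -u.magn i j z)
      (fun i j => u.elec i j z) where
  antisymm_left p q r s := by
    simp only [dualWeyl, sum_eta_eta, eps_swap p q, neg_mul, Finset.sum_neg_distrib, mul_neg,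
      neg_neg]
  antisymm_right p q r s := by
    simp only [dualWeyl]
    rw [← mul_neg, ← Finset.sum_neg_distrib]
    congr 1
    refine Finset.sum_congr rfl fun e _ => ?_
    rw [← Finset.sum_neg_distrib]
    refine Finset.sum_congr rfl fun f _ => ?_
    rw [h.antisymm_left r s]
    ring
  tt i j := by
    rw [dualWeyl_time h]
    exact h.weylBlock.ts j i
  ts i n := by
    rw [dualWeyl_time h]
    exact (h.weylBlock.ss n i)
  st i n := by
    rw [dualWeyl_space h]
    exact congrArg Neg.neg (h.pair_symm _ _ _ _)
  ss m n := by
    rw [dualWeyl_space h, h.magn_symm]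
    exact congrArg Neg.neg (h.weylBlock.st m n)

end LocalFields

/-! ### The reduced variables of a solution in a chart -/

/-- The reduced variables. -/
noncomputable def LocalFields.reduced (u : LocalFields) (τ₀ : ℝ) : Reduced where
  X i := u.frameVec i.succ
  n i l := u.Γ i.succ (l + 2).succ (l + 1).succ
  K i j z := -(z.1 - τ₀) * u.ell i j z + 2 * u.chi i j z
  E := u.elec
  B := u.magn
  th z := Theta τ₀ z.1
  th' z := -(z.1 - τ₀)

namespace LocalSolution

variable {u : LocalFields} {τ₀ τs τe : ℝ} {U : Set Space} (h : LocalSolution u τ₀ τs τe U)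
include h

/-- With $\Theta'=-(\tau-\tau_0)$, the relation $\Theta\ell-\Theta'\chi=\delta$ and the definition
$K=\Theta'\ell+2\chi$ form a linear system of determinant $2\Theta+\Theta'^2=1$. It is inverted here
and in `ell_eq` without dividing by $\Theta$. -/
theorem reduced_χ {z : Coord} (hz : z ∈ slab τs τe U) (i j : Fin 3) :
    (u.reduced τ₀).χ i j z = u.chi i j z := by
  have s := h.schouten_relation hz i j
  simp only [Reduced.χ, LocalFields.reduced]
  rw [← s]
  simp only [Theta] at *
  ring

theorem ell_eq {z : Coord} (hz : z ∈ slab τs τe U) (i j : Fin 3) :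
    u.ell i j z = -(z.1 - τ₀) * (u.reduced τ₀).K i j z + 2 * delta i j := by
  have s := h.schouten_relation hz i j
  simp only [LocalFields.reduced]
  rw [← s]
  simp only [Theta] at *
  ring

theorem gam_eq {z : Coord} (hz : z ∈ slab τs τe U) (a b c : Fin 4) :
    u.gam a b c z = u.Γ a b c z := by
  simp [LocalFields.gam, h.f_eq_zero hz]

theorem Γ_self {z : Coord} (hz : z ∈ slab τs τe U) (k l : Fin 3) :
    u.Γ k.succ l.succ l.succ z = 0 := by
  linarith [h.Γ_antisymm hz k.succ l l]

-- The spatial connection is antisymmetric in its last two indices, so the pair `l + 1`, `l + 2` is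
-- labelled by the missing index `l`. The lemmas up to `Γ_add_two_right` list the resulting signs.
omit h in
theorem Γ_two_one {z : Coord} (k l : Fin 3) :
    u.Γ k.succ (l + 2).succ (l + 1).succ z = (u.reduced τ₀).n k l z := rfl

theorem Γ_one_two {z : Coord} (hz : z ∈ slab τs τe U) (k l : Fin 3) :
    u.Γ k.succ (l + 1).succ (l + 2).succ z = -(u.reduced τ₀).n k l z := by
  rw [h.Γ_antisymm hz]
  rfl

omit h in
theorem Γ_add_one_left {z : Coord} (k l : Fin 3) :
    u.Γ k.succ (l + 1).succ l.succ z = (u.reduced τ₀).n k (l + 2) z := by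
  have := Γ_two_one (u := u) (τ₀ := τ₀) (z := z) k (l + 2)
  rwa [fin3_add_two_add_one, fin3_add_two_add_two] at this

theorem Γ_add_two_left {z : Coord} (hz : z ∈ slab τs τe U) (k l : Fin 3) :
    u.Γ k.succ (l + 2).succ l.succ z = -(u.reduced τ₀).n k (l + 1) z := by
  have := h.Γ_one_two hz k (l + 1)
  rwa [fin3_add_one_add_one, fin3_add_one_add_two] at this

theorem Γ_add_one_right {z : Coord} (hz : z ∈ slab τs τe U) (k l : Fin 3) :
    u.Γ k.succ l.succ (l + 1).succ z = -(u.reduced τ₀).n k (l + 2) z := by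
  rw [h.Γ_antisymm hz, Γ_add_one_left (τ₀ := τ₀)]

theorem Γ_add_two_right {z : Coord} (hz : z ∈ slab τs τe U) (k l : Fin 3) :
    u.Γ k.succ l.succ (l + 2).succ z = (u.reduced τ₀).n k (l + 1) z := by
  rw [h.Γ_antisymm hz, h.Γ_add_two_left hz, neg_neg]

omit h in
theorem Γ_time {z : Coord} (k l : Fin 3) : u.Γ k.succ l.succ 0 z = u.chi k l z := rfl

theorem Γ_time' {z : Coord} (hz : z ∈ slab τs τe U) (k l : Fin 3) :
    u.Γ k.succ 0 l.succ z = u.chi k l z := by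
  rw [h.Γ_zero_succ hz]
  rfl

theorem frameVec_fst {z : Coord} (hz : z ∈ slab τs τe U) (i : Fin 3) :
    (u.frameVec i.succ z).1 = 0 := by
  rw [← coordEquiv_symm_zero, coordEquiv_symm_frameVec, h.e_spatial_zero hz]

section Weyl

variable {w : Fin 4 → Fin 4 → Fin 4 → Fin 4 → Coord → ℝ} {e b : Fin 3 → Fin 3 → Coord → ℝ}
  (hw : ∀ z ∈ slab τs τe U, WeylBlock (fun p q r s => w p q r s z) (fun i j => e i j z)
    (fun i j => b i j z))

include hw in
/-- The covariant derivative of the electric part. -/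
theorem nabla_elec {z : Coord} (hz : z ∈ slab τs τe U) (k i j : Fin 3) :
    u.nabla₄ (slab τs τe U) w k.succ 0 i.succ 0 j.succ z
      = (u.reduced τ₀).dX (slab τs τe U) k (e i j) z
    + (cross (fun l => (u.reduced τ₀).n k l z) (fun l => e l j z) i
      + cross (fun l => (u.reduced τ₀).n k l z) (fun l => e i l z) j)
    - (cross (fun l => (u.reduced τ₀).χ k l z) (fun l => b l j z) i
      + cross (fun l => (u.reduced τ₀).χ k l z) (fun l => b l i z) j) := by
  have W := hw z hz
  have e0 : u.dirD (slab τs τe U) k.succ (w 0 i.succ 0 j.succ) z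
      = (u.reduced τ₀).dX (slab τs τe U) k (e i j) z := by
    rw [u.dirD_eq]
    exact der_congr (fun y hy => (hw y hy).tt i j) hz
  rw [LocalFields.nabla₄, e0]
  simp only [h.gam_eq hz, sum_four, h.Γ_zero_zero' hz, h.Γ_time' hz, Γ_time]
  rw [sum_cyclic i, sum_cyclic i, sum_cyclic j, sum_cyclic j]
  simp only [W.self_left, W.self_right, W.tt, W.st_add_one_left, W.st_add_two_left,
    h.Γ_self hz, Γ_add_one_left (τ₀ := τ₀), h.Γ_add_two_left hz, cross, h.reduced_χ hz]
  have c1 := W.antisymm_right 0 i.succ (j + 1).succ j.succ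
  have c2 := W.antisymm_right 0 i.succ (j + 2).succ j.succ
  rw [W.ts_add_one] at c1
  rw [W.ts_add_two] at c2
  rw [c1, c2]
  ring

include hw in
/-- The covariant derivative of the magnetic part. -/
theorem nabla_magn {z : Coord} (hz : z ∈ slab τs τe U) (k m j : Fin 3) :
    u.nabla₄ (slab τs τe U) w k.succ (m + 1).succ (m + 2).succ 0 j.succ z
      = -((u.reduced τ₀).dX (slab τs τe U) k (b m j) z
    + (cross (fun l => (u.reduced τ₀).n k l z) (fun l => b l j z) m
      + cross (fun l => (u.reduced τ₀).n k l z) (fun l => b m l z) j)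
    + (cross (fun l => (u.reduced τ₀).χ k l z) (fun l => e l j z) m
      + cross (fun l => (u.reduced τ₀).χ k l z) (fun l => e m l z) j)) := by
  have W := hw z hz
  have e0 : u.dirD (slab τs τe U) k.succ (w (m + 1).succ (m + 2).succ 0 j.succ) z
      = -(u.reduced τ₀).dX (slab τs τe U) k (b m j) z := by
    rw [u.dirD_eq, der_congr (fun y hy => (hw y hy).st j m) hz,
      der_neg (h.dom.uniqueDiffOn z hz)]
    rfl
  rw [LocalFields.nabla₄, e0]
  simp only [h.gam_eq hz, sum_four, h.Γ_zero_zero' hz, h.Γ_time' hz, Γ_time]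
  rw [sum_cyclic m, sum_cyclic m, sum_cyclic j, sum_cyclic j]
  simp only [W.self_left, W.self_right, W.tt, W.st, W.st_add_one_left, W.st_add_two, W.ss_add_one,
    W.ss_add_two, h.Γ_self hz, Γ_two_one (τ₀ := τ₀), h.Γ_one_two hz, h.Γ_add_one_right hz,
    Γ_add_one_left (τ₀ := τ₀), h.Γ_add_two_left hz, h.Γ_add_two_right hz, cross, h.reduced_χ hz]
  simp only [W.tt₁]
  ring

-- Needed besides `nabla_magn` because `WeylBlock` assumes neither pair symmetry nor symmetry of $e$
-- and $b$: the two index pairs are exchanged, and transposed entries of $e$ appear.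
include hw in
theorem nabla_magn' {z : Coord} (hz : z ∈ slab τs τe U) (k m j : Fin 3) :
    u.nabla₄ (slab τs τe U) w k.succ j.succ 0 (m + 1).succ (m + 2).succ z
      = (u.reduced τ₀).dX (slab τs τe U) k (b m j) z
    + (cross (fun l => (u.reduced τ₀).n k l z) (fun l => b l j z) m
      + cross (fun l => (u.reduced τ₀).n k l z) (fun l => b m l z) j)
    + (cross (fun l => (u.reduced τ₀).χ k l z) (fun l => e j l z) m
      + cross (fun l => (u.reduced τ₀).χ k l z) (fun l => e l m z) j) := by
  have W := hw z hz
  have e0 : u.dirD (slab τs τe U) k.succ (w j.succ 0 (m + 1).succ (m + 2).succ) z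
      = (u.reduced τ₀).dX (slab τs τe U) k (b m j) z := by
    rw [u.dirD_eq, der_congr (fun y hy => (hw y hy).ts₁ j m) hz]
    rfl
  rw [LocalFields.nabla₄, e0]
  simp only [h.gam_eq hz, sum_four, h.Γ_zero_zero' hz, h.Γ_time' hz, Γ_time]
  rw [sum_cyclic j, sum_cyclic j, sum_cyclic m, sum_cyclic m]
  have t1 := W.antisymm_left j.succ 0 m.succ (m + 1).succ
  have t2 := W.antisymm_left j.succ 0 m.succ (m + 2).succ
  have t3 := W.antisymm_right j.succ 0 (m + 1).succ m.succ
  rw [W.ts_add_one] at t1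
  rw [W.ts_add_two] at t2
  rw [t1] at t3
  have t4 : w j.succ 0 (m + 1).succ 0 z = e j (m + 1) z := W.tt₃ _ _
  have t5 : w j.succ 0 0 (m + 2).succ z = -e j (m + 2) z := W.tt₁ _ _
  simp only [W.self_left, W.self_right, W.ts₁, t2, t3, t4, t5, W.ss_left_add_one,
    W.ss_left_add_two, h.Γ_self hz, Γ_two_one (τ₀ := τ₀), h.Γ_one_two hz, h.Γ_add_one_right hz,
    Γ_add_one_left (τ₀ := τ₀), h.Γ_add_two_left hz, h.Γ_add_two_right hz, cross, h.reduced_χ hz]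
  ring

omit hw in
theorem div_eq {z : Coord} (hz : z ∈ slab τs τe U) (p q r : Fin 4) :
    u.div₄ (slab τs τe U) w p q r z = -der (slab τs τe U) tvec (w 0 p q r) z
      + ∑ k : Fin 3, u.nabla₄ (slab τs τe U) w k.succ k.succ p q r z := by
  have e0 : ∀ a, u.nabla₄ (slab τs τe U) w 0 a p q r z
      = der (slab τs τe U) tvec (w a p q r) z := fun a => by
    simp only [LocalFields.nabla₄, h.gam_eq hz, (h.gauge z hz).connection, zero_mul,
      Finset.sum_const_zero, sub_zero, h.dirD_zero hz]
  simp only [LocalFields.div₄, sum_four, eta_zero_zero, eta_zero_succ, eta_succ_zero,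
    eta_succ_succ, zero_mul, Finset.sum_const_zero, add_zero, zero_add, sum_delta_mul, e0]
  ring

-- Antisymmetry in the first pair removes the term with $k=i$; the two remaining spatial terms are
-- those of a curl of the magnetic part.
include hw in
theorem div_spatial {z : Coord} (hz : z ∈ slab τs τe U) (i j : Fin 3) :
    u.div₄ (slab τs τe U) w i.succ 0 j.succ z = -der (slab τs τe U) tvec (e i j) z
      - u.nabla₄ (slab τs τe U) w (i + 1).succ i.succ (i + 1).succ 0 j.succ z
      + u.nabla₄ (slab τs τe U) w (i + 2).succ (i + 2).succ i.succ 0 j.succ z := by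
  have as : ∀ k a c p q : Fin 4, u.nabla₄ (slab τs τe U) w k a c p q z
      = -u.nabla₄ (slab τs τe U) w k c a p q z := fun k a c p q => by
    have W := hw z hz
    have e0 : u.dirD (slab τs τe U) k (w a c p q) z = -u.dirD (slab τs τe U) k (w c a p q) z := by
      rw [u.dirD_eq, der_congr (fun y hy => (hw y hy).antisymm_left a c p q) hz,
        der_neg (h.dom.uniqueDiffOn z hz), u.dirD_eq]
    rw [LocalFields.nabla₄, LocalFields.nabla₄, e0]
    have W1 := W.antisymm_left
    simp only [W1 c _ p q, W1 _ a p q, W1 c a _ q, W1 c a p _, mul_neg, Finset.sum_neg_distrib]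
    ring
  rw [h.div_eq hz, sum_cyclic i, der_congr (fun y hy => (hw y hy).tt i j) hz,
    as (i + 1).succ (i + 1).succ i.succ]
  have : u.nabla₄ (slab τs τe U) w i.succ i.succ i.succ 0 j.succ z = 0 := by
    linarith [as i.succ i.succ i.succ 0 j.succ]
  rw [this]
  ring

end Weyl

end LocalSolution
namespace LocalSolution

variable {u : LocalFields} {τ₀ τs τe : ℝ} {U : Set Space} (h : LocalSolution u τ₀ τs τe U)
include h

/-! ### The reduced evolution system -/

theorem weyl : ∀ z ∈ slab τs τe U, WeylBlock (fun p q r s => u.d p q r s z)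
    (fun i j => u.elec i j z) (fun i j => u.magn i j z) :=
  fun z hz => (h.algebraic z hz).weylBlock

theorem weyl_dual : ∀ z ∈ slab τs τe U, WeylBlock (fun p q r s => u.dualWeyl p q r s z)
    (fun i j => (fun i j y => -u.magn i j y) i j z) (fun i j => u.elec i j z) :=
  fun z hz => (h.algebraic z hz).weylBlock_dual

theorem magn_symm {z : Coord} (hz : z ∈ slab τs τe U) (i j : Fin 3) :
    u.magn i j z = u.magn j i z := (h.algebraic z hz).magn_symm i j

theorem nabla_weyl_elec {z : Coord} (hz : z ∈ slab τs τe U) (k i j : Fin 3) :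
    u.nabla₄ (slab τs τe U) u.d k.succ 0 i.succ 0 j.succ z
      = (u.reduced τ₀).nabE (slab τs τe U) k i j z := by
  rw [h.nabla_elec h.weyl hz]
  simp only [h.magn_symm hz _ i]
  rfl

theorem nabla_weyl_magn {z : Coord} (hz : z ∈ slab τs τe U) (k m j : Fin 3) :
    u.nabla₄ (slab τs τe U) u.d k.succ (m + 1).succ (m + 2).succ 0 j.succ z
      = -(u.reduced τ₀).nabB (slab τs τe U) k m j z :=
  h.nabla_magn h.weyl hz k m j

theorem nabla_weyl_magn' {z : Coord} (hz : z ∈ slab τs τe U) (k m j : Fin 3) :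
    u.nabla₄ (slab τs τe U) u.d k.succ j.succ 0 (m + 1).succ (m + 2).succ z
      = (u.reduced τ₀).nabB (slab τs τe U) k m j z := by
  rw [h.nabla_magn' h.weyl hz]
  simp only [h.elec_symm hz j, h.elec_symm hz _ m]
  rfl

theorem nabla_dual_magn {z : Coord} (hz : z ∈ slab τs τe U) (k m j : Fin 3) :
    u.nabla₄ (slab τs τe U) u.dualWeyl k.succ (m + 1).succ (m + 2).succ 0 j.succ z
      = -(u.reduced τ₀).nabE (slab τs τe U) k m j z := by
  rw [h.nabla_magn h.weyl_dual hz]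
  simp only [Reduced.nabE, LocalFields.reduced, cross]
  ring

/-- Without symmetrisation in $i,j$; the evolution equations impose only the symmetric part. -/
theorem bianchi_electric {z : Coord} (hz : z ∈ slab τs τe U) (i j : Fin 3) :
    u.bianchiZero (slab τs τe U) i.succ 0 j.succ z
      = -der (slab τs τe U) tvec (u.elec i j) z
        + (u.reduced τ₀).curlB (slab τs τe U) i j z := by
  rw [LocalFields.bianchiZero, h.div_spatial h.weyl hz]
  have e1 := h.nabla_weyl_magn hz (i + 1) (i + 2) j
  have e2 := h.nabla_weyl_magn hz (i + 2) (i + 1) j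
  rw [fin3_add_two_add_one, fin3_add_two_add_two] at e1
  rw [fin3_add_one_add_one, fin3_add_one_add_two] at e2
  rw [e1, e2, Reduced.curlB]
  ring

theorem bianchi_magnetic {z : Coord} (hz : z ∈ slab τs τe U) (i j : Fin 3) :
    u.dualBianchiZero (slab τs τe U) i.succ 0 j.succ z
      = der (slab τs τe U) tvec (u.magn i j) z
        + (u.reduced τ₀).curlE (slab τs τe U) i j z := by
  rw [LocalFields.dualBianchiZero, h.div_spatial h.weyl_dual hz]
  have e1 := h.nabla_dual_magn hz (i + 1) (i + 2) j
  have e2 := h.nabla_dual_magn hz (i + 2) (i + 1) j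
  rw [fin3_add_two_add_one, fin3_add_two_add_two] at e1
  rw [fin3_add_one_add_one, fin3_add_one_add_two] at e2
  rw [e1, e2, Reduced.curlE, der_neg (h.dom.uniqueDiffOn z hz)]
  ring

theorem frameVec_smooth (a : Fin 4) : ContDiffOn ℝ 2 (u.frameVec a) (slab τs τe U) := by
  unfold LocalFields.frameVec
  exact ContDiffOn.sum fun μ _ => (h.regular.e a μ).smul contDiffOn_const

theorem dt_frameVec {z : Coord} (hz : z ∈ slab τs τe U) (i : Fin 3) :
    der (slab τs τe U) tvec (u.frameVec i.succ) z
      = -∑ l, u.chi i l z • u.frameVec l.succ z := by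
  have hu := h.dom.uniqueDiffOn z hz
  apply coordEquiv.symm.injective
  have e1 := der_clm (v := tvec) (coordEquiv.symm : Coord →L[ℝ] Fin 4 → ℝ) hu
    ((h.frameVec_smooth i.succ).differentiableOn (by norm_num) z hz)
  have e2 : ∀ μ, der (slab τs τe U) tvec (u.e i.succ μ) z
      = coordEquiv.symm (der (slab τs τe U) tvec (u.frameVec i.succ) z) μ := fun μ => by
    have e3 := der_clm (v := tvec)
      ((ContinuousLinearMap.proj (R := ℝ) (φ := fun _ : Fin 4 => ℝ) μ).comp
        (coordEquiv.symm : Coord →L[ℝ] Fin 4 → ℝ)) hu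
      ((h.frameVec_smooth i.succ).differentiableOn (by norm_num) z hz)
    refine Eq.trans ?_ e3
    refine congrArg (fun F => der (slab τs τe U) tvec F z) (funext fun y => ?_)
    exact (coordEquiv_symm_frameVec u i.succ μ y).symm
  ext μ
  rw [← e2, h.dt_e hz, sum_four, h.Γ_zero_zero' hz, zero_mul, zero_add]
  simp [map_neg, map_sum, map_smul, coordEquiv_symm_frameVec, LocalFields.chi]

theorem dt_n {z : Coord} (hz : z ∈ slab τs τe U) (i l : Fin 3) :
    der (slab τs τe U) tvec ((u.reduced τ₀).n i l) z
      = -(∑ k, u.chi i k z * (u.reduced τ₀).n k l z) + Theta τ₀ z.1 * u.magn i l z := by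
  have e1 := h.dt_Γ hz i.succ (l + 2).succ (l + 1).succ
  have e2 : u.dUp (l + 2).succ (l + 1).succ 0 i.succ z = u.magn i l z := by
    simp only [LocalFields.dUp, sum_four, eta_succ_zero, eta_succ_succ, zero_mul, sum_delta_mul,
      zero_add]
    rw [h.magn_symm hz]
    exact (h.weyl z hz).antisymm_left _ _ _ _ |>.trans (by rw [(h.weyl z hz).st, neg_neg])
  have e3 : ∑ e, S (l + 1).succ 0 (l + 2).succ e * u.L i.succ e z = 0 := by
    simp [S, kron_zero_succ, eta_succ_zero, kron_succ_succ, delta_one_two]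
  rw [e2, e3, sum_four, (h.gauge z hz).connection, mul_zero, zero_add, add_zero] at e1
  exact e1

theorem dt_K {z : Coord} (hz : z ∈ slab τs τe U) (i j : Fin 3) :
    der (slab τs τe U) tvec ((u.reduced τ₀).K i j) z
      = -(∑ k, u.chi i k z * (u.reduced τ₀).K k j z) + u.ell i j z - u.elec i j z := by
  have hu := h.dom.uniqueDiffOn z hz
  have a1 := h.diff_chi hz
  have a2 := h.diff_ell hz
  simp only [LocalFields.reduced]
  rw [der_add hu (by fun_prop) (by fun_prop), der_mul hu (by fun_prop) (by fun_prop),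
    der_mul hu (by fun_prop) (by fun_prop), der_const, der_neg hu, h.der_time hz, h.dt_chi hz,
    h.dt_ell hz]
  simp only [tvec, Theta, Fin.sum_univ_three]
  ring

omit h in
theorem contDiffOn_Theta : ContDiffOn ℝ 2 (fun z : Coord => Theta τ₀ z.1) (slab τs τe U) := by
  unfold Theta
  exact ((contDiff_const.sub ((contDiff_fst.sub contDiff_const).pow 2)).div_const 2).contDiffOn

theorem solves : (u.reduced τ₀).Solves (slab τs τe U) where
  dom := h.dom
  smooth_X i := h.frameVec_smooth i.succ
  smooth_n i j := h.regular.Γ _ _ _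
  smooth_K i j := ((contDiffOn_fst.sub contDiffOn_const).neg.mul (h.regular.L _ _)).add
    (contDiffOn_const.mul (h.regular.Γ _ _ _))
  smooth_E i j := h.regular.d _ _ _ _
  smooth_B i j := h.regular.d _ _ _ _
  smooth_th := contDiffOn_Theta
  smooth_th' := (contDiffOn_fst.sub contDiffOn_const).neg
  symm_K i j z hz := by
    simp only [LocalFields.reduced]
    rw [(h.chi_ell_symm hz i j).1, (h.chi_ell_symm hz i j).2]
  symm_E i j z hz := h.elec_symm hz i j
  symm_B i j z hz := h.magn_symm hz i j
  trace_E z hz := (h.algebraic z hz).elec_trace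
  trace_B z hz := (h.algebraic z hz).magn_trace
  th_sq z _ := by
    simp only [LocalFields.reduced, Theta]
    ring
  dt_th z hz := h.dt_Theta hz
  dt_th' z hz := by
    change der (slab τs τe U) tvec (fun z : Coord => -(z.1 - τ₀)) z = -1
    rw [der_neg (h.dom.uniqueDiffOn z hz), h.der_time hz]
    rfl
  dX_th i z hz := by
    have h1 : HasFDerivWithinAt (fun y : Coord => Theta τ₀ y.1)
        ((-(z.1 - τ₀)) • ContinuousLinearMap.fst ℝ ℝ Space) (slab τs τe U) z :=
      ((hasDerivAt_Theta τ₀ z.1).comp_hasFDerivAt (f := fun y : Coord => y.1) z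
        (ContinuousLinearMap.fst ℝ ℝ Space).hasFDerivAt).hasFDerivWithinAt
    change fderivWithin ℝ (fun y : Coord => Theta τ₀ y.1) _ z (u.frameVec i.succ z) = 0
    rw [h1.fderivWithin (h.dom.uniqueDiffOn _ hz)]
    simp [h.frameVec_fst hz]
  dX_th' i z hz := by
    change der (slab τs τe U) (u.frameVec i.succ z) (fun z : Coord => -(z.1 - τ₀)) z = 0
    rw [der_neg (h.dom.uniqueDiffOn z hz), h.der_time hz, h.frameVec_fst hz, neg_zero]
  dt_X i z hz := by
    simp only [h.reduced_χ hz]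
    exact h.dt_frameVec hz i
  dt_n i j z hz := by
    simp only [Reduced.rhsn, h.reduced_χ hz]
    exact h.dt_n hz i j
  dt_K i j z hz := by
    simp only [Reduced.rhsK, h.reduced_χ hz]
    rw [h.dt_K hz, h.ell_eq hz]
    simp only [LocalFields.reduced]
    ring
  -- Since $E$ is symmetric, the symmetrised equation determines $\partial_\tau E$ completely;
  -- likewise for $B$.
  dt_E i j z hz := by
    have e1 := (h.evolution z hz).electric i j
    rw [h.bianchi_electric hz, h.bianchi_electric hz,
      der_congr (fun y hy => h.elec_symm hy j i) hz] at e1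
    change der (slab τs τe U) tvec (u.elec i j) z = _
    linarith
  dt_B i j z hz := by
    have e1 := (h.evolution z hz).magnetic i j
    rw [h.bianchi_magnetic hz, h.bianchi_magnetic hz,
      der_congr (fun y hy => h.magn_symm hy j i) hz] at e1
    change der (slab τs τe U) tvec (u.magn i j) z = _
    linarith

end LocalSolution
namespace LocalSolution

variable {u : LocalFields} {τ₀ τs τe : ℝ} {U : Set Space} (h : LocalSolution u τ₀ τs τe U)
include h

/-! ### Zero quantities in terms of the reduced variables -/

theorem dirD_chi {z : Coord} (hz : z ∈ slab τs τe U) (i j k : Fin 3) :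
    u.dirD (slab τs τe U) i.succ (u.Γ j.succ k.succ 0) z
      = Theta τ₀ z.1 * (u.reduced τ₀).dX (slab τs τe U) i ((u.reduced τ₀).K j k) z := by
  rw [u.dirD_eq]
  change der _ _ (u.chi j k) z = _
  rw [← der_congr (fun y hy => h.reduced_χ hy j k) hz]
  exact h.solves.dX_χ hz i j k

theorem dirD_ell {z : Coord} (hz : z ∈ slab τs τe U) (i j k : Fin 3) :
    u.dirD (slab τs τe U) i.succ (u.L j.succ k.succ) z
      = -(z.1 - τ₀) * (u.reduced τ₀).dX (slab τs τe U) i ((u.reduced τ₀).K j k) z := by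
  have hu := h.dom.uniqueDiffOn z hz
  have e1 := h.solves.dX_th' i z hz
  have a1 := h.solves.diff_K hz
  have a2 := h.solves.diff_th' hz
  rw [u.dirD_eq]
  change der _ _ (u.ell j k) z = _
  rw [der_congr (fun y hy => h.ell_eq hy j k) hz]
  change der _ _ (fun y => (u.reduced τ₀).th' y * (u.reduced τ₀).K j k y + 2 * delta j k) z = _
  rw [der_add hu (a2.fun_mul (a1 j k)) (differentiableWithinAt_const _), der_mul hu a2 (a1 j k),
    der_const, add_zero]
  refine (congrArg₂ (· + ·) (congrArg₂ (· * ·) e1 rfl) rfl).trans ?_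
  rw [zero_mul, zero_add]
  rfl

omit h in
theorem dirD_n {z : Coord} (i j l : Fin 3) :
    u.dirD (slab τs τe U) i.succ (u.Γ j.succ (l + 2).succ (l + 1).succ) z
      = (u.reduced τ₀).dX (slab τs τe U) i ((u.reduced τ₀).n j l) z := u.dirD_eq _ _ _ _

/-- The contribution of $e_0$ to the torsion is the antisymmetric part of $\chi$, which is zero, so
the spatial torsion `T` is the whole of it. -/
theorem torsion_eq {z : Coord} (hz : z ∈ slab τs τe U) (m : Fin 3) (ν : Fin 4) :
    u.torsionZero (slab τs τe U) (m + 1).succ (m + 2).succ ν z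
      = coordEquiv.symm ((u.reduced τ₀).T (slab τs τe U) m z) ν := by
  have hu := h.dom.uniqueDiffOn z hz
  have e2 : ∀ i j : Fin 3, coordEquiv.symm ((u.reduced τ₀).dX (slab τs τe U) i
      ((u.reduced τ₀).X j) z) ν = u.dirD (slab τs τe U) i.succ (u.e j.succ ν) z := fun i j => by
    have e3 := der_clm (v := u.frameVec i.succ z)
      ((ContinuousLinearMap.proj (R := ℝ) (φ := fun _ : Fin 4 => ℝ) ν).comp
        (coordEquiv.symm : Coord →L[ℝ] Fin 4 → ℝ)) hu (h.solves.diff_X hz j)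
    rw [u.dirD_eq]
    refine e3.symm.trans ?_
    refine congrArg (fun F => der (slab τs τe U) (u.frameVec i.succ z) F z) (funext fun y => ?_)
    exact coordEquiv_symm_frameVec u j.succ ν y
  have e4 : ∀ j, coordEquiv.symm ((u.reduced τ₀).X j z) ν = u.e j.succ ν z := fun j =>
    coordEquiv_symm_frameVec u j.succ ν z
  rw [LocalFields.torsionZero, Reduced.T]
  simp only [map_add, map_sub, map_smul, Pi.add_apply, Pi.sub_apply, Pi.smul_apply, e2, e4, smul_eq_mul, Reduced.trn, sum_four, sum_cyclic m, h.Γ_time' hz,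
    h.Γ_self hz, h.Γ_one_two hz, Γ_two_one (τ₀ := τ₀), h.Γ_add_one_right hz,
    h.Γ_add_two_right hz, (h.chi_ell_symm hz (m + 1) (m + 2)).1]
  ring

theorem bianchi_time {z : Coord} (hz : z ∈ slab τs τe U) (j : Fin 3) :
    u.bianchiZero (slab τs τe U) 0 0 j.succ z = -(u.reduced τ₀).P (slab τs τe U) j z := by
  have e0 : ∀ k i j : Fin 3, u.nabla₄ (slab τs τe U) u.d k.succ i.succ 0 0 j.succ z
      = -(u.reduced τ₀).nabE (slab τs τe U) k i j z := fun k i j => by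
    rw [← h.nabla_weyl_elec hz, LocalFields.nabla₄, LocalFields.nabla₄, u.dirD_eq, u.dirD_eq,
      der_congr (fun y hy => (h.algebraic y hy).antisymm_left i.succ 0 0 j.succ) hz,
      der_neg (h.dom.uniqueDiffOn z hz)]
    have W1 := (h.algebraic z hz).antisymm_left
    simp only [W1 i.succ 0, W1 i.succ _ 0 j.succ, W1 _ 0 0 j.succ, mul_neg,
      Finset.sum_neg_distrib]
    ring
  rw [LocalFields.bianchiZero, h.div_eq hz]
  simp only [e0, Finset.sum_neg_distrib, Reduced.P]
  rw [der_zero_fun (fun y hy => (h.weyl y hy).self_left 0 0 j.succ) hz, neg_zero, zero_add]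

theorem bianchi_space {z : Coord} (hz : z ∈ slab τs τe U) (n : Fin 3) :
    u.bianchiZero (slab τs τe U) 0 (n + 1).succ (n + 2).succ z
      = (u.reduced τ₀).Q (slab τs τe U) n z := by
  rw [LocalFields.bianchiZero, h.div_eq hz,
    der_zero_fun (fun y hy => (h.weyl y hy).self_left 0 _ _) hz, neg_zero, zero_add, Reduced.Q]
  refine Finset.sum_congr rfl fun k _ => ?_
  rw [h.nabla_weyl_magn' hz, ← h.nabla_weyl_magn' hz, h.nabla_magn' h.weyl hz, Reduced.nabB]
  simp only [Reduced.dX]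
  rw [der_congr (fun y hy => h.magn_symm hy n k) hz]
  simp only [LocalFields.reduced, cross, h.magn_symm hz n, h.magn_symm hz _ k, h.elec_symm hz _ n]
  ring

theorem algCurv_spatial {z : Coord} (hz : z ∈ slab τs τe U) (m k : Fin 3) :
    u.algCurv τ₀ (k + 2).succ (k + 1).succ (m + 1).succ (m + 2).succ z
      = Theta τ₀ z.1 * u.elec m k z + u.ell m k z - delta m k * ∑ i, u.ell i i z := by
  have e1 : u.dUp (k + 2).succ (k + 1).succ (m + 1).succ (m + 2).succ z = u.elec m k z := by
    simp only [LocalFields.dUp, sum_four, eta_succ_zero, eta_succ_succ, zero_mul, sum_delta_mul,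
      zero_add]
    rw [h.elec_symm hz]
    exact (h.weyl z hz).antisymm_left _ _ _ _ |>.trans (by rw [(h.weyl z hz).ss, neg_neg])
  have e2 : ∀ i j, u.L (Fin.succ i) (Fin.succ j) z = u.ell i j z := fun _ _ => rfl
  rw [LocalFields.algCurv, e1, sum_four]
  simp only [S, kron_succ_succ, kron_succ_zero, eta_succ_succ, eta_succ_zero, e2, sum_cyclic m]
  rcases fin3_cyclic m k with hk | hk | hk <;>
  simp only [hk, fin3_add_one_add_one, fin3_add_one_add_two, fin3_add_two_add_one,
    fin3_add_two_add_two, delta_self, delta_add_one, delta_add_two, delta_add_one_left,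
    delta_add_two_left, delta_one_two, delta_two_one, (h.chi_ell_symm hz (m + 1) m).2,
    (h.chi_ell_symm hz (m + 2) m).2] <;>
  ring

theorem geomCurv_spatial {z : Coord} (hz : z ∈ slab τs τe U) (m k : Fin 3) :
    u.curvZero (slab τs τe U) τ₀ (k + 2).succ (k + 1).succ (m + 1).succ (m + 2).succ z
      = (u.reduced τ₀).R (slab τs τe U) m k z := by
  have e0 := h.reduced_χ hz
  -- The trace of $2\delta$ is 6. Together with the $2\delta$ in $\ell$ itself it produces the
  -- constant $4\delta$ in the Gauss constraint.
  have e1 : ∑ i, u.ell i i z = -(z.1 - τ₀) * (u.reduced τ₀).trK z + 6 := by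
    simp only [h.ell_eq hz, Reduced.trK, Fin.sum_univ_three, delta_self]
    ring
  rw [LocalFields.curvZero, h.algCurv_spatial hz, e1, h.ell_eq hz, LocalFields.geomCurv, dirD_n
    (τ₀ := τ₀), dirD_n (τ₀ := τ₀)]
  simp only [sum_four, (h.gauge z hz).connection]
  rw [sum_cyclic m, sum_cyclic k]
  simp only [h.Γ_time' hz, Γ_time, h.Γ_self hz, h.Γ_one_two hz, Γ_two_one (τ₀ := τ₀),
    h.Γ_add_one_right hz, h.Γ_add_two_right hz, h.Γ_add_two_left hz, Reduced.R, Reduced.trn, sum_cyclic m, cross, e0]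
  change _ = _ - Theta τ₀ z.1 * u.elec m k z - -(z.1 - τ₀) * (_ - _) + _
  ring

/-- In $\chi=\Theta K-\Theta'\delta$ the second term is parallel, and the Weyl term is $\Theta B$; a
factor $\Theta$ comes out of everything. -/
theorem curv_mixed {z : Coord} (hz : z ∈ slab τs τe U) (m k : Fin 3) :
    u.curvZero (slab τs τe U) τ₀ k.succ 0 (m + 1).succ (m + 2).succ z
      = Theta τ₀ z.1 * (u.reduced τ₀).Y (slab τs τe U) m k z := by
  have e0 : ∀ i j, u.chi i j z = Theta τ₀ z.1 * (u.reduced τ₀).K i j z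
      - -(z.1 - τ₀) * delta i j := fun i j => (h.reduced_χ hz i j).symm
  have e1 : u.dUp k.succ 0 (m + 1).succ (m + 2).succ z = u.magn m k z := by
    simp only [LocalFields.dUp, sum_four, eta_succ_zero, eta_succ_succ, zero_mul, sum_delta_mul,
      zero_add]
    rfl
  have hB : (u.reduced τ₀).B m k z = u.magn m k z := rfl
  rw [LocalFields.curvZero, LocalFields.algCurv, e1, LocalFields.geomCurv, h.dirD_chi hz,
    h.dirD_chi hz]
  simp only [sum_four, (h.gauge z hz).connection, h.Γ_zero_zero' hz, h.L_right_zero hz, S,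
    kron_zero_succ, eta_zero_succ, Γ_time, e0, cross, Reduced.Y, Reduced.trn, sum_cyclic m, hB]
  rcases fin3_cyclic m k with hk | hk | hk <;>
  simp only [hk, fin3_add_one_add_one, fin3_add_one_add_two, fin3_add_two_add_one,
    fin3_add_two_add_two, delta_self, delta_add_one, delta_add_two, delta_add_one_left,
    delta_add_two_left, delta_one_two, delta_two_one, h.Γ_self hz, h.Γ_one_two hz,
    Γ_two_one (τ₀ := τ₀),
    h.Γ_add_one_right hz, h.Γ_add_two_right hz, Γ_add_one_left (τ₀ := τ₀), h.Γ_add_two_left hz] <;>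
  ring

/-- In $\ell=\Theta'K+2\delta$ the second term is again parallel, and the Weyl term carries
$d_0=\Theta'$; this time the common factor is $\Theta'$. -/
theorem cotton_eq {z : Coord} (hz : z ∈ slab τs τe U) (m k : Fin 3) :
    u.cottonZero (slab τs τe U) τ₀ (m + 1).succ (m + 2).succ k.succ z
      = -(z.1 - τ₀) * (u.reduced τ₀).Y (slab τs τe U) m k z := by
  have e0 : ∀ i j : Fin 3, u.L i.succ j.succ z = -(z.1 - τ₀) * (u.reduced τ₀).K i j z
      + 2 * delta i j := fun i j => h.ell_eq hz i j
  have e1 : u.dUp 0 k.succ (m + 1).succ (m + 2).succ z = u.magn m k z := by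
    simp only [LocalFields.dUp, sum_four, eta_zero_zero, eta_zero_succ, zero_mul,
      Finset.sum_const_zero, add_zero]
    rw [(h.weyl z hz).ts]
    ring
  have hB : (u.reduced τ₀).B m k z = u.magn m k z := rfl
  simp only [LocalFields.cottonZero, LocalFields.hatNabla₂, h.dirD_ell hz, dcov, sum_four, if_true,
    Fin.succ_ne_zero, if_false, e1, zero_mul, Finset.sum_const_zero, add_zero, deriv_Theta,
    (h.gauge z hz).schouten, h.L_right_zero hz, mul_zero, zero_add, e0]
  simp only [cross, Reduced.Y, Reduced.trn, sum_cyclic m, hB]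
  rcases fin3_cyclic m k with hk | hk | hk <;>
  simp only [hk, fin3_add_one_add_one, fin3_add_one_add_two, fin3_add_two_add_one,
    fin3_add_two_add_two, delta_self, delta_add_one, delta_add_two, delta_add_one_left,
    delta_add_two_left, delta_one_two, delta_two_one, h.Γ_self hz, h.Γ_one_two hz,
    Γ_two_one (τ₀ := τ₀),
    h.Γ_add_one_right hz, h.Γ_add_two_right hz, Γ_add_one_left (τ₀ := τ₀), h.Γ_add_two_left hz] <;>
  ring

/-- Curvature yields $\Theta Y$ and the Cotton quantity yields $\Theta'Y$. As $2\Theta+\Theta'^2=1$,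
the combination recovers $Y$ with no division. -/
theorem Y_eq {z : Coord} (hz : z ∈ slab τs τe U) (m k : Fin 3) :
    (u.reduced τ₀).Y (slab τs τe U) m k z
      = 2 * u.curvZero (slab τs τe U) τ₀ k.succ 0 (m + 1).succ (m + 2).succ z
        - (z.1 - τ₀) * u.cottonZero (slab τs τe U) τ₀ (m + 1).succ (m + 2).succ k.succ z := by
  rw [h.curv_mixed hz, h.cotton_eq hz, Theta]
  ring

theorem energy_start {x : Space} (hx : x ∈ U) :
    (u.reduced τ₀).energy (slab τs τe U) (τs, x) = 0 := by
  have hz := h.mem_start hx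
  have c := h.constraints x hx
  refine (Reduced.energy_eq_zero_iff _).2 ?_
  rintro (⟨m, ν⟩ | ⟨m, k⟩ | ⟨m, k⟩ | j | j)
  · exact (h.torsion_eq hz m ν).symm.trans (c.torsion _ _ _)
  · exact (h.geomCurv_spatial hz m k).symm.trans (c.curvature _ _ _ _)
  · refine (h.Y_eq hz m k).trans ?_
    rw [c.curvature, c.cotton]
    ring
  · have := (h.bianchi_time hz j).symm.trans (c.bianchi _ _ _)
    exact neg_eq_zero.1 this
  · exact (h.bianchi_space hz j).symm.trans (c.bianchi _ _ _)

end LocalSolution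

/-! ### Invariance under changes of coordinates -/

section der

variable {V : Type*} [NormedAddCommGroup V] [NormedSpace ℝ V] {D D' O : Set Coord} {z v : Coord}

theorem der_inter {F : Coord → V} (hO : IsOpen O) (hz : z ∈ O) :
    der (D ∩ O) v F z = der D v F z := by
  rw [der, der, fderivWithin_inter (hO.mem_nhds hz)]

theorem der_comp {F : Coord → V} {Φ : Coord → Coord} (hu : UniqueDiffWithinAt ℝ D z)
    (hF : DifferentiableWithinAt ℝ F D' (Φ z)) (hΦ : DifferentiableWithinAt ℝ Φ D z)
    (hm : Set.MapsTo Φ D D') :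
    der D v (fun y => F (Φ y)) z = der D' (der D v Φ z) F (Φ z) := by
  have := fderivWithin_comp z hF hΦ hm hu
  rw [der, show (fun y => F (Φ y)) = F ∘ Φ from rfl, this]
  rfl

end der

namespace Reduced

theorem zeroQty_inter (w : Reduced) {D O : Set Coord} {z : Coord} (hO : IsOpen O) (hz : z ∈ O)
    (i : ZeroIndex) : w.zeroQty (D ∩ O) i z = w.zeroQty D i z := by
  have e : ∀ {V : Type} [NormedAddCommGroup V] [NormedSpace ℝ V] (i : Fin 3) (F : Coord → V),
      w.dX (D ∩ O) i F z = w.dX D i F z := fun i F => der_inter hO hz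
  rcases i with ⟨m, ν⟩ | ⟨m, k⟩ | ⟨m, k⟩ | j | j
  · simp only [zeroQty, T, e]
  · simp only [zeroQty, R, e]
  · simp only [zeroQty, Y, e]
  · simp only [zeroQty, P, nabE, e]
  · simp only [zeroQty, Q, nabB, e]

/-- `w'` is the image of `w` under the map `Φ` on `D`. -/
structure IsImage (w w' : Reduced) (D D' : Set Coord) (Φ : Coord → Coord) : Prop where
  mapsTo : Set.MapsTo Φ D D'
  smooth : ContDiffOn ℝ 2 Φ D
  X : ∀ i, ∀ z ∈ D, w'.X i (Φ z) = der D (w.X i z) Φ z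
  n : ∀ i j, ∀ z ∈ D, w'.n i j (Φ z) = w.n i j z
  K : ∀ i j, ∀ z ∈ D, w'.K i j (Φ z) = w.K i j z
  E : ∀ i j, ∀ z ∈ D, w'.E i j (Φ z) = w.E i j z
  B : ∀ i j, ∀ z ∈ D, w'.B i j (Φ z) = w.B i j z
  th : ∀ z ∈ D, w'.th (Φ z) = w.th z
  th' : ∀ z ∈ D, w'.th' (Φ z) = w.th' z

namespace IsImage

variable {w w' : Reduced} {D D' : Set Coord} {Φ : Coord → Coord} (h : IsImage w w' D D' Φ)
  (hD : IsRegularDomain D) (hw' : w'.Solves D')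
include h hD

theorem dX {V : Type*} [NormedAddCommGroup V] [NormedSpace ℝ V] {F' F : Coord → V} {z : Coord}
    (hz : z ∈ D) (hF' : DifferentiableWithinAt ℝ F' D' (Φ z)) (hF : ∀ y ∈ D, F' (Φ y) = F y)
    (i : Fin 3) : w'.dX D' i F' (Φ z) = w.dX D i F z := by
  rw [Reduced.dX, h.X i z hz, ← der_comp (hD.uniqueDiffOn z hz) hF'
    (h.smooth.differentiableOn (by norm_num) z hz) h.mapsTo, der_congr hF hz]
  rfl

include hw'

/-- The torsion is a vector field: it transforms by the differential of the coordinate change, the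
second derivatives of $\Phi$ cancelling in the bracket. -/
theorem T (hX : ∀ i, ContDiffOn ℝ 2 (w.X i) D) {z : Coord} (hz : z ∈ D) (m : Fin 3) :
    w'.T D' m (Φ z) = der D (w.T D m z) Φ z := by
  have hXd : ∀ i, DifferentiableWithinAt ℝ (w.X i) D z := fun i =>
    (hX i).differentiableOn (by norm_num) z hz
  have e : ∀ i j, w'.dX D' i (w'.X j) (Φ z) = w.dX D i (fun y => der D (w.X j y) Φ y) z :=
    fun i j => h.dX hD hz (hw'.diff_X (h.mapsTo hz) j) (h.X j) i
  have c := der_comm hD hz h.smooth (hXd (m + 1)) (hXd (m + 2))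
  simp only [Reduced.T, Reduced.trn, e, h.n _ _ z hz, h.X _ z hz, der_dir_add, der_dir_sub,
    der_dir_sum, der_dir_smul]
  rw [← der_dir_sub]
  simp only [Reduced.dX]
  rw [c]

/-- All zero-quantities but the torsion are scalars built from scalars and frame derivatives, hence
unchanged; the torsion changes by a linear map, which preserves its vanishing. -/
theorem zeroQty (hX : ∀ i, ContDiffOn ℝ 2 (w.X i) D) {z : Coord} (hz : z ∈ D)
    (h0 : ∀ i, w.zeroQty D i z = 0) (i : ZeroIndex) : w'.zeroQty D' i (Φ z) = 0 := by
  have hz' := h.mapsTo hz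
  have hn : ∀ i a b, w'.dX D' i (w'.n a b) (Φ z) = w.dX D i (w.n a b) z := fun i a b =>
    h.dX hD hz (hw'.diff_n hz' a b) (h.n a b) i
  have hK : ∀ i a b, w'.dX D' i (w'.K a b) (Φ z) = w.dX D i (w.K a b) z := fun i a b =>
    h.dX hD hz (hw'.diff_K hz' a b) (h.K a b) i
  have hE : ∀ i a b, w'.dX D' i (w'.E a b) (Φ z) = w.dX D i (w.E a b) z := fun i a b =>
    h.dX hD hz (hw'.diff_E hz' a b) (h.E a b) i
  have hB : ∀ i a b, w'.dX D' i (w'.B a b) (Φ z) = w.dX D i (w.B a b) z := fun i a b =>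
    h.dX hD hz (hw'.diff_B hz' a b) (h.B a b) i
  rcases i with ⟨m, ν⟩ | ⟨m, k⟩ | ⟨m, k⟩ | j | j
  · have hT : w.T D m z = 0 := by
      apply coordEquiv.symm.injective
      rw [map_zero]
      exact funext fun ν => h0 (.inl (m, ν))
    change coordEquiv.symm (w'.T D' m (Φ z)) ν = 0
    rw [h.T hD hw' hX hz, hT, der_dir_zero, map_zero, Pi.zero_apply]
  · refine Eq.trans ?_ (h0 (.inr (.inl (m, k))))
    simp only [Reduced.zeroQty, R, trn, trK, χ, hn, h.n _ _ z hz, h.K _ _ z hz, h.E _ _ z hz,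
      h.th z hz, h.th' z hz]
  · refine Eq.trans ?_ (h0 (.inr (.inr (.inl (m, k)))))
    simp only [Reduced.zeroQty, Y, trn, hK, h.n _ _ z hz, h.K _ _ z hz, h.B _ _ z hz]
  · refine Eq.trans ?_ (h0 (.inr (.inr (.inr (.inl j)))))
    simp only [Reduced.zeroQty, P, nabE, χ, hE, h.n _ _ z hz, h.K _ _ z hz, h.E _ _ z hz,
      h.B _ _ z hz, h.th z hz, h.th' z hz]
  · refine Eq.trans ?_ (h0 (.inr (.inr (.inr (.inr j)))))
    simp only [Reduced.zeroQty, Q, nabB, χ, hB, h.n _ _ z hz, h.K _ _ z hz, h.E _ _ z hz,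
      h.B _ _ z hz, h.th z hz, h.th' z hz]

end IsImage
end Reduced

/-! ### Changes of charts -/

section Manifold

variable {M : Type*} [TopologicalSpace M] [ChartedSpace Space M]

/-- The change of the coordinates of `ℝ × M` induced by a change of charts of `M`. -/
def chartChange (φ ψ : OpenPartialHomeomorph M Space) (z : Coord) : Coord := (z.1, ψ (φ.symm z.2))

theorem frameVec_inChart (u : Fields M) (φ : OpenPartialHomeomorph M Space) (a : Fin 4)
    (z : Coord) : (u.inChart φ).frameVec a z
      = ((u.e a (chartPoint φ z)).1,
        (mfderiv (𝓡 3) (𝓡 3) φ (φ.symm z.2) (u.e a (chartPoint φ z)).2 : Space)) := by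
  apply coordEquiv.symm.injective
  ext μ
  rw [coordEquiv_symm_frameVec]
  refine Fin.cases ?_ (fun i => ?_) μ <;> rfl

variable {φ ψ : OpenPartialHomeomorph M Space}
  (hφ : φ ∈ IsManifold.maximalAtlas (𝓡 3) ∞ M) (hψ : ψ ∈ IsManifold.maximalAtlas (𝓡 3) ∞ M)
include hφ

theorem mdifferentiableAt_chart {q : M} (hq : q ∈ φ.source) :
    MDifferentiableAt (𝓡 3) (𝓡 3) φ q :=
  ((contMDiffOn_of_mem_maximalAtlas hφ).contMDiffAt (φ.open_source.mem_nhds hq)).mdifferentiableAt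
    (by simp)

include hψ

theorem contDiffOn_transition :
    ContDiffOn ℝ ∞ (fun x => ψ (φ.symm x)) (φ.target ∩ φ.symm ⁻¹' ψ.source) := by
  rw [← contMDiffOn_iff_contDiffOn]
  exact (contMDiffOn_of_mem_maximalAtlas hψ).comp
    ((contMDiffOn_symm_of_mem_maximalAtlas hφ).mono Set.inter_subset_left) fun x hx => hx.2

theorem mfderiv_transition {x : Space} (hx : x ∈ φ.target ∩ φ.symm ⁻¹' ψ.source)
    (v : TangentSpace (𝓡 3) (φ.symm x)) :
    (mfderiv (𝓡 3) (𝓡 3) ψ (φ.symm x) v : Space)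
      = fderiv ℝ (fun x => ψ (φ.symm x)) x (mfderiv (𝓡 3) (𝓡 3) φ (φ.symm x) v : Space) := by
  have hO : IsOpen (φ.target ∩ φ.symm ⁻¹' ψ.source) :=
    φ.symm.isOpen_inter_preimage ψ.open_source
  have hq := φ.map_target hx.1
  have hd : DifferentiableAt ℝ (fun x => ψ (φ.symm x)) (φ (φ.symm x)) := by
    rw [φ.right_inv hx.1]
    exact ((contDiffOn_transition hφ hψ).differentiableOn (by simp) x hx).differentiableAt
      (hO.mem_nhds hx)
  have e1 : ψ =ᶠ[nhds (φ.symm x)] (fun x => ψ (φ.symm x)) ∘ φ := by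
    filter_upwards [φ.open_source.mem_nhds hq] with q hq
    simp [φ.left_inv hq]
  have e2 := mfderiv_comp (I := 𝓡 3) (I' := 𝓡 3) (I'' := 𝓡 3) (φ.symm x)
    hd.mdifferentiableAt (mdifferentiableAt_chart hφ hq)
  rw [← e1.mfderiv_eq, mfderiv_eq_fderiv, φ.right_inv hx.1] at e2
  rw [e2]
  rfl

end Manifold

/-! ### Global propagation over the compact spatial manifold. -/

section Manifold

variable {M : Type*} [TopologicalSpace M] [ChartedSpace Space M]

/-- The bound $m\ge4$ enters here: fields of class $C^{m-2}$ are at least $C^2$, so that the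
zero-quantities are $C^1$ and their evolution equations make sense. -/
theorem localSolution_inChart {u : Fields M} {m : ℕ} (hm : 4 ≤ m) {τ₀ τs τe : ℝ} (hτ : τs < τe)
    (hΘ : Theta τ₀ τs ≠ 0) (hu : u.IsEvolutionSolution (m - 2) τ₀ τs τe)
    (hdata : u.HasConstrainedData τ₀ τs τe) {φ : OpenPartialHomeomorph M Space}
    (hφ : φ ∈ IsManifold.maximalAtlas (𝓡 3) ∞ M) :
    LocalSolution (u.inChart φ) τ₀ τs τe φ.target := by
  have hk : ((2 : ℕ) : WithTop ℕ∞) ≤ ((m - 2 : ℕ) : WithTop ℕ∞) := by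
    exact_mod_cast (by omega : 2 ≤ m - 2)
  have hr := (hu φ hφ).1
  have hd : ∀ x ∈ φ.target, ((τs, x) : Coord) ∈ chartDomain τs τe φ := fun x hx =>
    ⟨⟨le_rfl, hτ⟩, hx⟩
  exact
    { isOpen := φ.open_target
      start := hτ
      theta_start := hΘ
      regular := ⟨fun a μ => (hr.e a μ).of_le hk, fun a b c => (hr.Γ a b c).of_le hk,
        fun a b => (hr.L a b).of_le hk, fun a b c e => (hr.d a b c e).of_le hk⟩
      algebraic := fun z hz => ((hu φ hφ).2 z hz).1
      gauge := fun z hz => ((hu φ hφ).2 z hz).2.1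
      evolution := fun z hz => ((hu φ hφ).2 z hz).2.2
      adapted := fun x hx => (hdata φ hφ _ (hd x hx) rfl).1
      constraints := fun x hx => (hdata φ hφ _ (hd x hx) rfl).2 }

variable {u : Fields M} {τ₀ τs τe : ℝ}
  (H : ∀ φ ∈ IsManifold.maximalAtlas (𝓡 3) ∞ M,
    LocalSolution (u.inChart φ) τ₀ τs τe φ.target)
  {φ ψ : OpenPartialHomeomorph M Space}

/-- The energy of the zero quantities in a chart. -/
noncomputable def chartEnergy (u : Fields M) (τ₀ τs τe : ℝ) (φ : OpenPartialHomeomorph M Space)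
    (z : Coord) : ℝ := ((u.inChart φ).reduced τ₀).energy (slab τs τe φ.target) z

/-- The part of the chart `φ` where the chart `ψ` is defined. -/
def overlap (φ ψ : OpenPartialHomeomorph M Space) : Set Coord :=
  Set.univ ×ˢ (φ.target ∩ φ.symm ⁻¹' ψ.source)

omit [ChartedSpace Space M] in
theorem isOpen_overlap (φ ψ : OpenPartialHomeomorph M Space) : IsOpen (overlap φ ψ) :=
  isOpen_univ.prod (φ.symm.isOpen_inter_preimage ψ.open_source)

omit [ChartedSpace Space M] in
theorem slab_inter_overlap (φ ψ : OpenPartialHomeomorph M Space) :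
    slab τs τe φ.target ∩ overlap φ ψ
      = slab τs τe (φ.target ∩ φ.symm ⁻¹' ψ.source) := by
  ext z
  simp only [slab, overlap, Set.mem_inter_iff, Set.mem_prod, Set.mem_univ, true_and]
  tauto

theorem contDiffOn_chartChange (hφ : φ ∈ IsManifold.maximalAtlas (𝓡 3) ∞ M)
    (hψ : ψ ∈ IsManifold.maximalAtlas (𝓡 3) ∞ M) :
    ContDiffOn ℝ 2 (chartChange φ ψ) (slab τs τe (φ.target ∩ φ.symm ⁻¹' ψ.source)) :=
  contDiffOn_fst.prodMk <|
    ((contDiffOn_transition hφ hψ).of_le (by norm_cast)).comp contDiffOn_snd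
      fun z hz => hz.2

theorem isImage_chartChange (hφ : φ ∈ IsManifold.maximalAtlas (𝓡 3) ∞ M)
    (hψ : ψ ∈ IsManifold.maximalAtlas (𝓡 3) ∞ M) :
    Reduced.IsImage ((u.inChart φ).reduced τ₀) ((u.inChart ψ).reduced τ₀)
      (slab τs τe (φ.target ∩ φ.symm ⁻¹' ψ.source)) (slab τs τe ψ.target) (chartChange φ ψ) := by
  have hcp : ∀ z ∈ slab τs τe (φ.target ∩ φ.symm ⁻¹' ψ.source),
      chartPoint ψ (chartChange φ ψ z) = chartPoint φ z := fun z hz => by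
    simp only [chartPoint, chartChange]
    rw [ψ.left_inv hz.2.2]
  have hO : IsOpen (φ.target ∩ φ.symm ⁻¹' ψ.source) :=
    φ.symm.isOpen_inter_preimage ψ.open_source
  have hΓ : ∀ a b c, ∀ z ∈ slab τs τe (φ.target ∩ φ.symm ⁻¹' ψ.source),
      (u.inChart ψ).Γ a b c (chartChange φ ψ z) = (u.inChart φ).Γ a b c z := fun a b c z hz =>
    congrArg (u.Γ a b c) (hcp z hz)
  have hL : ∀ a b, ∀ z ∈ slab τs τe (φ.target ∩ φ.symm ⁻¹' ψ.source),
      (u.inChart ψ).L a b (chartChange φ ψ z) = (u.inChart φ).L a b z := fun a b z hz =>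
    congrArg (u.L a b) (hcp z hz)
  have hd : ∀ a b c e, ∀ z ∈ slab τs τe (φ.target ∩ φ.symm ⁻¹' ψ.source),
      (u.inChart ψ).d a b c e (chartChange φ ψ z) = (u.inChart φ).d a b c e z :=
    fun a b c e z hz => congrArg (u.d a b c e) (hcp z hz)
  refine ⟨fun z hz => ⟨hz.1, ψ.map_source hz.2.2⟩, contDiffOn_chartChange hφ hψ, ?_,
    fun i j z hz => hΓ _ _ _ z hz, ?_, fun i j z hz => hd _ _ _ _ z hz,
    fun i j z hz => hd _ _ _ _ z hz, fun z _ => rfl, fun z _ => rfl⟩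
  · intro i z hz
    have hdiff : DifferentiableAt ℝ (fun x => ψ (φ.symm x)) z.2 :=
      ((contDiffOn_transition hφ hψ).differentiableOn (by simp) z.2 hz.2).differentiableAt
        (hO.mem_nhds hz.2)
    have h1 : HasFDerivAt (chartChange φ ψ)
        ((ContinuousLinearMap.fst ℝ ℝ Space).prod
          ((fderiv ℝ (fun x => ψ (φ.symm x)) z.2).comp (ContinuousLinearMap.snd ℝ ℝ Space))) z :=
      hasFDerivAt_fst.prodMk (hdiff.hasFDerivAt.comp z hasFDerivAt_snd)
    change (u.inChart ψ).frameVec i.succ (chartChange φ ψ z)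
      = fderivWithin ℝ _ _ z ((u.inChart φ).frameVec i.succ z)
    rw [h1.hasFDerivWithinAt.fderivWithin ((isRegularDomain_slab τs τe hO).uniqueDiffOn z hz),
      frameVec_inChart, frameVec_inChart]
    have h2 := mfderiv_transition hφ hψ hz.2 (u.e i.succ (chartPoint φ z)).2
    refine Prod.ext ?_ ?_
    · change (u.e i.succ (chartPoint ψ (chartChange φ ψ z))).1 = (u.e i.succ (chartPoint φ z)).1
      rw [hcp z hz]
    · refine Eq.trans ?_ h2
      -- The tangent space depends on the base point, so the equality of the two points is first
      -- generalised and then eliminated.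
      have h3 : ∀ q q' : ℝ × M, q = q' →
          (mfderiv (𝓡 3) (𝓡 3) ψ q.2 (u.e i.succ q).2 : Space)
            = mfderiv (𝓡 3) (𝓡 3) ψ q'.2 (u.e i.succ q').2 := by
        rintro q _ rfl
        rfl
      exact h3 _ _ (hcp z hz)
  · intro i j z hz
    simp only [LocalFields.reduced, LocalFields.ell, LocalFields.chi]
    rw [hΓ _ _ _ z hz, hL _ _ z hz]
    rfl

include H

/-- The vanishing of the zero quantities does not depend on the chart. -/
theorem chartEnergy_eq_zero (hφ : φ ∈ IsManifold.maximalAtlas (𝓡 3) ∞ M)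
    (hψ : ψ ∈ IsManifold.maximalAtlas (𝓡 3) ∞ M) {t : ℝ} (ht : t ∈ Set.Ico τs τe) {q : M}
    (hqφ : q ∈ φ.source) (hqψ : q ∈ ψ.source)
    (h0 : chartEnergy u τ₀ τs τe φ (t, φ q) = 0) : chartEnergy u τ₀ τs τe ψ (t, ψ q) = 0 := by
  have hz : ((t, φ q) : Coord) ∈ slab τs τe (φ.target ∩ φ.symm ⁻¹' ψ.source) :=
    ⟨ht, φ.map_source hqφ, by simpa [φ.left_inv hqφ] using hqψ⟩
  have hzO : ((t, φ q) : Coord) ∈ overlap φ ψ := ⟨trivial, hz.2⟩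
  have hO : IsOpen (φ.target ∩ φ.symm ⁻¹' ψ.source) :=
    φ.symm.isOpen_inter_preimage ψ.open_source
  have key := (isImage_chartChange (u := u) (τ₀ := τ₀) hφ hψ).zeroQty (isRegularDomain_slab τs τe hO)
    (H ψ hψ).solves (fun i => ((H φ hφ).frameVec_smooth i.succ).mono
      (Set.prod_mono le_rfl Set.inter_subset_left)) hz (fun i => by
        rw [← slab_inter_overlap, Reduced.zeroQty_inter _ (isOpen_overlap φ ψ) hzO]
        exact Reduced.energy_eq_zero_iff _ |>.1 h0 i)
  refine (Reduced.energy_eq_zero_iff _).2 fun i => ?_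
  have := key i
  rwa [chartChange, φ.left_inv hqφ] at this

/-- Continuity argument: the set of times at which the constraints hold on the whole of `M` is
closed, contains $\tau_\star$, and is open to the right by local propagation and compactness. -/
theorem chartEnergy_propagation [IsManifold (𝓡 3) ∞ M] [CompactSpace M] :
    ∀ t ∈ Set.Ico τs τe, ∀ q : M,
      chartEnergy u τ₀ τs τe (chartAt Space q) (t, chartAt Space q q) = 0 := by
  have hat : ∀ q : M, chartAt Space q ∈ IsManifold.maximalAtlas (𝓡 3) ∞ M := fun q =>
    IsManifold.chart_mem_maximalAtlas q
  intro T hT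
  let Z : Set ℝ := {t | ∀ q : M,
    chartEnergy u τ₀ τs τe (chartAt Space q) (t, chartAt Space q q) = 0}
  have hsub : Set.Icc τs T ⊆ Set.Ico τs τe := fun t ht => ⟨ht.1, ht.2.trans_lt hT.2⟩
  have hmem : ∀ q : M, chartAt Space q q ∈ (chartAt Space q).target := fun q =>
    mem_chart_target Space q
  suffices Set.Icc τs T ⊆ Z from this ⟨hT.1, le_rfl⟩
  refine IsClosed.Icc_subset_of_forall_mem_nhdsWithin ?_ ?_ ?_
  · have e : Z ∩ Set.Icc τs T = Set.Icc τs T ∩ ⋂ q : M, {t ∈ Set.Icc τs T |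
        chartEnergy u τ₀ τs τe (chartAt Space q) (t, chartAt Space q q) = 0} := by
      ext t
      refine ⟨fun h => ⟨h.2, Set.mem_iInter.2 fun q => ⟨h.2, h.1 q⟩⟩,
        fun h => ⟨fun q => (Set.mem_iInter.1 h.2 q).2, h.1⟩⟩
    rw [e]
    refine isClosed_Icc.inter (isClosed_iInter fun q => ?_)
    have hc : ContinuousOn (fun t =>
        chartEnergy u τ₀ τs τe (chartAt Space q) (t, chartAt Space q q)) (Set.Icc τs T) :=
      (H _ (hat q)).solves.contDiffOn_energy.continuousOn.comp (by fun_prop)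
        fun t ht => ⟨hsub ht, hmem q⟩
    exact hc.preimage_isClosed_of_isClosed isClosed_Icc isClosed_singleton
  · intro q
    exact (H _ (hat q)).energy_start (hmem q)
  · rintro t₁ ⟨hZ, ht₁⟩
    have ht₁' := hsub (Set.Ico_subset_Icc_self ht₁)
    -- Local propagation requires vanishing on the full time slice of one chart. At each point of it
    -- this is known in the preferred chart of that point, and is transferred.
    have loc : ∀ q : M, ∃ ε > 0, ∀ z : Coord, t₁ ≤ z.1 → z.1 ≤ t₁ + ε →
        dist z.2 (chartAt Space q q) ≤ ε →
          chartEnergy u τ₀ τs τe (chartAt Space q) z = 0 := fun q => by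
      refine (H _ (hat q)).solves.local_propagation rfl (H _ (hat q)).isOpen
        (fun i z hz => (H _ (hat q)).frameVec_fst hz i) ⟨ht₁', hmem q⟩ fun x hx => ?_
      have hq' := (chartAt Space q).map_target hx
      have := chartEnergy_eq_zero H (hat _) (hat q) ht₁' (mem_chart_source Space _) hq'
        (hZ ((chartAt Space q).symm x))
      rwa [(chartAt Space q).right_inv hx] at this
    choose ε hε hloc using loc
    -- Finitely many balls cover `M`, so a single time step works for all points.
    obtain ⟨s, hs⟩ := CompactSpace.elim_nhds_subcover
      (fun q => (chartAt Space q).source ∩ chartAt Space q ⁻¹' Metric.ball (chartAt Space q q) (ε q))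
      fun q => ((chartAt Space q).isOpen_inter_preimage Metric.isOpen_ball).mem_nhds
        ⟨mem_chart_source Space q, Metric.mem_ball_self (hε q)⟩
    have h1 : ∀ᶠ t in nhdsWithin t₁ (Set.Ioi t₁), ∀ q ∈ s, t < t₁ + ε q :=
      (Filter.eventually_all_finset s).2 fun q _ =>
        nhdsWithin_le_nhds (Iio_mem_nhds (by linarith [hε q]))
    have h2 : ∀ᶠ t in nhdsWithin t₁ (Set.Ioi t₁), t < τe :=
      nhdsWithin_le_nhds (Iio_mem_nhds ht₁'.2)
    filter_upwards [h1, h2, self_mem_nhdsWithin] with t h1 h2 h3 q'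
    have hq' : q' ∈ ⋃ q ∈ s, (chartAt Space q).source ∩
        chartAt Space q ⁻¹' Metric.ball (chartAt Space q q) (ε q) := by
      rw [hs]
      trivial
    simp only [Set.mem_iUnion, exists_prop] at hq'
    obtain ⟨q, hqs, hq, hqb⟩ := hq'
    have h3' : t₁ < t := h3
    exact chartEnergy_eq_zero H (hat q) (hat q') ⟨ht₁'.1.trans h3'.le, h2⟩ hq
      (mem_chart_source Space q') (hloc q (t, chartAt Space q q') h3'.le (h1 q hqs).le
        (Metric.mem_ball.1 hqb).le)

/-- The constraints are propagated. -/
theorem zeroQty_inChart [IsManifold (𝓡 3) ∞ M] [CompactSpace M]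
    (hφ : φ ∈ IsManifold.maximalAtlas (𝓡 3) ∞ M) {z : Coord} (hz : z ∈ slab τs τe φ.target)
    (i : Reduced.ZeroIndex) :
    ((u.inChart φ).reduced τ₀).zeroQty (slab τs τe φ.target) i z = 0 := by
  have hq := φ.map_target hz.2
  have := chartEnergy_eq_zero H (IsManifold.chart_mem_maximalAtlas _) hφ hz.1
    (mem_chart_source Space _) hq (chartEnergy_propagation H z.1 hz.1 (φ.symm z.2))
  rw [φ.right_inv hz.2] at this
  exact Reduced.energy_eq_zero_iff _ |>.1 this i

end Manifold

/-! ### Calculus of matrix-valued functions -/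

section Matrix

open Matrix

variable {D : Set Coord} {v : Coord} {z : Coord} {n : ℕ} {k : WithTop ℕ∞}

theorem contDiffOn_det {m : ℕ} {A : Coord → Matrix (Fin m) (Fin m) ℝ}
    (hA : ∀ i j, ContDiffOn ℝ k (fun y => A y i j) D) : ContDiffOn ℝ k (fun y => (A y).det) D := by
  simp only [Matrix.det_apply]
  exact ContDiffOn.sum fun σ _ => (contDiffOn_prod fun i _ => hA _ _).const_smul _

/-- By Cramer's rule each entry of the inverse is a quotient of determinants. -/
theorem contDiffOn_inv_matrix {m : ℕ} {A : Coord → Matrix (Fin m) (Fin m) ℝ}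
    (hA : ∀ i j, ContDiffOn ℝ k (fun y => A y i j) D) (h0 : ∀ z ∈ D, (A z).det ≠ 0)
    (i j : Fin m) : ContDiffOn ℝ k (fun y => (A y)⁻¹ i j) D := by
  have e : ∀ y ∈ D, (A y)⁻¹ i j
      = ((A y).det)⁻¹ * ((A y).updateRow j (Pi.single i 1)).det := fun y _ => by
    rw [Matrix.inv_def, Matrix.smul_apply, Ring.inverse_eq_inv', Matrix.adjugate_apply,
      smul_eq_mul]
  refine ContDiffOn.congr (ContDiffOn.mul ((contDiffOn_det hA).inv h0) (contDiffOn_det ?_)) e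
  intro a b
  by_cases h : a = j
  · subst h
    simp only [Matrix.updateRow_self]
    exact contDiffOn_const
  · simp only [Matrix.updateRow_ne h]
    exact hA a b

/-- The derivative of a matrix-valued function. -/
noncomputable def mder (D : Set Coord) (v : Coord) (H : Coord → Matrix (Fin 4) (Fin 4) ℝ)
    (z : Coord) : Matrix (Fin 4) (Fin 4) ℝ := Matrix.of fun i j => der D v (fun y => H y i j) z

/-- Differentiability of the entries of a matrix-valued function. -/
def EntryDiff (D : Set Coord) (H : Coord → Matrix (Fin 4) (Fin 4) ℝ) (z : Coord) : Prop :=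
  ∀ i j, DifferentiableWithinAt ℝ (fun y => H y i j) D z

variable {H K : Coord → Matrix (Fin 4) (Fin 4) ℝ}

theorem EntryDiff.mul (hH : EntryDiff D H z) (hK : EntryDiff D K z) : EntryDiff D (fun y => H y * K y) z :=
  fun i j => by
    simp only [Matrix.mul_apply]
    exact DifferentiableWithinAt.fun_sum fun l _ => (hH i l).fun_mul (hK l j)

theorem EntryDiff.add (hH : EntryDiff D H z) (hK : EntryDiff D K z) : EntryDiff D (fun y => H y + K y) z :=
  fun i j => (hH i j).fun_add (hK i j)

theorem mder_add (hu : UniqueDiffWithinAt ℝ D z) (hH : EntryDiff D H z) (hK : EntryDiff D K z) :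
    mder D v (fun y => H y + K y) z = mder D v H z + mder D v K z := by
  ext i j
  exact der_add hu (hH i j) (hK i j)

theorem mder_mul (hu : UniqueDiffWithinAt ℝ D z) (hH : EntryDiff D H z) (hK : EntryDiff D K z) :
    mder D v (fun y => H y * K y) z = mder D v H z * K z + H z * mder D v K z := by
  ext i j
  simp only [mder, Matrix.mul_apply, Matrix.of_apply, Matrix.add_apply]
  rw [der_sum _ hu fun l _ => (hH i l).fun_mul (hK l j), ← Finset.sum_add_distrib]
  exact Finset.sum_congr rfl fun l _ => der_mul hu (hH i l) (hK l j)

theorem mder_congr (h : ∀ y ∈ D, H y = K y) (hz : z ∈ D) : mder D v H z = mder D v K z := by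
  ext i j
  exact der_congr (fun y hy => by rw [h y hy]) hz

theorem mder_const (A : Matrix (Fin 4) (Fin 4) ℝ) : mder D v (fun _ => A) z = 0 := by
  ext i j
  exact der_const _

theorem mder_transpose : mder D v (fun y => (H y)ᵀ) z = (mder D v H z)ᵀ := rfl

theorem mder_mder_comm (hD : IsRegularDomain D) (hz : z ∈ D)
    (hH : ∀ i j, ContDiffOn ℝ 2 (fun y => H y i j) D) (v w : Coord) :
    mder D v (mder D w H) z = mder D w (mder D v H) z := by
  ext i j
  have := der_comm (X := fun _ => v) (Y := fun _ => w) hD hz (hH i j)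
    (differentiableWithinAt_const _) (differentiableWithinAt_const _)
  simp only [der_const, sub_zero, der_dir_zero] at this
  exact sub_eq_zero.1 this

end Matrix

/-! ### The Ricci tensor in terms of a frame -/

/-- `v.e` is a frame whose Levi-Civita connection has the coefficients `v.Γ`. -/
structure IsMetricFrame (v : LocalFields) (D : Set Coord) : Prop where
  dom : IsRegularDomain D
  smooth_e : ∀ a μ, ContDiffOn ℝ 2 (v.e a μ) D
  smooth_Γ : ∀ a b c, ContDiffOn ℝ 1 (v.Γ a b c) D
  nondegenerate : ∀ z ∈ D, (v.frameMatrix z).det ≠ 0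
  metric : ∀ z ∈ D, ∀ a b c, eta b b * v.Γ a b c z + eta c c * v.Γ a c b z = 0
  torsion : ∀ z ∈ D, ∀ a b ν, v.torsionZero D a b ν z = 0

namespace LocalFields

variable (v : LocalFields) (D : Set Coord)

/-- The matrix of the dual coframe. -/
noncomputable def om (z : Coord) : Matrix (Fin 4) (Fin 4) ℝ := (v.frameMatrix z)⁻¹

/-- The connection coefficients with respect to a coordinate vector. -/
noncomputable def conn (μ : Fin 4) (z : Coord) : Matrix (Fin 4) (Fin 4) ℝ :=
  Matrix.of fun c a => ∑ b, v.om z μ b * v.Γ b a c z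

/-- The coordinate components of the connection. -/
noncomputable def chr (μ : Fin 4) (z : Coord) : Matrix (Fin 4) (Fin 4) ℝ :=
  (mder D (coordVec μ) v.om z + v.om z * v.conn μ z) * v.frameMatrix z

end LocalFields

namespace IsMetricFrame

open Matrix

variable {v : LocalFields} {D : Set Coord} (h : IsMetricFrame v D)
include h

theorem om_mul {z : Coord} (hz : z ∈ D) : v.om z * v.frameMatrix z = 1 :=
  Matrix.nonsing_inv_mul _ (isUnit_iff_ne_zero.2 (h.nondegenerate z hz))

theorem mul_om {z : Coord} (hz : z ∈ D) : v.frameMatrix z * v.om z = 1 :=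
  Matrix.mul_nonsing_inv _ (isUnit_iff_ne_zero.2 (h.nondegenerate z hz))

theorem smooth_om (i j : Fin 4) : ContDiffOn ℝ 2 (fun z => v.om z i j) D :=
  contDiffOn_inv_matrix (A := v.frameMatrix) (fun a μ => h.smooth_e a μ) h.nondegenerate i j

theorem diff_om {z : Coord} (hz : z ∈ D) : EntryDiff D v.om z := fun i j =>
  (h.smooth_om i j).differentiableOn (by norm_num) z hz

theorem diff_frame {z : Coord} (hz : z ∈ D) : EntryDiff D v.frameMatrix z := fun i j =>
  (h.smooth_e i j).differentiableOn (by norm_num) z hz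

theorem diff_Γ {z : Coord} (hz : z ∈ D) (a b c : Fin 4) :
    DifferentiableWithinAt ℝ (v.Γ a b c) D z :=
  (h.smooth_Γ a b c).differentiableOn (by norm_num) z hz

theorem diff_conn {z : Coord} (hz : z ∈ D) (μ : Fin 4) : EntryDiff D (v.conn μ) z := fun c a => by
  change DifferentiableWithinAt ℝ (fun y => ∑ b, v.om y μ b * v.Γ b a c y) D z
  exact DifferentiableWithinAt.fun_sum fun b _ => (h.diff_om hz μ b).fun_mul (h.diff_Γ hz b a c)

theorem diff_mder_om {z : Coord} (hz : z ∈ D) (w : Coord) : EntryDiff D (mder D w v.om) z :=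
  fun i j => (contDiffOn_der (k := 1) (l := 2) (X := fun _ => w) h.dom.uniqueDiffOn
    (h.smooth_om i j) contDiffOn_const (by norm_num)).differentiableOn (by norm_num) z hz

/-- Obtained by differentiating the product of the frame and coframe matrices, which is the
identity. -/
theorem mder_frame {z : Coord} (hz : z ∈ D) (w : Coord) :
    mder D w v.frameMatrix z = -(v.frameMatrix z * mder D w v.om z * v.frameMatrix z) := by
  have hu := h.dom.uniqueDiffOn z hz
  have e := mder_mul (v := w) hu (h.diff_frame hz) (h.diff_om hz)
  rw [mder_congr (fun y hy => h.mul_om hy) hz, mder_const] at e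
  have e2 := congrArg (· * v.frameMatrix z) e
  simp only [zero_mul, add_mul, mul_assoc, h.om_mul hz, mul_one] at e2
  rw [mul_assoc]
  exact eq_neg_of_add_eq_zero_left e2.symm

/-- The symmetry of the connection. -/
theorem symm {z : Coord} (hz : z ∈ D) (μ s d : Fin 4) :
    mder D (coordVec μ) v.om z s d + (v.om z * v.conn μ z) s d
      = mder D (coordVec s) v.om z μ d + (v.om z * v.conn s z) μ d := by
  let F := v.frameMatrix z
  let N : Matrix (Fin 4) (Fin 4) ℝ := Matrix.of fun μ s =>
    mder D (coordVec μ) v.om z s d + (v.om z * v.conn μ z) s d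
  have hFo : F * v.om z = 1 := h.mul_om hz
  have hoF : v.om z * F = 1 := h.om_mul hz
  suffices hN : Nᵀ = N from (congrFun (congrFun hN s) μ)
  -- Symmetry of `N` may be tested after conjugation with the frame. There its antisymmetric part is
  -- the torsion.
  have hn : F * N * Fᵀ = Matrix.of fun a b =>
      ∑ μ, F a μ * (F * mder D (coordVec μ) v.om z) b d + v.Γ a d b z := by
    ext a b
    have e1 : (F * N * Fᵀ) a b = ∑ μ, F a μ * (F * (mder D (coordVec μ) v.om z
        + v.om z * v.conn μ z)) b d := by
      simp only [Matrix.mul_apply, Matrix.transpose_apply, Matrix.add_apply, N, Matrix.of_apply,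
        Finset.sum_mul, Finset.mul_sum]
      rw [Finset.sum_comm]
      refine Finset.sum_congr rfl fun μ _ => Finset.sum_congr rfl fun s _ => ?_
      ring
    have e2 : ∑ μ, F a μ * v.conn μ z b d = v.Γ a d b z := by
      have e3 : ∀ c, ∑ μ, F a μ * v.om z μ c = if a = c then 1 else 0 := fun c => by
        rw [← Matrix.mul_apply, hFo, Matrix.one_apply]
      simp only [LocalFields.conn, Matrix.of_apply, Finset.mul_sum]
      rw [Finset.sum_comm]
      simp only [← mul_assoc, ← Finset.sum_mul, e3]
      simp
    rw [e1]
    simp only [mul_add, ← mul_assoc, hFo, one_mul, Matrix.add_apply, Finset.sum_add_distrib, e2,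
      Matrix.of_apply]
  have hns : (F * N * Fᵀ)ᵀ = F * N * Fᵀ := by
    rw [hn]
    ext a b
    simp only [Matrix.transpose_apply, Matrix.of_apply]
    have ht : ∀ ν, v.dirD D a (v.e b ν) z - v.dirD D b (v.e a ν) z
        = ∑ c, (v.Γ a c b z - v.Γ b c a z) * F c ν := fun ν => sub_eq_zero.1 (h.torsion z hz a b ν)
    have hd : ∀ a b, ∑ ν, v.dirD D a (v.e b ν) z * v.om z ν d
        = -∑ μ, F a μ * (F * mder D (coordVec μ) v.om z) b d := fun a b => by
      have e4 : ∀ ν, v.dirD D a (v.e b ν) z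
          = -∑ μ, F a μ * (F * mder D (coordVec μ) v.om z * F) b ν := fun ν => by
        rw [LocalFields.dirD, ← Finset.sum_neg_distrib]
        refine Finset.sum_congr rfl fun μ _ => ?_
        have := congrFun (congrFun (h.mder_frame hz (coordVec μ)) b) ν
        rw [← mul_neg]
        exact congrArg (F a μ * ·) this
      simp only [e4, neg_mul, Finset.sum_neg_distrib, Finset.sum_mul]
      rw [Finset.sum_comm]
      congr 1
      refine Finset.sum_congr rfl fun μ _ => ?_
      simp only [mul_assoc, ← Finset.mul_sum]
      rw [← Matrix.mul_apply, mul_assoc, mul_assoc, hFo, mul_one]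
    have hs : ∑ ν, (v.dirD D a (v.e b ν) z - v.dirD D b (v.e a ν) z) * v.om z ν d
        = v.Γ a d b z - v.Γ b d a z := by
      simp only [ht, Finset.sum_mul]
      rw [Finset.sum_comm]
      simp only [mul_assoc, ← Finset.mul_sum, ← Matrix.mul_apply, hFo, Matrix.one_apply]
      simp
    simp only [sub_mul, Finset.sum_sub_distrib, hd] at hs
    linarith
  have e5 : N = v.om z * (F * N * Fᵀ) * (v.om z)ᵀ := by
    have : Fᵀ * (v.om z)ᵀ = 1 := by rw [← Matrix.transpose_mul, hoF, Matrix.transpose_one]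
    calc N = (v.om z * F) * N * (Fᵀ * (v.om z)ᵀ) := by rw [hoF, this, one_mul, mul_one]
      _ = _ := by noncomm_ring
  refine (congrArg Matrix.transpose e5).trans (Eq.trans ?_ e5.symm)
  rw [Matrix.transpose_mul, Matrix.transpose_mul, hns, Matrix.transpose_transpose]
  exact (mul_assoc _ _ _).symm

theorem chr_symm {z : Coord} (hz : z ∈ D) (μ s l : Fin 4) :
    v.chr D μ z s l = v.chr D s z μ l := by
  simp only [LocalFields.chr, Matrix.mul_apply (N := v.frameMatrix z)]
  exact Finset.sum_congr rfl fun d _ => congrArg (· * _) (h.symm hz μ s d)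

omit h in
theorem eta_transpose : (Matrix.of eta)ᵀ = Matrix.of eta := by
  ext a b
  simp only [Matrix.transpose_apply, Matrix.of_apply, eta]
  by_cases hab : a = b
  · subst hab; rfl
  · simp [hab, Ne.symm hab]

omit h in
theorem metric_eq (z : Coord) : v.metric z = v.om z * Matrix.of eta * (v.om z)ᵀ := by
  ext μ ν
  simp only [LocalFields.metric, Matrix.mul_apply, Matrix.of_apply, Matrix.transpose_apply,
    Finset.sum_mul, LocalFields.om]
  rw [Finset.sum_comm]
  refine Finset.sum_congr rfl fun a _ => Finset.sum_congr rfl fun b _ => ?_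
  ring

theorem conn_eta {z : Coord} (hz : z ∈ D) (μ : Fin 4) :
    v.conn μ z * Matrix.of eta + (v.conn μ z * Matrix.of eta)ᵀ = 0 := by
  have e : ∀ c a, (v.conn μ z * Matrix.of eta) c a = v.conn μ z c a * eta a a := fun c a => by
    rw [Matrix.mul_apply]
    refine Finset.sum_eq_single a (fun b _ hb => ?_) (by simp)
    simp [eta, hb]
  ext c a
  rw [Matrix.add_apply, Matrix.transpose_apply, e, e, Matrix.zero_apply]
  simp only [LocalFields.conn, Matrix.of_apply, Finset.sum_mul, ← Finset.sum_add_distrib]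
  refine Finset.sum_eq_zero fun b _ => ?_
  linear_combination v.om z μ b * h.metric z hz b a c

/-- Compatibility with the metric in coordinates. By the product rule for $\omega\eta\omega^T$ the
derivatives of $\omega$ appear on both sides, and the connection terms cancel by the antisymmetry in
`conn_eta`. -/
theorem mder_metric {z : Coord} (hz : z ∈ D) (μ : Fin 4) :
    mder D (coordVec μ) v.metric z
      = v.chr D μ z * v.metric z + (v.chr D μ z * v.metric z)ᵀ := by
  have hu := h.dom.uniqueDiffOn z hz
  have hE : EntryDiff D (fun _ => Matrix.of eta) z := fun i j => differentiableWithinAt_const _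
  have hT : EntryDiff D (fun y => (v.om y)ᵀ) z := fun i j => h.diff_om hz j i
  have e1 : v.chr D μ z * v.metric z
      = mder D (coordVec μ) v.om z * Matrix.of eta * (v.om z)ᵀ
        + v.om z * (v.conn μ z * Matrix.of eta) * (v.om z)ᵀ := by
    rw [metric_eq, LocalFields.chr]
    have := h.mul_om hz
    calc _ = (mder D (coordVec μ) v.om z + v.om z * v.conn μ z) * (v.frameMatrix z * v.om z)
        * Matrix.of eta * (v.om z)ᵀ := by noncomm_ring
      _ = _ := by rw [this]; noncomm_ring
  rw [mder_congr (fun y _ => metric_eq y) hz, mder_mul hu ((h.diff_om hz).mul hE) hT,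
    mder_mul hu (h.diff_om hz) hE, mder_const, mder_transpose, e1]
  have e2 := eq_neg_of_add_eq_zero_right (h.conn_eta hz μ)
  simp only [Matrix.transpose_add, Matrix.transpose_mul, Matrix.transpose_transpose, eta_transpose] at e2 ⊢
  rw [e2]
  noncomm_ring

omit h in
theorem metric_symm (z : Coord) : (v.metric z)ᵀ = v.metric z := by
  rw [metric_eq, Matrix.transpose_mul, Matrix.transpose_mul, Matrix.transpose_transpose, eta_transpose,
    mul_assoc]

end IsMetricFrame
namespace IsMetricFrame

open Matrix

variable {v : LocalFields} {D : Set Coord} (h : IsMetricFrame v D)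
include h

/-- Uniqueness of the Levi-Civita connection: `chr` is symmetric and metric, so the Koszul
combination of derivatives of the metric collapses to twice one term. -/
theorem christoffel_eq {z : Coord} (hz : z ∈ D) (l μ ν : Fin 4) :
    christoffel D v.metric l μ ν z = v.chr D μ z ν l := by
  let B : Fin 4 → Matrix (Fin 4) (Fin 4) ℝ := fun μ => v.chr D μ z * v.metric z
  have hB : ∀ μ s ν, B μ s ν = B s μ ν := fun μ s ν => by
    simp only [B, Matrix.mul_apply]
    exact Finset.sum_congr rfl fun l _ => congrArg (· * _) (h.chr_symm hz μ s l)
  have hp : ∀ μ s ν, pd D μ (fun y => v.metric y s ν) z = B μ s ν + B μ ν s := fun μ s ν =>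
    congrFun (congrFun (h.mder_metric hz μ) s) ν
  have hinv : v.metric z * (v.metric z)⁻¹ = 1 := by
    apply Matrix.mul_nonsing_inv
    rw [metric_eq, Matrix.det_mul, Matrix.det_mul, Matrix.det_transpose]
    have h1 : IsUnit (v.om z).det :=
      (Matrix.isUnit_nonsing_inv_det _ (isUnit_iff_ne_zero.2 (h.nondegenerate z hz)))
    have h2 : IsUnit (Matrix.of eta).det := by
      have : Matrix.of eta = Matrix.diagonal fun a => eta a a := by
        ext a b
        by_cases hab : a = b
        · subst hab; simp
        · simp [hab, eta]
      rw [this, Matrix.det_diagonal]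
      simp [eta]
    exact (h1.mul h2).mul h1
  have hsymm : ∀ s, (v.metric z)⁻¹ l s = (v.metric z)⁻¹ s l := fun s => by
    have := Matrix.transpose_nonsing_inv (v.metric z)
    rw [metric_symm] at this
    exact congrFun (congrFun this s) l
  have e : ∀ s, pd D μ (fun y => v.metric y s ν) z + pd D ν (fun y => v.metric y s μ) z
      - pd D s (fun y => v.metric y μ ν) z = 2 * B μ ν s := fun s => by
    rw [hp, hp, hp, hB μ s, hB ν s, hB ν μ]
    ring
  rw [christoffel]
  simp only [e, hsymm]
  have e3 : v.chr D μ z = B μ * (v.metric z)⁻¹ := by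
    simp only [B]
    rw [mul_assoc, hinv, mul_one]
  rw [e3, Matrix.mul_apply, Finset.mul_sum]
  exact Finset.sum_congr rfl fun s _ => by ring

/-- The curvature of the connection in coordinates. -/
noncomputable def _root_.ConformalEFE.LocalFields.curvConn (v : LocalFields) (D : Set Coord)
    (μ ν : Fin 4) (z : Coord) : Matrix (Fin 4) (Fin 4) ℝ :=
  mder D (coordVec μ) (v.conn ν) z - mder D (coordVec ν) (v.conn μ) z
    + v.conn ν z * v.conn μ z - v.conn μ z * v.conn ν z

theorem mder_chr {z : Coord} (hz : z ∈ D) (μ ν : Fin 4) :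
    mder D (coordVec μ) (v.chr D ν) z
      = (mder D (coordVec μ) (mder D (coordVec ν) v.om) z
          + (mder D (coordVec μ) v.om z * v.conn ν z
            + v.om z * mder D (coordVec μ) (v.conn ν) z)) * v.frameMatrix z
        + (mder D (coordVec ν) v.om z + v.om z * v.conn ν z)
          * -(v.frameMatrix z * mder D (coordVec μ) v.om z * v.frameMatrix z) := by
  have hu := h.dom.uniqueDiffOn z hz
  have d1 := h.diff_mder_om hz (coordVec ν)
  have d2 := (h.diff_om hz).mul (h.diff_conn hz ν)
  have e : v.chr D ν = fun y => (mder D (coordVec ν) v.om y + v.om y * v.conn ν y)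
      * v.frameMatrix y := rfl
  rw [e, mder_mul hu (d1.add d2) (h.diff_frame hz), mder_add hu d1 d2,
    mder_mul hu (h.diff_om hz) (h.diff_conn hz ν), h.mder_frame hz]

/-- `chr` is the gauge transform of `conn` by the coframe matrix, so the curvatures are conjugate;
the second derivatives of the coframe cancel because they commute. -/
theorem curvature_eq {z : Coord} (hz : z ∈ D) (μ ν : Fin 4) :
    mder D (coordVec μ) (v.chr D ν) z - mder D (coordVec ν) (v.chr D μ) z
      + v.chr D ν z * v.chr D μ z - v.chr D μ z * v.chr D ν z
      = v.om z * v.curvConn D μ ν z * v.frameMatrix z := by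
  rw [h.mder_chr hz, h.mder_chr hz, mder_mder_comm h.dom hz h.smooth_om (coordVec ν)]
  simp only [LocalFields.chr, LocalFields.curvConn]
  have hFo := h.mul_om hz
  generalize v.om z = o at *
  generalize v.frameMatrix z = F at *
  generalize mder D (coordVec μ) (mder D (coordVec ν) v.om) z = a
  generalize mder D (coordVec μ) v.om z = oμ
  generalize mder D (coordVec ν) v.om z = oν
  generalize mder D (coordVec μ) (v.conn ν) z = b
  generalize mder D (coordVec ν) (v.conn μ) z = c
  generalize v.conn μ z = A
  generalize v.conn ν z = A'
  have e1 : (oν + o * A') * F * ((oμ + o * A) * F)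
      = (oν + o * A') * F * oμ * F + (oν + o * A') * A * F := by
    calc _ = (oν + o * A') * F * oμ * F + (oν + o * A') * (F * o) * A * F := by noncomm_ring
      _ = _ := by rw [hFo, mul_one]
  have e2 : (oμ + o * A) * F * ((oν + o * A') * F)
      = (oμ + o * A) * F * oν * F + (oμ + o * A) * A' * F := by
    calc _ = (oμ + o * A) * F * oν * F + (oμ + o * A) * (F * o) * A' * F := by noncomm_ring
      _ = _ := by rw [hFo, mul_one]
  rw [e1, e2]
  noncomm_ring

theorem pd_eq {z : Coord} (hz : z ∈ D) (μ : Fin 4) (f : Coord → ℝ) :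
    pd D μ f z = ∑ a, v.om z μ a * v.dirD D a f z := by
  have e : ∀ ν, ∑ a, v.om z μ a * v.e a ν z = if μ = ν then 1 else 0 := fun ν => by
    rw [← Matrix.one_apply, ← h.om_mul hz, Matrix.mul_apply]
    rfl
  simp only [LocalFields.dirD, Finset.mul_sum]
  rw [Finset.sum_comm]
  simp only [← mul_assoc, ← Finset.sum_mul, e]
  simp

/-- Passing from coordinate to frame components differentiates the coframe. By `symm` these
derivatives supply the term of `geomCurv` with $\Gamma_b{}^f{}_a-\Gamma_a{}^f{}_b$. -/
theorem curvConn_eq {z : Coord} (hz : z ∈ D) (μ ν d c : Fin 4) :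
    v.curvConn D μ ν z d c
      = ∑ a, ∑ b, v.om z μ a * v.om z ν b * v.geomCurv D c d a b z := by
  have hu := h.dom.uniqueDiffOn z hz
  have e1 : ∀ μ ν, mder D (coordVec μ) (v.conn ν) z d c
      = ∑ b, mder D (coordVec μ) v.om z ν b * v.Γ b c d z
        + ∑ a, ∑ b, v.om z μ a * v.om z ν b * v.dirD D a (v.Γ b c d) z := fun μ ν => by
    have e2 : mder D (coordVec μ) (v.conn ν) z d c
        = der D (coordVec μ) (fun y => ∑ b, v.om y ν b * v.Γ b c d y) z := rfl
    rw [e2, der_sum _ hu fun b _ => (h.diff_om hz ν b).fun_mul (h.diff_Γ hz b c d)]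
    simp only [der_mul hu (h.diff_om hz ν _) (h.diff_Γ hz _ c d)]
    rw [Finset.sum_add_distrib]
    congr 1
    rw [Finset.sum_comm]
    refine Finset.sum_congr rfl fun b _ => ?_
    have := h.pd_eq hz μ (v.Γ b c d)
    change v.om z ν b * pd D μ (v.Γ b c d) z = _
    rw [this, Finset.mul_sum]
    exact Finset.sum_congr rfl fun a _ => by ring
  have e3 : ∀ f, mder D (coordVec μ) v.om z ν f - mder D (coordVec ν) v.om z μ f
      = ∑ a, ∑ b, v.om z μ a * v.om z ν b * (v.Γ b f a z - v.Γ a f b z) := fun f => by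
    have := h.symm hz μ ν f
    rw [Matrix.mul_apply, Matrix.mul_apply] at this
    simp only [LocalFields.conn, Matrix.of_apply] at this
    have e4 : ∑ a, ∑ b, v.om z μ a * v.om z ν b * (v.Γ b f a z - v.Γ a f b z)
        = ∑ c, v.om z μ c * ∑ b, v.om z ν b * v.Γ b f c z
          - ∑ c, v.om z ν c * ∑ b, v.om z μ b * v.Γ b f c z := by
      simp only [Finset.mul_sum, mul_sub, Finset.sum_sub_distrib]
      congr 1
      · exact Finset.sum_congr rfl fun a _ => Finset.sum_congr rfl fun b _ => by ring
      · rw [Finset.sum_comm]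
        exact Finset.sum_congr rfl fun a _ => Finset.sum_congr rfl fun b _ => by ring
    rw [e4]
    linarith
  have e5 : ∀ μ ν, (v.conn ν z * v.conn μ z) d c
      = ∑ a, ∑ b, v.om z μ a * v.om z ν b * ∑ f, v.Γ b f d z * v.Γ a c f z := fun μ ν => by
    simp only [Matrix.mul_apply, LocalFields.conn, Matrix.of_apply, Fin.sum_univ_four]
    ring
  have e6 : ∀ F : Fin 4 → Fin 4 → ℝ, ∑ a, ∑ b, v.om z μ a * v.om z ν b * F b a
      = ∑ a, ∑ b, v.om z ν a * v.om z μ b * F a b := fun F => by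
    rw [Finset.sum_comm]
    exact Finset.sum_congr rfl fun a _ => Finset.sum_congr rfl fun b _ => by ring
  have e7 : ∑ a, ∑ b, v.om z μ a * v.om z ν b * ∑ f, v.Γ f c d z * (v.Γ b f a z - v.Γ a f b z)
      = ∑ f, mder D (coordVec μ) v.om z ν f * v.Γ f c d z
        - ∑ f, mder D (coordVec ν) v.om z μ f * v.Γ f c d z := by
    rw [← Finset.sum_sub_distrib]
    simp only [← sub_mul, e3, Finset.sum_mul, Finset.mul_sum]
    conv_rhs => rw [Finset.sum_comm]
    refine Finset.sum_congr rfl fun a _ => ?_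
    conv_rhs => rw [Finset.sum_comm]
    exact Finset.sum_congr rfl fun b _ => Finset.sum_congr rfl fun f _ => by ring
  have e8 : ∑ a, ∑ b, v.om z μ a * v.om z ν b * v.geomCurv D c d a b z
      = ∑ a, ∑ b, v.om z μ a * v.om z ν b * v.dirD D a (v.Γ b c d) z
        - ∑ a, ∑ b, v.om z μ a * v.om z ν b * v.dirD D b (v.Γ a c d) z
        + ∑ a, ∑ b, v.om z μ a * v.om z ν b * ∑ f, v.Γ f c d z * (v.Γ b f a z - v.Γ a f b z)
        + (∑ a, ∑ b, v.om z μ a * v.om z ν b * ∑ f, v.Γ b f d z * v.Γ a c f z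
          - ∑ a, ∑ b, v.om z μ a * v.om z ν b * ∑ f, v.Γ a f d z * v.Γ b c f z) := by
    simp only [← Finset.sum_sub_distrib, ← Finset.sum_add_distrib, LocalFields.geomCurv]
    refine Finset.sum_congr rfl fun a _ => Finset.sum_congr rfl fun b _ => ?_
    rw [Finset.sum_sub_distrib]
    ring
  rw [e8, e7, e6 fun b a => v.dirD D b (v.Γ a c d) z,
    e6 fun b a => ∑ f, v.Γ a f d z * v.Γ b c f z, ← e5 μ ν, ← e5 ν μ, LocalFields.curvConn,
    Matrix.sub_apply, Matrix.add_apply, Matrix.sub_apply, e1, e1]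
  ring

/-- The Ricci tensor is the Ricci tensor of the frame connection. -/
theorem ricci_eq {z : Coord} (hz : z ∈ D) (μ ν : Fin 4) :
    ricci D v.metric μ ν z
      = ∑ d, ∑ b, v.om z μ d * v.om z ν b * ∑ c, v.geomCurv D c d c b z := by
  have c1 : ∀ l μ ν, ∀ y ∈ D, christoffel D v.metric l μ ν y = v.chr D μ y ν l :=
    fun l μ ν y hy => h.christoffel_eq hy l μ ν
  have c2 : ∀ l μ ν, ∀ y ∈ D, christoffel D v.metric l μ ν y = v.chr D ν y μ l :=
    fun l μ ν y hy => (c1 l μ ν y hy).trans (h.chr_symm hy μ ν l)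
  have e1 : ricci D v.metric μ ν z
      = ∑ l, (v.om z * v.curvConn D l ν z * v.frameMatrix z) μ l := by
    simp only [← h.curvature_eq hz]
    rw [ricci, ← Finset.sum_add_distrib]
    refine Finset.sum_congr rfl fun l _ => ?_
    have p1 : pd D l (christoffel D v.metric l μ ν) z
        = mder D (coordVec l) (v.chr D ν) z μ l := der_congr (c2 l μ ν) hz
    have p2 : pd D ν (christoffel D v.metric l μ l) z
        = mder D (coordVec ν) (v.chr D l) z μ l := der_congr (c2 l μ l) hz
    simp only [p1, p2, Matrix.add_apply, Matrix.sub_apply, Matrix.mul_apply,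
      Finset.sum_sub_distrib]
    have q1 : ∑ s, christoffel D v.metric l l s z * christoffel D v.metric s μ ν z
        = ∑ s, v.chr D ν z μ s * v.chr D l z s l := Finset.sum_congr rfl fun s _ => by
      rw [c1 l l s z hz, c2 s μ ν z hz, mul_comm]
    have q2 : ∑ s, christoffel D v.metric l ν s z * christoffel D v.metric s μ l z
        = ∑ s, v.chr D l z μ s * v.chr D ν z s l := Finset.sum_congr rfl fun s _ => by
      rw [c1 l ν s z hz, c2 s μ l z hz, mul_comm]
    rw [q1, q2]
    ring
  rw [e1]
  have hFo : ∀ c a, ∑ l, v.frameMatrix z c l * v.om z l a = if c = a then 1 else 0 :=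
    fun c a => by rw [← Matrix.mul_apply, h.mul_om hz, Matrix.one_apply]
  have e2 : ∀ d c, ∑ l, v.curvConn D l ν z d c * v.frameMatrix z c l
      = ∑ b, v.om z ν b * v.geomCurv D c d c b z := fun d c => by
    simp only [h.curvConn_eq hz, Finset.sum_mul]
    rw [Finset.sum_comm]
    have : ∀ a, ∑ l, ∑ b, v.om z l a * v.om z ν b * v.geomCurv D c d a b z * v.frameMatrix z c l
        = (∑ l, v.frameMatrix z c l * v.om z l a) * ∑ b, v.om z ν b * v.geomCurv D c d a b z :=
      fun a => by
        rw [Finset.sum_mul]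
        refine Finset.sum_congr rfl fun l _ => ?_
        rw [Finset.mul_sum]
        exact Finset.sum_congr rfl fun b _ => by ring
    simp only [this, hFo]
    simp
  have e3 : ∀ l, (v.om z * v.curvConn D l ν z * v.frameMatrix z) μ l
      = ∑ d, ∑ c, v.om z μ d * (v.curvConn D l ν z d c * v.frameMatrix z c l) := fun l => by
    simp only [Matrix.mul_apply, Finset.sum_mul]
    rw [Finset.sum_comm]
    exact Finset.sum_congr rfl fun d _ => Finset.sum_congr rfl fun c _ => by ring
  simp only [e3]
  rw [Finset.sum_comm]
  refine Finset.sum_congr rfl fun d _ => ?_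
  rw [Finset.sum_comm]
  simp only [← Finset.mul_sum, e2]
  rw [Finset.sum_comm, Finset.mul_sum]
  refine Finset.sum_congr rfl fun b _ => ?_
  rw [← Finset.mul_sum]
  ring

end IsMetricFrame
namespace LocalSolution

variable {u : LocalFields} {τ₀ τs τe : ℝ} {U : Set Space} (h : LocalSolution u τ₀ τs τe U)
include h

/-! ### Vanishing of the torsion and of the curvature zero quantity -/

theorem metric_diag {z : Coord} (hz : z ∈ slab τs τe U) (a b c : Fin 4) :
    eta b b * u.Γ a b c z + eta c c * u.Γ a c b z = 0 := by
  have e : ∀ b c, ∑ x, eta b x * u.Γ a x c z = eta b b * u.Γ a b c z := fun b c =>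
    Finset.sum_eq_single b (fun x _ hx => by simp [eta, Ne.symm hx]) (by simp)
  have := h.metric_connection hz a b c
  rwa [e, e] at this

omit h in
theorem curvZero_swap (c d a b : Fin 4) {z : Coord} (hA : u.Algebraic z) :
    u.curvZero (slab τs τe U) τ₀ c d a b z = -u.curvZero (slab τs τe U) τ₀ c d b a z := by
  have e1 : u.dUp c d a b z = -u.dUp c d b a z := by
    simp only [LocalFields.dUp, ← Finset.sum_neg_distrib]
    exact Finset.sum_congr rfl fun x _ => by rw [hA.antisymm_right x d a b, mul_neg]
  simp only [LocalFields.curvZero, LocalFields.geomCurv, LocalFields.algCurv, e1,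
    Finset.sum_sub_distrib, mul_sub]
  ring

/-- Antisymmetry in the first pair of indices, as for the curvature of a metric connection. On the
algebraic side it rests on the symmetry of $\hat L$. -/
theorem curvZero_lower {z : Coord} (hz : z ∈ slab τs τe U) (c d a b : Fin 4) :
    eta c c * u.curvZero (slab τs τe U) τ₀ c d a b z
      + eta d d * u.curvZero (slab τs τe U) τ₀ d c a b z = 0 := by
  have hu := h.dom.uniqueDiffOn z hz
  have m := h.metric_diag hz
  have hs : ∀ c, eta c c * eta c c = 1 := fun c => by
    refine Fin.cases (by simp [eta]) (fun i => by simp [eta_succ_succ, delta_self]) c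
  have e1 : ∀ a b, eta c c * u.dirD (slab τs τe U) a (u.Γ b c d) z
      + eta d d * u.dirD (slab τs τe U) a (u.Γ b d c) z = 0 := fun a b => by
    have a1 := h.diff_Γ hz
    have : der (slab τs τe U) (u.frameVec a z)
        (fun y => eta c c * u.Γ b c d y + eta d d * u.Γ b d c y) z = 0 :=
      der_zero_fun (fun y hy => h.metric_diag hy b c d) hz
    rw [der_add hu ((a1 _ _ _).const_mul _) ((a1 _ _ _).const_mul _),
      der_mul hu (differentiableWithinAt_const _) (a1 _ _ _),
      der_mul hu (differentiableWithinAt_const _) (a1 _ _ _), der_const, der_const] at this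
    rw [u.dirD_eq, u.dirD_eq]
    linarith
  have e2 : ∀ (T : Fin 4 → ℝ), eta c c * ∑ f, u.Γ f c d z * T f
      + eta d d * ∑ f, u.Γ f d c z * T f = 0 := fun T => by
    rw [Finset.mul_sum, Finset.mul_sum, ← Finset.sum_add_distrib]
    refine Finset.sum_eq_zero fun f _ => ?_
    linear_combination T f * m f c d
  have e3 : eta c c * ∑ f, (u.Γ b f d z * u.Γ a c f z - u.Γ a f d z * u.Γ b c f z)
      + eta d d * ∑ f, (u.Γ b f c z * u.Γ a d f z - u.Γ a f c z * u.Γ b d f z) = 0 := by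
    rw [Finset.mul_sum, Finset.mul_sum, ← Finset.sum_add_distrib]
    refine Finset.sum_eq_zero fun f _ => ?_
    linear_combination u.Γ b f d z * m a c f - u.Γ a f d z * m b c f
      + u.Γ b f c z * m a d f - u.Γ a f c z * m b d f
  have hdU : ∀ c d, eta c c * u.dUp c d a b z = u.d c d a b z := fun c d => by
    have : u.dUp c d a b z = eta c c * u.d c d a b z :=
      Finset.sum_eq_single c (fun x _ hx => by simp [eta, Ne.symm hx]) (by simp)
    rw [this, ← mul_assoc, hs, one_mul]
  have e4 : eta c c * u.dUp c d a b z + eta d d * u.dUp d c a b z = 0 := by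
    rw [hdU, hdU, (h.algebraic z hz).antisymm_left c d]
    ring
  have hS : ∀ c d a b, eta c c * ∑ e, S d a c e * u.L b e z
      = eta c d * u.L b a z + eta c a * u.L b d z - eta d a * u.L b c z := fun c d a b => by
    have k : ∀ x, eta c c * kron x c = eta c x := fun x => by
      by_cases hx : c = x
      · subst hx; simp [kron]
      · simp [kron, eta, hx, Ne.symm hx]
    have t1 : ∑ e, S d a c e * u.L b e z
        = kron d c * u.L b a z + kron a c * u.L b d z - eta d a * (eta c c * u.L b c z) := by
      simp only [S, sub_mul, add_mul, Finset.sum_add_distrib, Finset.sum_sub_distrib]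
      congr 1
      · congr 1
        · simp [kron]
        · simp [kron]
      · simp [eta]
    rw [t1]
    linear_combination u.L b a z * k d + u.L b d z * k a - eta d a * u.L b c z * hs c
  have hes : ∀ a b, eta a b = eta b a := fun a b => by
    by_cases hx : a = b
    · subst hx; rfl
    · simp [eta, hx, Ne.symm hx]
  have e5 : eta c c * ∑ e, (S d a c e * u.L b e z - S d b c e * u.L a e z)
      + eta d d * ∑ e, (S c a d e * u.L b e z - S c b d e * u.L a e z) = 0 := by
    rw [Finset.sum_sub_distrib, Finset.sum_sub_distrib, mul_sub, mul_sub, hS, hS, hS, hS,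
      hes d c, hes d a, hes d b]
    have hL : u.L a b z = u.L b a z := by
      refine Fin.cases ?_ (fun i => Fin.cases ?_ (fun j => ?_) b) a
      · rw [(h.gauge z hz).schouten, h.L_right_zero hz]
      · rw [(h.gauge z hz).schouten, h.L_right_zero hz]
      · exact (h.chi_ell_symm hz i j).2
    rw [hL]
    ring
  simp only [LocalFields.curvZero, LocalFields.geomCurv, LocalFields.algCurv]
  linear_combination e1 a b - e1 b a + e2 (fun f => u.Γ b f a z - u.Γ a f b z) + e3
    - Theta τ₀ z.1 * e4 - e5

/-- `Y` gives the components with one time index in the first pair and `R` the spatial ones, with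
`curvZero_lower` supplying those related by antisymmetry. Components with a time index in the second
pair vanish by the evolution equations. -/
theorem curvZero_eq_zero {z : Coord} (hz : z ∈ slab τs τe U)
    (h0 : ∀ i, (u.reduced τ₀).zeroQty (slab τs τe U) i z = 0) (c d a b : Fin 4) :
    u.curvZero (slab τs τe U) τ₀ c d a b z = 0 := by
  have hA := h.algebraic z hz
  have k0 : ∀ m k : Fin 3,
      u.curvZero (slab τs τe U) τ₀ k.succ 0 (m + 1).succ (m + 2).succ z = 0 := fun m k => by
    rw [h.curv_mixed hz, show (u.reduced τ₀).Y (slab τs τe U) m k z = 0 from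
      h0 (.inr (.inr (.inl (m, k)))), mul_zero]
  have kk : ∀ m k : Fin 3,
      u.curvZero (slab τs τe U) τ₀ (k + 2).succ (k + 1).succ (m + 1).succ (m + 2).succ z = 0 :=
    fun m k => (h.geomCurv_spatial hz m k).trans (h0 (.inr (.inl (m, k))))
  have low := fun c d m => h.curvZero_lower hz c d (Fin.succ (m + 1)) (Fin.succ (m + 2))
  have hcd : ∀ (m : Fin 3) (c d : Fin 4),
      u.curvZero (slab τs τe U) τ₀ c d (m + 1).succ (m + 2).succ z = 0 := by
    intro m c d
    refine Fin.cases ?_ (fun k => ?_) d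
    · refine Fin.cases ?_ (fun k => k0 m k) c
      have := low 0 0 m
      rw [eta_zero_zero] at this
      linarith
    · refine Fin.cases ?_ (fun l => ?_) c
      · have := low 0 k.succ m
        rw [k0 m k, eta_zero_zero] at this
        linarith
      · have e := low l.succ k.succ m
        rw [eta_succ_succ, eta_succ_succ, delta_self, delta_self] at e
        rcases fin3_cyclic k l with rfl | rfl | rfl
        · linarith
        · have := kk m (k + 2)
          rwa [fin3_add_two_add_two, fin3_add_two_add_one] at this
        · have := kk m (k + 1)
          rw [fin3_add_one_add_two, fin3_add_one_add_one] at this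
          rw [this] at e
          linarith
  refine Fin.cases ?_ (fun i => ?_) a
  · exact (h.evolution z hz).connection c d b
  · refine Fin.cases ?_ (fun j => ?_) b
    · rw [curvZero_swap c d _ _ hA, (h.evolution z hz).connection, neg_zero]
    · rcases fin3_cyclic i j with rfl | rfl | rfl
      · have := curvZero_swap (τs := τs) (τe := τe) (U := U) (τ₀ := τ₀) c d j.succ j.succ hA
        linarith
      · have := hcd (i + 2) c d
        rwa [fin3_add_two_add_two, fin3_add_two_add_one] at this
      · have := hcd (i + 1) c d
        rw [fin3_add_one_add_two, fin3_add_one_add_one] at this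
        rw [curvZero_swap c d _ _ hA, this, neg_zero]

theorem torsionZero_eq_zero {z : Coord} (hz : z ∈ slab τs τe U)
    (h0 : ∀ i, (u.reduced τ₀).zeroQty (slab τs τe U) i z = 0) (a b ν : Fin 4) :
    u.torsionZero (slab τs τe U) a b ν z = 0 := by
  have sw : ∀ a b, u.torsionZero (slab τs τe U) a b ν z
      = -u.torsionZero (slab τs τe U) b a ν z := fun a b => by
    simp only [LocalFields.torsionZero, sub_mul, Finset.sum_sub_distrib]
    ring
  have hs : ∀ m : Fin 3, u.torsionZero (slab τs τe U) (m + 1).succ (m + 2).succ ν z = 0 :=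
    fun m => (h.torsion_eq hz m ν).trans (h0 (.inl (m, ν)))
  refine Fin.cases ?_ (fun i => ?_) a
  · exact (h.evolution z hz).frame b ν
  · refine Fin.cases ?_ (fun j => ?_) b
    · rw [sw, (h.evolution z hz).frame, neg_zero]
    · rcases fin3_cyclic i j with rfl | rfl | rfl
      · linarith [sw j.succ j.succ]
      · have := hs (i + 2)
        rwa [fin3_add_two_add_two, fin3_add_two_add_one] at this
      · have := hs (i + 1)
        rw [fin3_add_one_add_two, fin3_add_one_add_one] at this
        rw [sw, this, neg_zero]

end LocalSolution

/-! ### The physical frame -/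

theorem IsRegularDomain.inter {D O : Set Coord} (h : IsRegularDomain D) (hO : IsOpen O) :
    IsRegularDomain (D ∩ O) := by
  refine ⟨h.uniqueDiffOn.inter hO, ?_⟩
  rw [interior_inter, hO.interior_eq, Set.inter_comm, Set.inter_comm _ O]
  exact (Set.inter_subset_inter_right O h.subset_closure).trans hO.inter_closure

/-- The frame `Θ e_a` with the coefficients of its Levi-Civita connection. -/
noncomputable def LocalFields.phys (u : LocalFields) (τ₀ : ℝ) : LocalFields where
  e a μ z := Theta τ₀ z.1 * u.e a μ z
  Γ a c b z := Theta τ₀ z.1 * u.Γ a c b z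
    + (z.1 - τ₀) * (kron b 0 * kron a c + eta a b * kron c 0)
  L := u.L
  d := u.d

theorem phys_metric (u : LocalFields) (τ₀ : ℝ) {z : Coord} (hΘ : Theta τ₀ z.1 ≠ 0) :
    (u.phys τ₀).metric z = u.physMetric τ₀ z := by
  have e : (u.phys τ₀).frameMatrix z = Theta τ₀ z.1 • u.frameMatrix z := by
    ext a μ
    rfl
  have e2 : ((u.phys τ₀).frameMatrix z)⁻¹ = (Theta τ₀ z.1)⁻¹ • (u.frameMatrix z)⁻¹ := by
    rw [e]
    by_cases hd : IsUnit (u.frameMatrix z).det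
    · have := invertibleOfNonzero hΘ
      rw [Matrix.inv_smul (u.frameMatrix z) (Theta τ₀ z.1) hd, invOf_eq_inv]
    · rw [Matrix.nonsing_inv_apply_not_isUnit _ hd, smul_zero]
      refine Matrix.nonsing_inv_apply_not_isUnit _ ?_
      rw [Matrix.det_smul]
      exact fun h => hd (isUnit_of_mul_isUnit_right h)
  ext μ ν
  simp only [LocalFields.metric, LocalFields.physMetric, e2, Matrix.of_apply, Matrix.smul_apply,
    smul_eq_mul, Finset.mul_sum]
  refine Finset.sum_congr rfl fun a _ => Finset.sum_congr rfl fun b _ => ?_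
  rw [sq, mul_inv]
  ring

namespace LocalSolution

variable {u : LocalFields} {τ₀ τs τe : ℝ} {U : Set Space} (h : LocalSolution u τ₀ τs τe U)

/-- The part of the slab where the conformal factor does not vanish. -/
def _root_.ConformalEFE.physSlab (τ₀ τs τe : ℝ) (U : Set Space) : Set Coord :=
  slab τs τe U ∩ {z | Theta τ₀ z.1 ≠ 0}

theorem isOpen_Theta_ne : IsOpen {z : Coord | Theta τ₀ z.1 ≠ 0} := by
  refine isOpen_ne_fun ?_ continuous_const
  unfold Theta
  fun_prop

include h

theorem der_Theta {z : Coord} (hz : z ∈ slab τs τe U) (a : Fin 4) :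
    u.dirD (slab τs τe U) a (fun y => Theta τ₀ y.1) z = -(z.1 - τ₀) * kron a 0 := by
  refine Fin.cases ?_ (fun i => ?_) a
  · rw [h.dirD_zero hz, h.dt_Theta hz, kron_zero_zero, mul_one]
  · rw [u.dirD_eq, kron_succ_zero, mul_zero]
    exact h.solves.dX_th i z hz

theorem dirD_time {z : Coord} (hz : z ∈ slab τs τe U) (a : Fin 4) :
    u.dirD (slab τs τe U) a (fun y => y.1 - τ₀) z = kron a 0 := by
  rw [u.dirD_eq, h.der_time hz, ← coordEquiv_symm_zero, coordEquiv_symm_frameVec]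
  refine Fin.cases ?_ (fun i => ?_) a
  · rw [(h.gauge z hz).frame]
  · rw [h.e_spatial_zero hz, kron_succ_zero]

omit h in
theorem dirD_phys {z : Coord} (hz : z ∈ physSlab τ₀ τs τe U) (a : Fin 4) (F : Coord → ℝ) :
    (u.phys τ₀).dirD (physSlab τ₀ τs τe U) a F z
      = Theta τ₀ z.1 * u.dirD (slab τs τe U) a F z := by
  have e : ∀ μ, pd (physSlab τ₀ τs τe U) μ F z = pd (slab τs τe U) μ F z := fun μ =>
    der_inter isOpen_Theta_ne hz.2
  simp only [LocalFields.dirD, e, LocalFields.phys, Finset.mul_sum]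
  exact Finset.sum_congr rfl fun μ _ => by ring

theorem dirD_phys_Γ {z : Coord} (hz : z ∈ slab τs τe U) (a b c d : Fin 4) :
    u.dirD (slab τs τe U) a ((u.phys τ₀).Γ b c d) z
      = Theta τ₀ z.1 * u.dirD (slab τs τe U) a (u.Γ b c d) z
        + kron a 0 * (-(z.1 - τ₀) * u.Γ b c d z
          + (kron d 0 * kron b c + eta b d * kron c 0)) := by
  have hu := h.dom.uniqueDiffOn z hz
  have e1 := h.der_Theta hz a
  have e2 := h.dirD_time hz a
  have a1 := diff_Theta (τ₀ := τ₀) (τs := τs) (τe := τe) (U := U) (z := z)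
  have a2 := h.diff_Γ hz b c d
  have a3 : DifferentiableWithinAt ℝ (fun y : Coord => y.1 - τ₀) (slab τs τe U) z := by fun_prop
  rw [u.dirD_eq] at e1 e2 ⊢
  rw [u.dirD_eq]
  change der _ _ (fun y => Theta τ₀ y.1 * u.Γ b c d y
    + (y.1 - τ₀) * (kron d 0 * kron b c + eta b d * kron c 0)) z = _
  rw [der_add hu (a1.fun_mul a2) (a3.mul_const _), der_mul hu a1 a2,
    der_mul hu a3 (differentiableWithinAt_const _), e1, e2, der_const]
  ring

theorem dirD_phys_e {z : Coord} (hz : z ∈ slab τs τe U) (a b ν : Fin 4) :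
    u.dirD (slab τs τe U) a ((u.phys τ₀).e b ν) z
      = Theta τ₀ z.1 * u.dirD (slab τs τe U) a (u.e b ν) z
        + -(z.1 - τ₀) * kron a 0 * u.e b ν z := by
  have hu := h.dom.uniqueDiffOn z hz
  have e1 := h.der_Theta hz a
  have a1 := diff_Theta (τ₀ := τ₀) (τs := τs) (τe := τe) (U := U) (z := z)
  rw [u.dirD_eq] at e1 ⊢
  rw [u.dirD_eq]
  change der _ _ (fun y => Theta τ₀ y.1 * u.e b ν y) z = _
  rw [der_mul hu a1 (h.diff_e hz b ν), e1]
  ring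

/-- The term added to $\Theta\Gamma$ in `LocalFields.phys` is the effect of $d\log\Theta$, which has
only a time component. It is antisymmetric after lowering an index, and its antisymmetrisation
accounts for the derivatives of $\Theta$ in $[\Theta e_a,\Theta e_b]$. -/
theorem isMetricFrame
    (h0 : ∀ z ∈ slab τs τe U, ∀ i, (u.reduced τ₀).zeroQty (slab τs τe U) i z = 0) :
    IsMetricFrame (u.phys τ₀) (physSlab τ₀ τs τe U) where
  dom := h.dom.inter isOpen_Theta_ne
  smooth_e a μ := (contDiffOn_Theta.mul (h.regular.e a μ)).mono Set.inter_subset_left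
  smooth_Γ a b c := ((contDiffOn_Theta.mul (h.regular.Γ a b c)).add
    ((contDiffOn_fst.sub contDiffOn_const).mul contDiffOn_const)).mono Set.inter_subset_left
      |>.of_le (by norm_num)
  nondegenerate z hz := by
    have e : (u.phys τ₀).frameMatrix z = Theta τ₀ z.1 • u.frameMatrix z := by
      ext a μ
      rfl
    rw [e, Matrix.det_smul]
    exact mul_ne_zero (pow_ne_zero _ hz.2) (h.frame_nondegenerate hz.1)
  metric z hz a b c := by
    have m := h.metric_diag hz.1 a b c
    have e1 : ∀ b, eta a b = kron a b * eta b b := fun b => by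
      by_cases hx : a = b
      · subst hx; simp [kron]
      · simp [kron, eta, hx]
    have e2 : ∀ c, kron c 0 * (1 + eta c c) = 0 := fun c => by
      refine Fin.cases (by simp [eta]) (fun i => by simp [kron]) c
    simp only [LocalFields.phys]
    rw [e1 b, e1 c]
    linear_combination Theta τ₀ z.1 * m + (z.1 - τ₀) * kron a b * eta b b * e2 c
      + (z.1 - τ₀) * kron a c * eta c c * e2 b
  torsion z hz a b ν := by
    have t := h.torsionZero_eq_zero hz.1 (h0 z hz.1) a b ν
    rw [LocalFields.torsionZero] at t
    rw [LocalFields.torsionZero, dirD_phys hz, dirD_phys hz, h.dirD_phys_e hz.1,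
      h.dirD_phys_e hz.1]
    have e1 : ∑ c, ((u.phys τ₀).Γ a c b z - (u.phys τ₀).Γ b c a z) * (u.phys τ₀).e c ν z
        = Theta τ₀ z.1 ^ 2 * ∑ c, (u.Γ a c b z - u.Γ b c a z) * u.e c ν z
          + Theta τ₀ z.1 * (z.1 - τ₀) * (kron b 0 * u.e a ν z - kron a 0 * u.e b ν z) := by
      have k : ∀ a, u.e a ν z = ∑ c, kron a c * u.e c ν z := fun a => by simp [kron]
      have hes : eta b a = eta a b := by
        by_cases hx : a = b
        · subst hx; rfl
        · simp [eta, hx, Ne.symm hx]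
      rw [k a, k b, Finset.mul_sum, Finset.mul_sum, Finset.mul_sum, ← Finset.sum_sub_distrib,
        Finset.mul_sum, ← Finset.sum_add_distrib]
      refine Finset.sum_congr rfl fun c _ => ?_
      simp only [LocalFields.phys]
      rw [hes]
      ring
    rw [e1]
    linear_combination Theta τ₀ z.1 ^ 2 * t

/-- The four-dimensional formula $R_{db}=2L_{db}+\eta_{db}\,\mathrm{tr}\,L$. The Weyl part is
trace-free, and only the spatial components of $L$ enter its trace. -/
theorem algCurv_trace {z : Coord} (hz : z ∈ slab τs τe U) (d b : Fin 4) :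
    ∑ c, u.algCurv τ₀ c d c b z = 2 * u.L d b z + eta d b * ∑ i, u.ell i i z := by
  have hL : ∀ a b, u.L a b z = u.L b a z := fun a b => by
    refine Fin.cases ?_ (fun i => Fin.cases ?_ (fun j => ?_) b) a
    · rw [(h.gauge z hz).schouten, h.L_right_zero hz]
    · rw [(h.gauge z hz).schouten, h.L_right_zero hz]
    · exact (h.chi_ell_symm hz i j).2
  have e1 : ∑ c, u.dUp c d c b z = 0 := by
    rw [← (h.algebraic z hz).trace_free d b, Finset.sum_comm]
    refine Finset.sum_congr rfl fun c _ => Finset.sum_congr rfl fun x _ => ?_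
    by_cases hx : c = x
    · subst hx; rfl
    · simp [eta, hx, Ne.symm hx]
  have e2 : ∑ c, ∑ e, (S d c c e * u.L b e z - S d b c e * u.L c e z)
      = 2 * u.L d b z + eta d b * ∑ i, u.ell i i z := by
    have t1 : ∀ e, ∑ c, S d c c e = 4 * kron d e := fun e => by
      have p1 : ∑ c, kron d c * kron c e = kron d e := by simp [kron]
      have p2 : ∑ c : Fin 4, kron d e * kron c c = 4 * kron d e := by simp [kron]
      have p3 : ∑ c, eta d c * eta c e = kron d e := by
        refine (Finset.sum_eq_single d (fun x _ hx => by simp [eta, Ne.symm hx]) (by simp)).trans ?_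
        by_cases hx : d = e
        · subst hx
          refine Fin.cases (by simp [eta, kron]) (fun i => by simp [eta, kron]) d
        · simp [kron, eta, hx]
      simp only [S, Finset.sum_sub_distrib, Finset.sum_add_distrib, p1, p2, p3]
      ring
    have t2 : ∑ c, ∑ e, S d b c e * u.L c e z
        = u.L d b z + u.L b d z - eta d b * ∑ i, u.ell i i z := by
      have q3 : ∑ c, ∑ e, eta d b * eta c e * u.L c e z = eta d b * ∑ i, u.ell i i z := by
        simp only [mul_assoc, ← Finset.mul_sum]
        congr 1
        simp only [sum_four, eta_zero_zero, eta_zero_succ, eta_succ_zero, eta_succ_succ, zero_mul,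
          Finset.sum_const_zero, sum_delta_mul, (h.gauge z hz).schouten, mul_zero, zero_add]
        rfl
      have q1 : ∑ c, ∑ e, kron d c * kron b e * u.L c e z = u.L d b z := by simp [kron]
      have q2 : ∑ c, ∑ e, kron d e * kron b c * u.L c e z = u.L b d z := by simp [kron]
      simp only [S, sub_mul, add_mul, Finset.sum_sub_distrib, Finset.sum_add_distrib, q1, q2, q3]
    simp only [Finset.sum_sub_distrib]
    rw [t2, Finset.sum_comm]
    simp only [← Finset.sum_mul, t1]
    rw [show ∑ e, 4 * kron d e * u.L b e z = 4 * u.L b d z by simp [kron], hL b d]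
    ring
  simp only [LocalFields.algCurv, Finset.sum_add_distrib, ← Finset.mul_sum, e1, e2]
  ring

end LocalSolution

/-- The change of the Ricci tensor under the rescaling of the frame by a function `T` of time. -/
theorem sum_rescaled_curvature {T s : ℝ} {G : Fin 4 → Fin 4 → Fin 4 → ℝ}
    (DG : Fin 4 → Fin 4 → Fin 4 → Fin 4 → ℝ) (g0 : ∀ b c, G 0 b c = 0) (g00 : ∀ a, G a 0 0 = 0)
    (gs : ∀ a (j : Fin 3), G a 0 j.succ = G a j.succ 0)
    (ga : ∀ a (i j : Fin 3), G a i.succ j.succ = -G a j.succ i.succ)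
    (gx : ∀ i j : Fin 3, G i.succ j.succ 0 = G j.succ i.succ 0) (d b : Fin 4) :
    ∑ c, (T * (T * DG c b c d
        + kron c 0 * (-s * G b c d + (kron d 0 * kron b c + eta b d * kron c 0)))
      - T * (T * DG b c c d
        + kron b 0 * (-s * G c c d + (kron d 0 * kron c c + eta c d * kron c 0)))
      + ∑ f, (T * G f c d + s * (kron d 0 * kron f c + eta f d * kron c 0))
          * ((T * G b f c + s * (kron c 0 * kron b f + eta b c * kron f 0))
            - (T * G c f b + s * (kron b 0 * kron c f + eta c b * kron f 0)))
      + ∑ f, ((T * G b f d + s * (kron d 0 * kron b f + eta b d * kron f 0))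
            * (T * G c c f + s * (kron f 0 * kron c c + eta c f * kron c 0))
          - (T * G c f d + s * (kron d 0 * kron c f + eta c d * kron f 0))
            * (T * G b c f + s * (kron f 0 * kron b c + eta b f * kron c 0))))
    = T ^ 2 * ∑ c, (DG c b c d - DG b c c d + ∑ f, G f c d * (G b f c - G c f b)
        + ∑ f, (G b f d * G c c f - G c f d * G b c f))
      + (T + s ^ 2) * (eta d b - 2 * kron d 0 * kron b 0)
      + s ^ 2 * (2 * eta d b + 2 * kron d 0 * kron b 0)
      + T * s * (2 * G b d 0 + eta b d * ∑ i : Fin 3, G i.succ i.succ 0) := by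
  -- The hypotheses are rewritten as a normal form for the connection coefficients, after which each
  -- of the sixteen components is a polynomial identity.
  have r1 : ∀ a, G a 0 1 = G a 1 0 := fun a => gs a 0
  have r2 : ∀ a, G a 0 2 = G a 2 0 := fun a => gs a 1
  have r3 : ∀ a, G a 0 3 = G a 3 0 := fun a => gs a 2
  have q1 : ∀ a, G a 1 1 = 0 := fun a => by have : G a 1 1 = -G a 1 1 := ga a 0 0; linarith
  have q2 : ∀ a, G a 2 2 = 0 := fun a => by have : G a 2 2 = -G a 2 2 := ga a 1 1; linarith
  have q3 : ∀ a, G a 3 3 = 0 := fun a => by have : G a 3 3 = -G a 3 3 := ga a 2 2; linarith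
  have p1 : ∀ a, G a 2 1 = -G a 1 2 := fun a => ga a 1 0
  have p2 : ∀ a, G a 3 2 = -G a 2 3 := fun a => ga a 2 1
  have p3 : ∀ a, G a 3 1 = -G a 1 3 := fun a => ga a 2 0
  have x1 : G 2 1 0 = G 1 2 0 := gx 1 0
  have x2 : G 3 2 0 = G 2 3 0 := gx 2 1
  have x3 : G 3 1 0 = G 1 3 0 := gx 2 0
  fin_cases d <;> fin_cases b <;>
  simp [Fin.sum_univ_four, Fin.sum_univ_three, kron, eta, g0, g00, r1, r2, r3, q1, q2, q3, p1, p2,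
    p3, x1, x2, x3] <;> ring
namespace LocalSolution

variable {u : LocalFields} {τ₀ τs τe : ℝ} {U : Set Space} (h : LocalSolution u τ₀ τs τe U)
include h

/-! ### The Ricci tensor of the physical metric -/

/-- The relation between $\ell$ and $\chi$ removes both from the rescaled curvature and leaves
$3(2\Theta+(\tau-\tau_0)^2)\eta$. The bracket is 1, whence the Einstein constant $3$. -/
theorem ricci_trace {z : Coord} (hz : z ∈ physSlab τ₀ τs τe U)
    (h0 : ∀ i, (u.reduced τ₀).zeroQty (slab τs τe U) i z = 0) (d b : Fin 4) :
    ∑ c, (u.phys τ₀).geomCurv (physSlab τ₀ τs τe U) c d c b z = 3 * eta d b := by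
  have hc : ∑ c, u.geomCurv (slab τs τe U) c d c b z
      = 2 * u.L d b z + eta d b * ∑ i, u.ell i i z := by
    rw [← h.algCurv_trace hz.1]
    exact Finset.sum_congr rfl fun c _ => sub_eq_zero.1 (h.curvZero_eq_zero hz.1 h0 c d c b)
  have g0 : ∀ b c, u.Γ 0 b c z = 0 := (h.gauge z hz.1).connection
  have g00 : ∀ a, u.Γ a 0 0 z = 0 := h.Γ_zero_zero' hz.1
  have hk : ∀ d b, Theta τ₀ z.1 * u.L d b z + (z.1 - τ₀) * u.Γ b d 0 z
      = eta d b + kron d 0 * kron b 0 := fun d b => by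
    refine Fin.cases ?_ (fun i => Fin.cases ?_ (fun j => ?_) b) d
    · rw [(h.gauge z hz.1).schouten, g00]
      refine Fin.cases (by simp [eta, kron])
        (fun j => by simp [eta, kron, (Fin.succ_ne_zero j).symm]) b
    · rw [h.L_right_zero hz.1, g0]
      simp [eta, kron]
    · have := h.schouten_relation hz.1 i j
      rw [(h.chi_ell_symm hz.1 i j).1] at this
      rw [eta_succ_succ, kron_succ_zero, zero_mul, add_zero, ← this]
      rfl
  have ht : Theta τ₀ z.1 * ∑ i, u.ell i i z + (z.1 - τ₀) * ∑ i : Fin 3, u.Γ i.succ i.succ 0 z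
      = 3 := by
    have e : ∀ i, Theta τ₀ z.1 * u.ell i i z + (z.1 - τ₀) * u.Γ i.succ i.succ 0 z = 1 := fun i =>
      (h.schouten_relation hz.1 i i).trans (delta_self i)
    rw [Finset.mul_sum, Finset.mul_sum, ← Finset.sum_add_distrib,
      Finset.sum_congr rfl fun i _ => e i]
    simp
  have hes : eta b d = eta d b := by
    by_cases hx : b = d
    · subst hx; rfl
    · simp [eta, hx, Ne.symm hx]
  have hΘ : 2 * Theta τ₀ z.1 = 1 - (z.1 - τ₀) ^ 2 := by
    rw [Theta]
    ring
  simp only [LocalFields.geomCurv] at hc ⊢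
  simp only [dirD_phys hz, h.dirD_phys_Γ hz.1]
  simp only [LocalFields.phys]
  refine (sum_rescaled_curvature (G := fun a b c => u.Γ a b c z)
    (fun a b c d => u.dirD (slab τs τe U) a (u.Γ b c d) z) g0 g00 (fun a j => h.Γ_zero_succ hz.1 a j)
    (fun a i j => h.Γ_antisymm hz.1 a i j) (fun i j => (h.chi_ell_symm hz.1 i j).1) d b).trans ?_
  rw [hc, hes]
  linear_combination 2 * Theta τ₀ z.1 * hk d b + Theta τ₀ z.1 * eta d b * ht + 3 * eta d b * hΘ

end LocalSolution

theorem christoffel_congr {D : Set Coord} {g g' : Coord → Matrix (Fin 4) (Fin 4) ℝ}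
    (hg : ∀ z ∈ D, g z = g' z) (l μ ν : Fin 4) {z : Coord} (hz : z ∈ D) :
    christoffel D g l μ ν z = christoffel D g' l μ ν z := by
  have e : ∀ κ i j, pd D κ (fun y => g y i j) z = pd D κ (fun y => g' y i j) z := fun κ i j =>
    der_congr (fun y hy => by rw [hg y hy]) hz
  simp only [christoffel, e, hg z hz]

theorem ricci_congr {D : Set Coord} {g g' : Coord → Matrix (Fin 4) (Fin 4) ℝ}
    (hg : ∀ z ∈ D, g z = g' z) (μ ν : Fin 4) {z : Coord} (hz : z ∈ D) :
    ricci D g μ ν z = ricci D g' μ ν z := by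
  have e : ∀ κ l μ ν, pd D κ (christoffel D g l μ ν) z = pd D κ (christoffel D g' l μ ν) z :=
    fun κ l μ ν => der_congr (fun y hy => christoffel_congr hg l μ ν hy) hz
  simp only [ricci, e, christoffel_congr hg _ _ _ hz]

theorem LocalSolution.solvesVacuumEFE {u : LocalFields} {τ₀ τs τe : ℝ} {U : Set Space}
    (h : LocalSolution u τ₀ τs τe U) {k : ℕ} (hu : ∀ a μ, ContDiffOn ℝ k (u.e a μ) (slab τs τe U))
    (h0 : ∀ z ∈ slab τs τe U, ∀ i, (u.reduced τ₀).zeroQty (slab τs τe U) i z = 0) :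
    SolvesVacuumEFE k 3 (physSlab τ₀ τs τe U) (u.physMetric τ₀) where
  regular μ ν := by
    have ho : ∀ i j, ContDiffOn ℝ k (fun y => (u.frameMatrix y)⁻¹ i j) (slab τs τe U) :=
      contDiffOn_inv_matrix (A := u.frameMatrix) (fun a μ => hu a μ)
        fun z hz => h.frame_nondegenerate hz
    have hΘ : ContDiffOn ℝ k (fun y : Coord => ((Theta τ₀ y.1) ^ 2)⁻¹) (physSlab τ₀ τs τe U) := by
      refine ContDiffOn.inv (ContDiff.contDiffOn ?_) fun z hz => pow_ne_zero 2 hz.2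
      unfold Theta
      fun_prop
    have hm : ContDiffOn ℝ k (fun y => u.metric y μ ν) (slab τs τe U) := by
      simp only [LocalFields.metric, Matrix.of_apply]
      exact ContDiffOn.sum fun a _ => ContDiffOn.sum fun b _ =>
        (contDiffOn_const.mul (ho μ a)).mul (ho ν b)
    exact hΘ.mul (hm.mono Set.inter_subset_left)
  lorentzian z hz := by
    have hd := (h.isMetricFrame h0).nondegenerate z hz
    -- The metric is $\omega\eta\omega^T$ for the physical coframe, so its transpose serves as the
    -- congruence.
    refine ⟨((u.phys τ₀).om z).transpose, ?_, ?_⟩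
    · rw [Matrix.det_transpose]
      exact (Matrix.isUnit_nonsing_inv_det _ (isUnit_iff_ne_zero.2 hd)).ne_zero
    · rw [Matrix.transpose_transpose, ← IsMetricFrame.metric_eq, phys_metric u τ₀ hz.2]
  einstein z hz μ ν := by
    rw [ricci_congr (fun y hy => (phys_metric u τ₀ hy.2).symm) μ ν hz,
      (h.isMetricFrame h0).ricci_eq hz, ← phys_metric u τ₀ hz.2]
    simp only [h.ricci_trace hz (h0 z hz.1), LocalFields.metric, Matrix.of_apply, Finset.mul_sum,
      LocalFields.om]
    exact Finset.sum_congr rfl fun a _ => Finset.sum_congr rfl fun b _ => by ring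

end ConformalEFE

theorem mainTheorem4
    {M : Type*} [TopologicalSpace M] [T2Space M] [CompactSpace M]
    [ChartedSpace ConformalEFE.Space M] [IsManifold (𝓡 3) ∞ M]
    (m : ℕ) (hm : 4 ≤ m) (τ₀ τs τe : ℝ) (hτ : τs < τe)
    (hΘ : ConformalEFE.Theta τ₀ τs ≠ 0)
    (u : ConformalEFE.Fields M)
    (hu : u.IsEvolutionSolution (m - 2) τ₀ τs τe)
    (hdata : u.HasConstrainedData τ₀ τs τe) :
    ∀ φ ∈ IsManifold.maximalAtlas (𝓡 3) ∞ M,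
      (∀ z ∈ ConformalEFE.chartDomain τs τe φ, ((u.inChart φ).frameMatrix z).det ≠ 0) ∧
      ConformalEFE.SolvesVacuumEFE (m - 2) 3 (ConformalEFE.physDomain τ₀ τs τe φ)
        ((u.inChart φ).physMetric τ₀) := by
  intro φ hφ
  have H : ∀ ψ ∈ IsManifold.maximalAtlas (𝓡 3) ∞ M,
      ConformalEFE.LocalSolution (u.inChart ψ) τ₀ τs τe ψ.target :=
    fun ψ hψ => ConformalEFE.localSolution_inChart hm hτ hΘ hu hdata hψ
  -- `chartDomain` and `physDomain` agree by definition with `slab` and `physSlab` over the target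
  -- of the chart.
  exact ⟨fun z hz => (H φ hφ).frame_nondegenerate hz, (H φ hφ).solvesVacuumEFE (hu φ hφ).1.e
    fun z hz i => ConformalEFE.zeroQty_inChart H hφ hz i⟩
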